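/- Let $G=(V,E)$ be a finite simple undirected graph. A non-empty set $S\subseteq V$ is a \emph{safe set} of $G$ if there are no connected component $C$ of $G[S]$ and connected component $D$ of $G-S$ such that $C$ and $D$ are joined by an edge of $G$ and $|C|<|D|$. Let $\mathsf{s}(G)$ denote the minimum size of a safe set of a graph $G$ with at least one vertex. Then \textsc{Safe Set} can be solved in $O^*(2^k k^{3k})$ time, where $k$ is the solution size and $0^0=1$. That is, on a random access machine on which each step takes unit time and the only arithmetic operations are increment and decrement, there is a polynomial $p$ such that the following hold. (1) There is a deterministic algorithm that, given a graph $G$ with $n\ge 0$ vertices (by its adjacency matrix) and an integer $k\ge 0$, decides in at most $2^k k^{3k}\,p(n)$ steps whether $G$ has a safe set of size at most $k$, and outputs such a set if one exists. (2) There is a deterministic algorithm that, given a graph $G$ with $n\ge 1$ vertices, outputs a safe set of $G$ of minimum size $k=\mathsf{s}(G)$ in at most $2^{k} k^{3k}\,p(n)$ steps. -/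

import Mathlib

/-! ### Safe sets -/

namespace SafeSet

/-- `S` is a safe set of the finite graph `G`: it is non-empty, and no connected component `C` of
`G[S]` is adjacent to a connected component `D` of `G - S` with `|C| < |D|`. -/
def IsSafeSet {V : Type*} [Finite V] (G : SimpleGraph V) (S : Set V) : Prop :=
  S.Nonempty ∧
    ∀ (C : (G.induce S).ConnectedComponent) (D : (G.induce Sᶜ).ConnectedComponent),
      (∃ a ∈ C.supp, ∃ b ∈ D.supp, G.Adj a b) → ¬ C.supp.ncard < D.supp.ncard

/-- The safe number `s(G)`: the size of a minimum safe set. (If `G` has at least one vertex, then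
the set of all vertices is a safe set, so that the infimum is a minimum.) -/
noncomputable def safeNumber {V : Type*} [Finite V] (G : SimpleGraph V) : ℕ :=
  sInf {m | ∃ S : Set V, IsSafeSet G S ∧ S.ncard = m}

/-! ### Random access machine programs and their running time

The machine has registers `0, 1, 2, …` and arrays `0, 1, 2, …`, each array with two indices; all
cells hold natural numbers. A program is a fixed finite text, so that it uses a fixed finite number
of registers and arrays, and array entries are addressed indirectly, by the contents of registers.
Every instruction, and every evaluation of a test, takes one time unit. The only arithmetic
operations are `+ 1` and truncated `- 1`, so that in `t` steps no value can exceed its start value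
by more than `t` (up to the fixed constants in the program): unit cost does not hide any
computation with long numbers. -/

/-- A memory state: contents of the registers and of the arrays. -/
structure State where
  reg : ℕ → ℕ
  arr : ℕ → ℕ → ℕ → ℕ

/-- Overwrite register `x` by the value `v`. -/
def State.setReg (s : State) (x v : ℕ) : State :=
  { s with reg := fun y => if y = x then v else s.reg y }

/-- Overwrite the entry `(i, j)` of array `a` by the value `v`. -/
def State.setArr (s : State) (a i j v : ℕ) : State :=
  { s with arr := fun b i' j' => if b = a ∧ i' = i ∧ j' = j then v else s.arr b i' j' }

/-- Programs. Here `x`, `y`, `i`, `j` are numbers of registers, `a` is the number of an array. -/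
inductive Prog where
  /-- `x := c` -/
  | const (x c : ℕ)
  /-- `x := y` -/
  | copy (x y : ℕ)
  /-- `x := x + 1` -/
  | inc (x : ℕ)
  /-- `x := x - 1`, where `0 - 1 = 0` -/
  | dec (x : ℕ)
  /-- `x := a[i, j]` -/
  | load (x a i j : ℕ)
  /-- `a[i, j] := x` -/
  | store (a i j x : ℕ)
  /-- first `p`, then `q` -/
  | seq (p q : Prog)
  /-- `if x < y then p else q` -/
  | ifLt (x y : ℕ) (p q : Prog)
  /-- `while x < y do p` -/
  | whileLt (x y : ℕ) (p : Prog)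

/-- `Exec p s s' t`: program `p`, started in state `s`, halts in state `s'` after exactly `t`
steps. -/
inductive Exec : Prog → State → State → ℕ → Prop where
  | const (s : State) (x c : ℕ) : Exec (.const x c) s (s.setReg x c) 1
  | copy (s : State) (x y : ℕ) : Exec (.copy x y) s (s.setReg x (s.reg y)) 1
  | inc (s : State) (x : ℕ) : Exec (.inc x) s (s.setReg x (s.reg x + 1)) 1
  | dec (s : State) (x : ℕ) : Exec (.dec x) s (s.setReg x (s.reg x - 1)) 1
  | load (s : State) (x a i j : ℕ) :
      Exec (.load x a i j) s (s.setReg x (s.arr a (s.reg i) (s.reg j))) 1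
  | store (s : State) (a i j x : ℕ) :
      Exec (.store a i j x) s (s.setArr a (s.reg i) (s.reg j) (s.reg x)) 1
  | seq {p q : Prog} {s s' s'' : State} {t t' : ℕ} :
      Exec p s s' t → Exec q s' s'' t' → Exec (.seq p q) s s'' (t + t')
  | ifLt_true {x y : ℕ} {p q : Prog} {s s' : State} {t : ℕ} :
      s.reg x < s.reg y → Exec p s s' t → Exec (.ifLt x y p q) s s' (t + 1)
  | ifLt_false {x y : ℕ} {p q : Prog} {s s' : State} {t : ℕ} :
      ¬ s.reg x < s.reg y → Exec q s s' t → Exec (.ifLt x y p q) s s' (t + 1)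
  | while_true {x y : ℕ} {p : Prog} {s s' s'' : State} {t t' : ℕ} :
      s.reg x < s.reg y → Exec p s s' t → Exec (.whileLt x y p) s' s'' t' →
        Exec (.whileLt x y p) s s'' (t + t' + 1)
  | while_false {x y : ℕ} {p : Prog} {s : State} :
      ¬ s.reg x < s.reg y → Exec (.whileLt x y p) s s 1

/-- The machine is deterministic: final state and running time are determined by the program and
the initial state. -/
theorem Exec.deterministic {p : Prog} {s s₁ s₂ : State} {t₁ t₂ : ℕ}
    (h₁ : Exec p s s₁ t₁) (h₂ : Exec p s s₂ t₂) : s₁ = s₂ ∧ t₁ = t₂ := by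
  induction h₁ generalizing s₂ t₂ with
  | const | copy | inc | dec | load | store => cases h₂; exact ⟨rfl, rfl⟩
  | seq _ _ ih ih' =>
    cases h₂ with
    | seq k k' =>
      obtain ⟨rfl, rfl⟩ := ih k
      obtain ⟨rfl, rfl⟩ := ih' k'
      exact ⟨rfl, rfl⟩
  | ifLt_true h _ ih =>
    cases h₂ with
    | ifLt_true _ k => obtain ⟨rfl, rfl⟩ := ih k; exact ⟨rfl, rfl⟩
    | ifLt_false k => exact absurd h k
  | ifLt_false h _ ih =>
    cases h₂ with
    | ifLt_true k => exact absurd k h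
    | ifLt_false _ k => obtain ⟨rfl, rfl⟩ := ih k; exact ⟨rfl, rfl⟩
  | while_true h _ _ ih ih' =>
    cases h₂ with
    | while_true _ k k' =>
      obtain ⟨rfl, rfl⟩ := ih k
      obtain ⟨rfl, rfl⟩ := ih' k'
      exact ⟨rfl, rfl⟩
    | while_false k => exact absurd h k
  | while_false h =>
    cases h₂ with
    | while_true k => exact absurd k h
    | while_false => exact ⟨rfl, rfl⟩

/-! ### Input and output -/

open Classical in
/-- The initial state for a graph on the vertices `0, …, n - 1` and a number `k`: register `0` holds
`n`, register `1` holds `k`, array `0` holds the adjacency matrix, all other cells are zero. -/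
noncomputable def inputState {n : ℕ} (G : SimpleGraph (Fin n)) (k : ℕ) : State where
  reg x := if x = 0 then n else if x = 1 then k else 0
  arr a i j :=
    if a = 0 ∧ ∃ u v : Fin n, (u : ℕ) = i ∧ (v : ℕ) = j ∧ G.Adj u v then 1 else 0

/-- The vertex set that a final state describes: `v` is in it if `a[v, 0]` is nonzero, where `a` is
array `1`. -/
def outputSet (n : ℕ) (s : State) : Set (Fin n) :=
  {v | s.arr 1 v 0 ≠ 0}

end SafeSet

/-! ### A small structured language

Expressions and commands with bounded loops, together with a compiler to `Prog`. Scratch registers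
of compiled code are those from a given level on. -/

namespace SafeSet

/-! Let T be a minimum safe set and K = |T|. The part of T in one connected component of G is again
safe (`Safe.inter`), so by minimality T lies in a single component of G. Some data about T, in the
form of three strings of K digits with K + 1 possible values each, are guessed by exhaustive
enumeration; a set that is as good as T is then found with a further factor 2 ^ K and polynomial
overhead.

Branching (`exists_grow_mem`, `exists_isRun`). Start with S = {r} for some r in T. Suppose that some
a in S has a neighbour v outside S whose component in G - S has more than c vertices, where c is the
size of the component of a in T. Grow a connected set from v outside S, one vertex at a time. One of
its first c + 1 vertices lies in T, since otherwise they would form a connected set outside T that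
is too large for the component of a. The index of such a vertex is at most c ≤ K; it is guessed, and
the vertex joins S. The number c is available because the guess also tells how the K slots, one for
each vertex of T, are divided into the components of T. All vertices added lie in T, so the process
stops with S contained in T and no such v left.

Completion. Every component of G - S that meets T is now adjacent to S and hence has at most K
vertices and at most 2 ^ K subsets. The rest of T splits into pieces, one in each of these
components, numbered from 1 by their least vertices. Of a piece only the following matters: which
vertices of S it links, how much it adds to each component of T that meets S, its size, and that it
does not violate safety locally (`Fits`). The links needed form a forest of pointers on the slots of
S (`exists_parents`), where each slot carries the number of a piece that realises the link to its
parent; any other slot points to the root of its component and carries the number of its piece.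
These are the strings of pointers and times (`exists_isScheme`). Conversely, any sets in distinct
components that meet these demands complete S to a safe set with at most K vertices
(`IsScheme.safe_union`). They are found greedily: the vertices are scanned in order, and the next
piece is put into the first component that admits one. The greedy choice is never behind the true
pieces (`pieces_spec`).

The result of each guess is verified (`attempt_iff`), so wrong guesses do no harm. Sizes 1, 2, 3, …
are tried up to the first success or the given bound. A search for size K costs 2 ^ K (K + 1) ^ (3
K) up to a polynomial factor, and (K + 1) ^ (3 K) ≤ 27 K ^ (3 K) because (1 + 1 / K) ^ K < 3
(`add_one_pow_le`).

For the machine, the algorithm is written in a language of bounded loops whose compilation is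
verified once (`Cmd.exec`). Its running time is read off from the nesting depth of the loops over
the registers that hold (K + 1) ^ K and 2 ^ K (`Cmd.time_le`). -/

/-- Expressions over a state. `cnt x e` counts the values `i < reg 0` of the bound register `x` for
which `e` is nonzero. -/
inductive Exp where
  | reg (x : ℕ)
  | num (c : ℕ)
  | succ (e : Exp)
  | get (a : ℕ) (e f : Exp)
  | lt (e f : Exp)
  | ite (e f g : Exp)
  | cnt (x : ℕ) (e : Exp)

namespace Exp

/-- The value of an expression. -/
def eval : Exp → State → ℕ
  | reg x, s => s.reg x
  | num c, _ => c
  | succ e, s => e.eval s + 1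
  | get a e f, s => s.arr a (e.eval s) (f.eval s)
  | lt e f, s => if e.eval s < f.eval s then 1 else 0
  | ite e f g, s => if e.eval s ≠ 0 then f.eval s else g.eval s
  | cnt x e, s => ((Finset.range (s.reg 0)).filter fun i => e.eval (s.setReg x i) ≠ 0).card

/-- All registers that occur are below `d`, and register `0` is not bound. -/
def ok (d : ℕ) : Exp → Bool
  | reg x => decide (x < d)
  | num _ => true
  | succ e => e.ok d
  | get _ e f => e.ok d && f.ok d
  | lt e f => e.ok d && f.ok d
  | ite e f g => e.ok d && f.ok d && g.ok d
  | cnt x e => decide (x ≠ 0) && decide (x < d) && decide (0 < d) && e.ok d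

/-- The arrays that are read. -/
def arrs : Exp → List ℕ
  | reg _ => []
  | num _ => []
  | succ e => e.arrs
  | get a e f => a :: (e.arrs ++ f.arrs)
  | lt e f => e.arrs ++ f.arrs
  | ite e f g => e.arrs ++ (f.arrs ++ g.arrs)
  | cnt _ e => e.arrs

/-- Code that writes the value of the expression into register `d`. -/
def comp : Exp → ℕ → Prog
  | reg x, d => .copy d x
  | num c, d => .const d c
  | succ e, d => .seq (e.comp d) (.inc d)
  | get a e f, d => .seq (e.comp d) (.seq (f.comp (d + 1)) (.load d a d (d + 1)))
  | lt e f, d =>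
    .seq (e.comp d) (.seq (f.comp (d + 1)) (.ifLt d (d + 1) (.const d 1) (.const d 0)))
  | ite e f g, d =>
    .seq (.const d 0) (.seq (e.comp (d + 1)) (.ifLt d (d + 1) (f.comp d) (g.comp d)))
  | cnt x e, d =>
    .seq (.const d 0) (.seq (.const (d + 1) 0) (.seq (.copy (d + 2) 0) (.seq (.copy (d + 3) x)
      (.seq (.whileLt (d + 1) (d + 2)
        (.seq (.copy x (d + 1)) (.seq (e.comp (d + 5)) (.seq (.const (d + 4) 0)
          (.seq (.ifLt (d + 4) (d + 5) (.inc d) (.const (d + 4) 0)) (.inc (d + 1)))))))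
        (.copy x (d + 3))))))

/-- A bound on the running time of the code, as a polynomial in the content of register `0`. -/
noncomputable def cost : Exp → Polynomial ℕ
  | reg _ => 1
  | num _ => 1
  | succ e => e.cost + 1
  | get _ e f => e.cost + f.cost + 1
  | lt e f => e.cost + f.cost + 2
  | ite e f g => e.cost + f.cost + g.cost + 2
  | cnt _ e => Polynomial.X * (e.cost + 6) + 6

end Exp

/-! ### Correctness of compiled expressions -/

/-- The states agree on all arrays and on the registers below `d`. -/
def Agree (d : ℕ) (s s' : State) : Prop :=
  (∀ x < d, s.reg x = s'.reg x) ∧ s.arr = s'.arr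

theorem State.setReg_reg (s : State) (x v y : ℕ) :
    (s.setReg x v).reg y = if y = x then v else s.reg y := rfl

@[simp] theorem State.setReg_arr (s : State) (x v : ℕ) : (s.setReg x v).arr = s.arr := rfl

@[simp] theorem State.setArr_reg (s : State) (a i j v : ℕ) : (s.setArr a i j v).reg = s.reg := rfl

theorem State.setArr_arr (s : State) (a i j v b i' j' : ℕ) :
    (s.setArr a i j v).arr b i' j' = if b = a ∧ i' = i ∧ j' = j then v else s.arr b i' j' := rfl

theorem Agree.trans {d : ℕ} {s s' s'' : State} (h : Agree d s s') (h' : Agree d s' s'') :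
    Agree d s s'' :=
  ⟨fun x hx => (h.1 x hx).trans (h'.1 x hx), h.2.trans h'.2⟩

theorem Agree.mono {d d' : ℕ} {s s' : State} (h : Agree d s s') (hd : d' ≤ d) : Agree d' s s' :=
  ⟨fun x hx => h.1 x (hx.trans_le hd), h.2⟩

theorem Agree.setReg {d : ℕ} {s s' : State} (h : Agree d s s') (x v : ℕ) :
    Agree d (s.setReg x v) (s'.setReg x v) :=
  ⟨fun y hy => by simp only [State.setReg_reg, h.1 y hy], h.2⟩

theorem Agree.setArr {d : ℕ} {s s' : State} (h : Agree d s s') (a i j v : ℕ) :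
    Agree d (s.setArr a i j v) (s'.setArr a i j v) :=
  ⟨h.1, by funext b i' j'; simp only [State.setArr_arr, h.2]⟩

theorem Exp.ok_mono {d d' : ℕ} (hd : d ≤ d') {e : Exp} (h : e.ok d) : e.ok d' := by
  induction e with
  | reg x => simp only [Exp.ok, decide_eq_true_eq] at *; omega
  | num => rfl
  | succ e ih => exact ih h
  | get a e f ih ih' | lt e f ih ih' =>
    simp only [Exp.ok, Bool.and_eq_true] at *; exact ⟨ih h.1, ih' h.2⟩
  | ite e f g ih ih' ih'' =>
    simp only [Exp.ok, Bool.and_eq_true] at *; exact ⟨⟨ih h.1.1, ih' h.1.2⟩, ih'' h.2⟩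
  | cnt x e ih =>
    simp only [Exp.ok, Bool.and_eq_true, decide_eq_true_eq] at *
    exact ⟨⟨⟨h.1.1.1, by omega⟩, by omega⟩, ih h.2⟩

/-- The value depends only on the registers below `d` and the arrays that are read. -/
theorem Exp.eval_congr {d : ℕ} {e : Exp} (h : e.ok d) {s s' : State}
    (hr : ∀ x < d, s.reg x = s'.reg x) (ha : ∀ a ∈ e.arrs, s.arr a = s'.arr a) :
    e.eval s = e.eval s' := by
  induction e generalizing s s' with
  | reg x => exact hr x (by simpa [Exp.ok] using h)
  | num => rfl
  | succ e ih => simp only [Exp.eval, ih h hr ha]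
  | get a e f ih ih' =>
    simp only [Exp.ok, Bool.and_eq_true] at h
    simp only [Exp.arrs, List.mem_cons, List.mem_append] at ha
    simp only [Exp.eval, ih h.1 hr fun a h => ha a (by
        tauto), ih' h.2 hr fun a h => ha a (by tauto),
      ha a (by tauto)]
  | lt e f ih ih' =>
    simp only [Exp.ok, Bool.and_eq_true] at h
    simp only [Exp.arrs, List.mem_append] at ha
    simp only [Exp.eval, ih h.1 hr fun a h => ha a (by
        tauto), ih' h.2 hr fun a h => ha a (by tauto)]
  | ite e f g ih ih' ih'' =>
    simp only [Exp.ok, Bool.and_eq_true] at h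
    simp only [Exp.arrs, List.mem_append] at ha
    simp only [Exp.eval, ih h.1.1 hr fun a h => ha a (by tauto),
      ih' h.1.2 hr fun a h => ha a (by tauto), ih'' h.2 hr fun a h => ha a (by tauto)]
  | cnt x e ih =>
    simp only [Exp.ok, Bool.and_eq_true, decide_eq_true_eq] at h
    simp only [Exp.eval]
    rw [hr 0 h.1.2]
    congr 1
    refine Finset.filter_congr fun i _ => ?_
    rw [ih h.2 (s := s.setReg x i) (s' := s'.setReg x i)
      (fun y hy => by simp only [State.setReg_reg, hr y hy]) ha]

theorem Exp.eval_agree {d : ℕ} {e : Exp} (h : e.ok d) {s s' : State} (hs : Agree d s s') :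
    e.eval s = e.eval s' :=
  Exp.eval_congr h hs.1 fun a _ => by rw [hs.2]

/-- A counting loop: the invariant `I i` holds before the `i`-th iteration. -/
theorem exec_while {x y : ℕ} {p : Prog} {N : ℕ} {I : ℕ → State → Prop} {T : ℕ → ℕ}
    (hI : ∀ i s, I i s → s.reg x = i ∧ s.reg y = N)
    (hp : ∀ i < N, ∀ s, I i s → ∃ s' t, Exec p s s' t ∧ t ≤ T i ∧ I (i + 1) s')
    {s : State} (hs : I 0 s) :
    ∃ s' t, Exec (.whileLt x y p) s s' t ∧ t ≤ (∑ i ∈ Finset.range N, (T i + 1)) + 1 ∧ I N s' := by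
  -- Induction on the number `m` of remaining iterations, because `Exec` peels off the first
  -- iteration of a loop.
  have key : ∀ m i, i + m = N → ∀ s, I i s → ∃ s' t, Exec (.whileLt x y p) s s' t ∧
      t ≤ (∑ i ∈ Finset.Ico i N, (T i + 1)) + 1 ∧ I N s' := by
    intro m
    induction m with
    | zero =>
      intro i hi s hs
      obtain rfl : i = N := by omega
      refine ⟨s, 1, .while_false ?_, by simp, hs⟩
      obtain ⟨h1, h2⟩ := hI _ _ hs
      omega
    | succ m ih =>
      intro i hi s hs
      obtain ⟨h1, h2⟩ := hI _ _ hs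
      obtain ⟨s1, t1, e1, ht1, hs1⟩ := hp i (by omega) s hs
      obtain ⟨s2, t2, e2, ht2, hs2⟩ := ih (i + 1) (by omega) s1 hs1
      refine ⟨s2, t1 + t2 + 1, .while_true (by omega) e1 e2, ?_, hs2⟩
      rw [Finset.sum_eq_sum_Ico_succ_bot (by omega)]
      omega
  have := key N 0 (by omega) s hs
  rwa [← Finset.range_eq_Ico] at this

/-- Code at level `d` delivers its value in register `d` and spoils no register below it, so an
operand kept in `d` survives while the next one is computed at `d + 1`. The time bound depends on
register `0` only, because `cnt` is the only loop and never changes that register. -/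
theorem Exp.exec {e : Exp} {d : ℕ} (h : e.ok d) (hd : 0 < d) (s : State) :
    ∃ s' t, Exec (e.comp d) s s' t ∧ t ≤ e.cost.eval (s.reg 0) ∧ s'.reg d = e.eval s ∧
      Agree d s' s := by
  induction e generalizing d s with
  | reg x =>
    refine ⟨_, _, .copy s d x, by simp [Exp.cost], by simp [State.setReg_reg, Exp.eval], ?_, rfl⟩
    intro y hy; rw [State.setReg_reg, if_neg hy.ne]
  | num c =>
    refine ⟨_, _, .const s d c, by simp [Exp.cost], by simp [State.setReg_reg, Exp.eval], ?_, rfl⟩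
    intro y hy; rw [State.setReg_reg, if_neg hy.ne]
  | succ e ih =>
    obtain ⟨s1, t1, e1, ht1, hv1, ha1⟩ := ih h hd s
    refine ⟨_, _, .seq e1 (.inc s1 d), by simp [Exp.cost, ht1],
      by simp [State.setReg_reg, Exp.eval, hv1], ?_, ha1.2⟩
    intro y hy; rw [State.setReg_reg, if_neg hy.ne, ha1.1 y hy]
  | get a e f ih ih' =>
    simp only [Exp.ok, Bool.and_eq_true] at h
    obtain ⟨s1, t1, e1, ht1, hv1, ha1⟩ := ih h.1 hd s
    obtain ⟨s2, t2, e2, ht2, hv2, ha2⟩ := ih' (Exp.ok_mono (Nat.le_succ d) h.2) (by omega) s1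
    rw [ha1.1 0 hd] at ht2
    refine ⟨_, _, .seq e1 (.seq e2 (.load s2 d a d (d + 1))), ?_, ?_, ?_, ha2.2.trans ha1.2⟩
    · simp only [Exp.cost, Polynomial.eval_add, Polynomial.eval_one] at *; omega
    · simp only [State.setReg_reg, if_true, Exp.eval]
      rw [hv2, ha2.1 d (by omega), hv1, ha2.2, ha1.2, Exp.eval_agree h.2 ha1]
    · intro y hy; rw [State.setReg_reg, if_neg hy.ne, ha2.1 y (by omega), ha1.1 y hy]
  | lt e f ih ih' =>
    simp only [Exp.ok, Bool.and_eq_true] at h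
    obtain ⟨s1, t1, e1, ht1, hv1, ha1⟩ := ih h.1 hd s
    obtain ⟨s2, t2, e2, ht2, hv2, ha2⟩ := ih' (Exp.ok_mono (Nat.le_succ d) h.2) (by omega) s1
    rw [ha1.1 0 hd] at ht2
    have h1 : s2.reg d = e.eval s := by rw [ha2.1 d (by omega), hv1]
    have h2 : s2.reg (d + 1) = f.eval s := by rw [hv2, Exp.eval_agree h.2 ha1]
    have ht : t1 + (t2 + (1 + 1)) ≤ (Exp.cost (.lt e f)).eval (s.reg 0) := by
      simp only [Exp.cost, Polynomial.eval_add, Polynomial.eval_ofNat] at *; omega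
    have hag : ∀ v, Agree d (s2.setReg d v) s := fun v =>
      ⟨fun y hy => by rw [State.setReg_reg, if_neg hy.ne, ha2.1 y (by omega), ha1.1 y hy],
        ha2.2.trans ha1.2⟩
    by_cases hlt : e.eval s < f.eval s
    · refine ⟨_, _, .seq e1 (.seq e2 (.ifLt_true (by rw [h1, h2]; exact hlt) (.const s2 d 1))),
        ht, by simp [State.setReg_reg, Exp.eval, hlt], hag 1⟩
    · refine ⟨_, _, .seq e1 (.seq e2 (.ifLt_false (by rw [h1, h2]; exact hlt) (.const s2 d 0))),
        ht, by simp [State.setReg_reg, Exp.eval, hlt], hag 0⟩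
  | ite e f g ih ih' ih'' =>
    simp only [Exp.ok, Bool.and_eq_true] at h
    have a0 : Agree d (s.setReg d 0) s :=
      ⟨fun y hy => by rw [State.setReg_reg, if_neg hy.ne], rfl⟩
    obtain ⟨s1, t1, e1, ht1, hv1, ha1⟩ := ih (Exp.ok_mono (Nat.le_succ d) h.1.1) (by omega)
      (s.setReg d 0)
    have a1 : Agree d s1 s := (ha1.mono (by omega)).trans a0
    rw [State.setReg_reg, if_neg hd.ne] at ht1
    have h1 : s1.reg d = 0 := by rw [ha1.1 d (by omega), State.setReg_reg, if_pos rfl]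
    have h2 : s1.reg (d + 1) = e.eval s := by rw [hv1, Exp.eval_agree h.1.1 a0]
    by_cases hc : e.eval s ≠ 0
    · obtain ⟨s2, t2, e2, ht2, hv2, ha2⟩ := ih' h.1.2 hd s1
      rw [a1.1 0 hd] at ht2
      refine ⟨_, _, .seq (.const s d 0) (.seq e1 (.ifLt_true (by omega) e2)), ?_, ?_, ha2.trans a1⟩
      · simp only [Exp.cost, Polynomial.eval_add, Polynomial.eval_ofNat] at *; omega
      · rw [hv2, Exp.eval_agree h.1.2 a1, Exp.eval, if_pos hc]
    · obtain ⟨s2, t2, e2, ht2, hv2, ha2⟩ := ih'' h.2 hd s1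
      rw [a1.1 0 hd] at ht2
      refine ⟨_, _, .seq (.const s d 0) (.seq e1 (.ifLt_false (by omega) e2)), ?_, ?_, ha2.trans a1⟩
      · simp only [Exp.cost, Polynomial.eval_add, Polynomial.eval_ofNat] at *; omega
      · rw [hv2, Exp.eval_agree h.2 a1, Exp.eval, if_neg hc]
  | cnt x e ih =>
    simp only [Exp.ok, Bool.and_eq_true, decide_eq_true_eq] at h
    obtain ⟨⟨⟨hx0, hxd⟩, -⟩, hok⟩ := h
    set N := s.reg 0 with hN
    -- The registers `d + 1`, `d + 2`, `d + 3` hold the counter, the bound and the old content of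
    -- `x`. Register `x` is excepted since the loop uses it as bound variable; it is restored after
    -- the loop.
    let I : ℕ → State → Prop := fun i s' =>
      s'.reg (d + 1) = i ∧ s'.reg (d + 2) = N ∧ s'.reg (d + 3) = s.reg x ∧
      s'.reg d = ((Finset.range i).filter fun i => e.eval (s.setReg x i) ≠ 0).card ∧
      (∀ y < d, y ≠ x → s'.reg y = s.reg y) ∧ s'.arr = s.arr
    set s0 := (((s.setReg d 0).setReg (d + 1) 0).setReg (d + 2) N).setReg (d + 3) (s.reg x)
      with hs0
    have hI0 : I 0 s0 := by
      refine ⟨?_, ?_, ?_, ?_, ?_, rfl⟩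
      · simp [hs0, State.setReg_reg]
      · simp [hs0, State.setReg_reg]
      · simp [hs0, State.setReg_reg]
      · simp [hs0, State.setReg_reg]
      · intro y hy hyx
        simp only [hs0, State.setReg_reg]
        rw [if_neg (by omega), if_neg (by omega), if_neg (by omega), if_neg (by omega)]
    obtain ⟨s1, t1, e1, ht1, hs1⟩ := exec_while (x := d + 1) (y := d + 2) (N := N) (I := I)
      (p := (.seq (.copy x (d + 1)) (.seq (e.comp (d + 5)) (.seq (.const (d + 4) 0)
          (.seq (.ifLt (d + 4) (d + 5) (.inc d) (.const (d + 4) 0)) (.inc (d + 1)))))))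
      (T := fun _ => e.cost.eval N + 5)
      (fun i s hs => ⟨hs.1, hs.2.1⟩) (by
        rintro i hi s' ⟨h1, h2, h3, h4, h5, h6⟩
        obtain ⟨s2, t2, e2, ht2, hv2, ha2⟩ := ih (d := d + 5) (Exp.ok_mono (by omega) hok) (by
            omega)
          (s'.setReg x (s'.reg (d + 1)))
        have hev : s2.reg (d + 5) = e.eval (s.setReg x i) := by
          rw [hv2]
          refine Exp.eval_congr hok (fun y hy => ?_) (fun a _ => by simp [h6])
          simp only [State.setReg_reg, h1]
          split_ifs with hyx
          · rfl
          · exact h5 y hy hyx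
        rw [State.setReg_reg, if_neg hx0.symm, h5 0 hd hx0.symm, ← hN] at ht2
        have hr : ∀ y < d + 5, y ≠ x → s2.reg y = s'.reg y := fun y hy hyx => by
          rw [ha2.1 y hy, State.setReg_reg, if_neg hyx]
        have harr : s2.arr = s.arr := ha2.2.trans h6
        have hfin : ∀ s3 : State, s3.arr = s.arr → (∀ y, y ≠ d → y ≠ d + 4 → s3.reg y = s2.reg y) →
            s3.reg d = ((Finset.range (i + 1)).filter fun i => e.eval (s.setReg x i) ≠ 0).card →
            I (i + 1) (s3.setReg (d + 1) (s3.reg (d + 1) + 1)) := by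
          intro s3 ha3 hr3 hd3
          refine ⟨?_, ?_, ?_, ?_, ?_, ?_⟩
          · rw [State.setReg_reg, if_pos rfl, hr3 _ (by omega) (by omega),
              hr _ (by omega) (by omega), h1]
          · rw [State.setReg_reg, if_neg (by omega), hr3 _ (by omega) (by omega),
              hr _ (by omega) (by omega), h2]
          · rw [State.setReg_reg, if_neg (by omega), hr3 _ (by omega) (by omega),
              hr _ (by omega) (by omega), h3]
          · rw [State.setReg_reg, if_neg (by omega), hd3]
          · intro y hy hyx
            rw [State.setReg_reg, if_neg (by omega), hr3 _ (by omega) (by omega),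
              hr _ (by omega) (by omega), h5 y hy hyx]
          · exact ha3
        have hcard : ((Finset.range (i + 1)).filter fun i => e.eval (s.setReg x i) ≠ 0).card =
            ((Finset.range i).filter fun i => e.eval (s.setReg x i) ≠ 0).card +
              if e.eval (s.setReg x i) ≠ 0 then 1 else 0 := by
          rw [Finset.range_add_one, Finset.filter_insert]
          split_ifs with hc
          · rw [Finset.card_insert_of_notMem (by simp)]
          · rfl
        by_cases hc : e.eval (s.setReg x i) ≠ 0
        · refine ⟨_, _, .seq (.copy s' x (d + 1)) (.seq e2 (.seq (.const s2 (d + 4) 0)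
            (.seq (.ifLt_true ?_ (.inc _ d)) (.inc _ (d + 1))))), ?_, hfin _ ?_ ?_ ?_⟩
          · simp [State.setReg_reg, hev]; omega
          · omega
          · exact harr
          · intro y hy hy'
            simp [State.setReg_reg, hy, hy']
          · rw [hcard, if_pos hc, ← h4, State.setReg_reg, if_pos rfl, State.setReg_reg,
              if_neg (by omega), hr _ (by omega) (by omega)]
        · refine ⟨_, _, .seq (.copy s' x (d + 1)) (.seq e2 (.seq (.const s2 (d + 4) 0)
            (.seq (.ifLt_false ?_ (.const _ (d + 4) 0)) (.inc _ (d + 1))))), ?_, hfin _ ?_ ?_ ?_⟩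
          · simp [State.setReg_reg, hev]; omega
          · omega
          · exact harr
          · intro y hy hy'
            simp [State.setReg_reg, hy']
          · rw [hcard, if_neg hc, ← h4, State.setReg_reg, if_neg (by omega), State.setReg_reg,
              if_neg (by omega), hr _ (by omega) (by omega), add_zero]) hI0
    obtain ⟨h1, h2, h3, h4, h5, h6⟩ := hs1
    have e0 : Exec (.copy (d + 2) 0) ((s.setReg d 0).setReg (d + 1) 0)
        (((s.setReg d 0).setReg (d + 1) 0).setReg (d + 2) N) 1 := by
      convert Exec.copy _ _ _ using 2
      rw [State.setReg_reg, if_neg (by omega), State.setReg_reg, if_neg (by omega)]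
    have e0' : Exec (.copy (d + 3) x) (((s.setReg d 0).setReg (d + 1) 0).setReg (d + 2) N) s0 1 :=
        by
      convert Exec.copy _ _ _ using 2
      rw [State.setReg_reg, if_neg (by omega), State.setReg_reg, if_neg (by omega),
        State.setReg_reg, if_neg (by omega)]
    refine ⟨_, _, .seq (.const s d 0) (.seq (.const _ (d + 1) 0) (.seq e0 (.seq e0'
      (.seq e1 (.copy s1 x (d + 3)))))), ?_, ?_, ?_, h6⟩
    · simp only [Finset.sum_const, Finset.card_range, smul_eq_mul] at ht1
      simp only [Exp.cost, Polynomial.eval_add, Polynomial.eval_ofNat, Polynomial.eval_mul,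
        Polynomial.eval_X]
      have : N * (e.cost.eval N + 5 + 1) = N * (e.cost.eval N + 6) := by ring
      omega
    · rw [State.setReg_reg, if_neg (by omega), h4]; rfl
    · intro y hy
      rw [State.setReg_reg]
      split_ifs with hyx
      · rw [h3, hyx]
      · exact h5 y hy hyx

/-! ### Commands: meaning, running time and compilation -/

/-- Commands. `loop x y c` runs `c` for all values `i` of the register `x` below the value that
register `y` has at the start, and restores `x` in the end. -/
inductive Cmd where
  | skip
  | set (x : ℕ) (e : Exp)
  | put (a : ℕ) (e f g : Exp)
  | seq (c c' : Cmd)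
  | ite (e : Exp) (c c' : Cmd)
  | loop (x y : ℕ) (c : Cmd)

/-- Apply `f 0`, `f 1`, …, `f (k - 1)` in this order. -/
def iter (f : ℕ → State → State) : ℕ → State → State
  | 0, s => s
  | k + 1, s => f k (iter f k s)

namespace Cmd

/-- The state after the command. -/
def run : Cmd → State → State
  | skip, s => s
  | set x e, s => s.setReg x (e.eval s)
  | put a e f g, s => s.setArr a (e.eval s) (f.eval s) (g.eval s)
  | seq c c', s => c'.run (c.run s)
  | ite e c c', s => if e.eval s ≠ 0 then c.run s else c'.run s
  | loop x y c, s => (iter (fun i s => c.run (s.setReg x i)) (s.reg y) s).setReg x (s.reg x)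

/-- A bound on the running time of the compiled command. -/
noncomputable def time : Cmd → State → ℕ
  | skip, _ => 1
  | set _ e, s => e.cost.eval (s.reg 0) + 1
  | put _ e f g, s => (e.cost + f.cost + g.cost).eval (s.reg 0) + 1
  | seq c c', s => c.time s + c'.time (c.run s)
  | ite e c c', s => e.cost.eval (s.reg 0) + 2 + if e.eval s ≠ 0 then c.time s else c'.time s
  | loop x y c, s => (∑ i ∈ Finset.range (s.reg y),
      (c.time ((iter (fun i s => c.run (s.setReg x i)) i s).setReg x i) + 3)) + 5

/-- The registers that are overwritten. -/
def wr : Cmd → List ℕ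
  | skip => []
  | set x _ => [x]
  | put _ _ _ _ => []
  | seq c c' => c.wr ++ c'.wr
  | ite _ c c' => c.wr ++ c'.wr
  | loop _ _ c => c.wr

/-- The arrays that are overwritten. -/
def wa : Cmd → List ℕ
  | skip => []
  | set _ _ => []
  | put a _ _ _ => [a]
  | seq c c' => c.wa ++ c'.wa
  | ite _ c c' => c.wa ++ c'.wa
  | loop _ _ c => c.wa

/-- All registers that occur are below `d`, and register `0` is not overwritten. -/
def ok (d : ℕ) : Cmd → Bool
  | skip => true
  | set x e => decide (x ≠ 0) && decide (x < d) && e.ok d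
  | put _ e f g => e.ok d && f.ok d && g.ok d
  | seq c c' => c.ok d && c'.ok d
  | ite e c c' => e.ok d && c.ok d && c'.ok d
  | loop x y c => decide (x ≠ 0) && decide (x < d) && decide (y < d) && c.ok d

/-- Compilation; registers from `d` on are scratch registers. -/
def comp : Cmd → ℕ → Prog
  | skip, d => .const d 0
  | set x e, d => .seq (e.comp d) (.copy x d)
  | put a e f g, d =>
    .seq (e.comp d) (.seq (f.comp (d + 1)) (.seq (g.comp (d + 2)) (.store a d (d + 1) (d + 2))))
  | seq c c', d => .seq (c.comp d) (c'.comp d)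
  | ite e c c', d =>
    .seq (.const d 0) (.seq (e.comp (d + 1)) (.ifLt d (d + 1) (c.comp d) (c'.comp d)))
  | loop x y c, d =>
    .seq (.copy d y) (.seq (.const (d + 1) 0) (.seq (.copy (d + 2) x)
      (.seq (.whileLt (d + 1) d
        (.seq (.copy x (d + 1)) (.seq (c.comp (d + 3)) (.inc (d + 1)))))
        (.copy x (d + 2)))))

theorem ok_mono {d d' : ℕ} (hd : d ≤ d') {c : Cmd} (h : c.ok d) : c.ok d' := by
  induction c with
  | skip => rfl
  | set x e =>
    simp only [ok, Bool.and_eq_true, decide_eq_true_eq] at *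
    exact ⟨⟨h.1.1, by omega⟩, Exp.ok_mono hd h.2⟩
  | put a e f g =>
    simp only [ok, Bool.and_eq_true] at *
    exact ⟨⟨Exp.ok_mono hd h.1.1, Exp.ok_mono hd h.1.2⟩, Exp.ok_mono hd h.2⟩
  | seq c c' ih ih' =>
    simp only [ok, Bool.and_eq_true] at *
    exact ⟨ih h.1, ih' h.2⟩
  | ite e c c' ih ih' =>
    simp only [ok, Bool.and_eq_true] at *
    exact ⟨⟨Exp.ok_mono hd h.1.1, ih h.1.2⟩, ih' h.2⟩
  | loop x y c ih =>
    simp only [ok, Bool.and_eq_true, decide_eq_true_eq] at *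
    exact ⟨⟨⟨h.1.1.1, by omega⟩, by omega⟩, ih h.2⟩

end Cmd

theorem iter_induction {f : ℕ → State → State} {P : ℕ → State → Prop} {k : ℕ} {s : State}
    (h0 : P 0 s) (hs : ∀ i < k, ∀ s, P i s → P (i + 1) (f i s)) : P k (iter f k s) := by
  induction k with
  | zero => exact h0
  | succ k ih => exact hs k (by omega) _ (ih fun i hi => hs i (by omega))

namespace Cmd

/-- A frame rule. A loop variable does not count as written because it is restored at the end. For
concrete commands the list `wr` can be evaluated, so that the side condition is a matter of
`decide`. -/
theorem run_reg {c : Cmd} {x : ℕ} (h : x ∉ c.wr) (s : State) : (c.run s).reg x = s.reg x := by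
  induction c generalizing s with
  | skip => rfl
  | set y e =>
    simp only [wr, List.mem_singleton] at h
    simp [run, State.setReg_reg, h]
  | put => rfl
  | seq c c' ih ih' =>
    simp only [wr, List.mem_append, not_or] at h
    simp only [run, ih' h.2, ih h.1]
  | ite e c c' ih ih' =>
    simp only [wr, List.mem_append, not_or] at h
    simp only [run]
    split_ifs
    · exact ih h.1 s
    · exact ih' h.2 s
  | loop y z c ih =>
    simp only [run, State.setReg_reg]
    split_ifs with hxy
    · rw [hxy]
    · refine iter_induction (P := fun _ s' => s'.reg x = s.reg x) rfl fun i _ s' hs' => ?_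
      rw [ih h, State.setReg_reg, if_neg hxy, hs']

theorem run_arr {c : Cmd} {a : ℕ} (h : a ∉ c.wa) (s : State) : (c.run s).arr a = s.arr a := by
  induction c generalizing s with
  | skip => rfl
  | set y e => rfl
  | put b e f g =>
    simp only [wa, List.mem_singleton] at h
    funext i j
    simp [run, State.setArr_arr, h]
  | seq c c' ih ih' =>
    simp only [wa, List.mem_append, not_or] at h
    simp only [run, ih' h.2, ih h.1]
  | ite e c c' ih ih' =>
    simp only [wa, List.mem_append, not_or] at h
    simp only [run]
    split_ifs
    · exact ih h.1 s
    · exact ih' h.2 s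
  | loop y z c ih =>
    refine iter_induction (P := fun _ s' => s'.arr a = s.arr a) rfl fun i _ s' hs' => ?_
    rw [ih h, State.setReg_arr, hs']

theorem notMem_wr_of_ok {d : ℕ} {c : Cmd} (h : c.ok d) : ∀ x ∈ c.wr, x < d ∧ x ≠ 0 := by
  induction c with
  | skip => simp [wr]
  | set x e =>
    simp only [ok, Bool.and_eq_true, decide_eq_true_eq] at h
    simpa [wr] using ⟨h.1.2, h.1.1⟩
  | put => simp [wr]
  | seq c c' ih ih' =>
    simp only [ok, Bool.and_eq_true] at h
    intro x hx
    rcases List.mem_append.1 hx with hx | hx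
    exacts [ih h.1 x hx, ih' h.2 x hx]
  | ite e c c' ih ih' =>
    simp only [ok, Bool.and_eq_true] at h
    intro x hx
    rcases List.mem_append.1 hx with hx | hx
    exacts [ih h.1.2 x hx, ih' h.2 x hx]
  | loop x y c ih =>
    simp only [ok, Bool.and_eq_true] at h
    exact ih h.2

/-- Compiled code leaves garbage in the scratch registers. A command that mentions only registers
below `d` does not see it, which is what allows compiled commands to be composed. -/
theorem run_agree {d d' : ℕ} (hd : d ≤ d') {c : Cmd} (h : c.ok d) {s s' : State}
    (hs : Agree d' s s') : Agree d' (c.run s) (c.run s') := by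
  induction c generalizing s s' with
  | skip => exact hs
  | set x e =>
    simp only [ok, Bool.and_eq_true] at h
    simp only [run, Exp.eval_agree (Exp.ok_mono hd h.2) hs]
    exact hs.setReg _ _
  | put b e f g =>
    simp only [ok, Bool.and_eq_true] at h
    simp only [run, Exp.eval_agree (Exp.ok_mono hd h.1.1) hs,
      Exp.eval_agree (Exp.ok_mono hd h.1.2) hs, Exp.eval_agree (Exp.ok_mono hd h.2) hs]
    exact hs.setArr _ _ _ _
  | seq c c' ih ih' =>
    simp only [ok, Bool.and_eq_true] at h
    exact ih' h.2 (ih h.1 hs)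
  | ite e c c' ih ih' =>
    simp only [ok, Bool.and_eq_true] at h
    simp only [run, Exp.eval_agree (Exp.ok_mono hd h.1.1) hs]
    split_ifs
    exacts [ih h.1.2 hs, ih' h.2 hs]
  | loop x y c ih =>
    simp only [ok, Bool.and_eq_true, decide_eq_true_eq] at h
    simp only [run]
    rw [hs.1 x (by omega), hs.1 y (by omega)]
    refine Agree.setReg ?_ _ _
    induction s'.reg y with
    | zero => exact hs
    | succ k ihk => exact ih h.2 (ihk.setReg x k)

theorem time_agree {d : ℕ} {c : Cmd} (h : c.ok d) (hd : 0 < d) {s s' : State}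
    (hs : Agree d s s') : c.time s = c.time s' := by
  induction c generalizing s s' with
  | skip => rfl
  | set x e => simp only [time, hs.1 0 hd]
  | put b e f g => simp only [time, hs.1 0 hd]
  | seq c c' ih ih' =>
    simp only [ok, Bool.and_eq_true] at h
    simp only [time, ih h.1 hs, ih' h.2 (run_agree le_rfl h.1 hs)]
  | ite e c c' ih ih' =>
    simp only [ok, Bool.and_eq_true] at h
    simp only [time, Exp.eval_agree h.1.1 hs, hs.1 0 hd, ih h.1.2 hs, ih' h.2 hs]
  | loop x y c ih =>
    simp only [ok, Bool.and_eq_true, decide_eq_true_eq] at h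
    simp only [time]
    rw [hs.1 y (by omega)]
    have key : ∀ i, Agree d (iter (fun i s => c.run (s.setReg x i)) i s)
        (iter (fun i s => c.run (s.setReg x i)) i s') := by
      intro i
      induction i with
      | zero => exact hs
      | succ k ihk => exact run_agree le_rfl h.2 (ihk.setReg x k)
    congr 1
    exact Finset.sum_congr rfl fun i _ => by rw [ih h.2 ((key i).setReg x i)]

/-- The final states agree below `d` only; `run_agree` and `time_agree` carry this weaker relation
through sequences, branches and loops. -/
theorem exec {c : Cmd} {d : ℕ} (h : c.ok d) (hd : 0 < d) (s : State) :
    ∃ s' t, Exec (c.comp d) s s' t ∧ t ≤ c.time s ∧ Agree d s' (c.run s) := by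
  induction c generalizing d s with
  | skip =>
    refine ⟨_, _, .const s d 0, le_rfl, ?_, rfl⟩
    intro y hy; rw [State.setReg_reg, if_neg hy.ne]; rfl
  | set x e =>
    simp only [ok, Bool.and_eq_true, decide_eq_true_eq] at h
    obtain ⟨s1, t1, e1, ht1, hv1, ha1⟩ := Exp.exec h.2 hd s
    refine ⟨_, _, .seq e1 (.copy s1 x d), by simpa [time] using ht1, ?_⟩
    rw [hv1]
    exact ha1.setReg _ _
  | put a e f g =>
    simp only [ok, Bool.and_eq_true] at h
    obtain ⟨s1, t1, e1, ht1, hv1, ha1⟩ := Exp.exec h.1.1 hd s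
    obtain ⟨s2, t2, e2, ht2, hv2, ha2⟩ := Exp.exec (Exp.ok_mono (Nat.le_succ d) h.1.2)
      (by omega) s1
    obtain ⟨s3, t3, e3, ht3, hv3, ha3⟩ := Exp.exec
      (Exp.ok_mono (show d ≤ d + 2 by omega) h.2) (by omega) s2
    have a2 : Agree d s2 s := (ha2.mono (by omega)).trans ha1
    have a3 : Agree d s3 s := (ha3.mono (by omega)).trans a2
    rw [ha1.1 0 hd] at ht2
    rw [a2.1 0 hd] at ht3
    refine ⟨_, _, .seq e1 (.seq e2 (.seq e3 (.store s3 a d (d + 1) (d + 2)))), ?_, ?_⟩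
    · simp only [time, Polynomial.eval_add]; omega
    · rw [hv3, ha3.1 (d + 1) (by omega), hv2, ha3.1 d (by omega), ha2.1 d (by omega), hv1,
        Exp.eval_agree h.1.2 ha1, Exp.eval_agree h.2 a2]
      exact a3.setArr _ _ _ _
  | seq c c' ih ih' =>
    simp only [ok, Bool.and_eq_true] at h
    obtain ⟨s1, t1, e1, ht1, ha1⟩ := ih h.1 hd s
    obtain ⟨s2, t2, e2, ht2, ha2⟩ := ih' h.2 hd s1
    refine ⟨_, _, .seq e1 e2, ?_, ha2.trans (run_agree le_rfl h.2 ha1)⟩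
    rw [time_agree h.2 hd ha1] at ht2
    simp only [time]; omega
  | ite e c c' ih ih' =>
    simp only [ok, Bool.and_eq_true] at h
    have a0 : Agree d (s.setReg d 0) s :=
      ⟨fun y hy => by rw [State.setReg_reg, if_neg hy.ne], rfl⟩
    obtain ⟨s1, t1, e1, ht1, hv1, ha1⟩ := Exp.exec (Exp.ok_mono (Nat.le_succ d) h.1.1) (by omega)
      (s.setReg d 0)
    have a1 : Agree d s1 s := (ha1.mono (by omega)).trans a0
    rw [State.setReg_reg, if_neg hd.ne] at ht1
    have h1 : s1.reg d = 0 := by rw [ha1.1 d (by omega), State.setReg_reg, if_pos rfl]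
    have h2 : s1.reg (d + 1) = e.eval s := by rw [hv1, Exp.eval_agree h.1.1 a0]
    by_cases hc : e.eval s ≠ 0
    · obtain ⟨s2, t2, e2, ht2, ha2⟩ := ih h.1.2 hd s1
      rw [time_agree h.1.2 hd a1] at ht2
      refine ⟨_, _, .seq (.const s d 0) (.seq e1 (.ifLt_true (by omega) e2)), ?_, ?_⟩
      · simp only [time, if_pos hc]; omega
      · simp only [run, if_pos hc]
        exact ha2.trans (run_agree le_rfl h.1.2 a1)
    · obtain ⟨s2, t2, e2, ht2, ha2⟩ := ih' h.2 hd s1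
      rw [time_agree h.2 hd a1] at ht2
      refine ⟨_, _, .seq (.const s d 0) (.seq e1 (.ifLt_false (by omega) e2)), ?_, ?_⟩
      · simp only [time, if_neg hc]; omega
      · simp only [run, if_neg hc]
        exact ha2.trans (run_agree le_rfl h.2 a1)
  | loop x y c ih =>
    simp only [ok, Bool.and_eq_true, decide_eq_true_eq] at h
    obtain ⟨⟨⟨hx0, hxd⟩, hyd⟩, hok⟩ := h
    set N := s.reg y with hN
    let J : ℕ → State := fun i => iter (fun i s => c.run (s.setReg x i)) i s
    -- The registers `d`, `d + 1`, `d + 2` hold the number of iterations, the counter and the old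
    -- content of `x`. They survive the body, which is compiled at level `d + 3` and writes no
    -- register in between (`hwr`).
    let I : ℕ → State → Prop := fun i s' =>
      s'.reg (d + 1) = i ∧ s'.reg d = N ∧ s'.reg (d + 2) = s.reg x ∧ Agree d s' (J i)
    set s0 := ((s.setReg d N).setReg (d + 1) 0).setReg (d + 2) (s.reg x) with hs0
    have hI0 : I 0 s0 := by
      refine ⟨?_, ?_, ?_, ?_, rfl⟩
      · simp [hs0, State.setReg_reg]
      · simp [hs0, State.setReg_reg]
      · simp [hs0, State.setReg_reg]
      · intro y hy
        simp only [hs0, State.setReg_reg]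
        rw [if_neg (by omega), if_neg (by omega), if_neg (by omega)]; rfl
    have hwr : ∀ z, d ≤ z → z ∉ c.wr := fun z hz hz' => by
      have := (notMem_wr_of_ok hok z hz').1; omega
    obtain ⟨s1, t1, e1, ht1, hs1⟩ := exec_while (x := d + 1) (y := d) (N := N) (I := I)
      (p := .seq (.copy x (d + 1)) (.seq (c.comp (d + 3)) (.inc (d + 1))))
      (T := fun i => c.time ((J i).setReg x i) + 2)
      (fun i s hs => ⟨hs.1, hs.2.1⟩) (by
        rintro i hi s' ⟨h1, h2, h3, h4⟩
        obtain ⟨s2, t2, e2, ht2, ha2⟩ := ih (d := d + 3) (ok_mono (by omega) hok) (by omega)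
          (s'.setReg x i)
        have a2 : Agree d s2 (J (i + 1)) :=
          (ha2.mono (by omega)).trans (run_agree le_rfl hok (h4.setReg x i))
        have hr : ∀ z, d ≤ z → z < d + 3 → s2.reg z = s'.reg z := fun z hz hz' => by
          rw [ha2.1 z hz', run_reg (hwr z hz), State.setReg_reg, if_neg (by omega)]
        rw [time_agree hok hd (h4.setReg x i)] at ht2
        have ec : Exec (.copy x (d + 1)) s' (s'.setReg x i) 1 := h1 ▸ Exec.copy s' x (d + 1)
        refine ⟨_, _, .seq ec (.seq e2 (.inc _ (d + 1))), by omega, ?_⟩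
        refine ⟨?_, ?_, ?_, ?_, a2.2⟩
        · rw [State.setReg_reg, if_pos rfl, hr _ (by omega) (by omega), h1]
        · rw [State.setReg_reg, if_neg (by omega), hr _ (by omega) (by omega), h2]
        · rw [State.setReg_reg, if_neg (by omega), hr _ (by omega) (by omega), h3]
        · intro z hz
          rw [State.setReg_reg, if_neg (by omega), a2.1 z hz]) hI0
    obtain ⟨h1, h2, h3, h4⟩ := hs1
    have e0 : Exec (.copy (d + 2) x) ((s.setReg d N).setReg (d + 1) 0) s0 1 := by
      convert Exec.copy _ _ _ using 2
      rw [State.setReg_reg, if_neg (by omega), State.setReg_reg, if_neg (by omega)]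
    refine ⟨_, _, .seq (.copy s d y) (.seq (.const _ (d + 1) 0) (.seq e0
      (.seq e1 (.copy s1 x (d + 2))))), ?_, ?_⟩
    · simp only [time]
      rw [← hN]
      change t1 ≤ (∑ i ∈ Finset.range N, (c.time ((J i).setReg x i) + 3)) + 1 at ht1
      change _ ≤ (∑ i ∈ Finset.range N, (c.time ((J i).setReg x i) + 3)) + 5
      omega
    · rw [h3]
      exact h4.setReg _ _

end Cmd

end SafeSet

/-! ### Connectivity with respect to a vertex set -/

namespace SafeSet

theorem card_le_of_forall_lt {n : ℕ} {T : Finset ℕ} (h : ∀ x ∈ T, x < n) : T.card ≤ n := by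
  have := Finset.card_le_card (t := Finset.range n) fun x hx => Finset.mem_range.2 (h x hx)
  rwa [Finset.card_range] at this

/-- `A` is the adjacency relation of an undirected graph on `0, …, n - 1`. -/
structure IsGraph (n : ℕ) (A : ℕ → ℕ → Prop) : Prop where
  lt : ∀ {a b}, A a b → a < n
  symm : ∀ {a b}, A a b → A b a

theorem IsGraph.lt' {n : ℕ} {A : ℕ → ℕ → Prop} (hA : IsGraph n A) {a b : ℕ} (h : A a b) : b < n :=
  hA.lt (hA.symm h)

/-- `a` and `b` are on the same side of `Y` and connected on this side. -/
def Conn (A : ℕ → ℕ → Prop) (Y : Set ℕ) : ℕ → ℕ → Prop :=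
  Relation.ReflTransGen fun x y => A x y ∧ (x ∈ Y ↔ y ∈ Y)

open Classical in
/-- The number of vertices connected to `a` on its side of `Y`. -/
noncomputable def csize (n : ℕ) (A : ℕ → ℕ → Prop) (Y : Set ℕ) (a : ℕ) : ℕ :=
  ((Finset.range n).filter fun b => Conn A Y a b).card

/-- No component of the complement of `Y` is larger than an adjacent component of `Y`. -/
def Safe (n : ℕ) (A : ℕ → ℕ → Prop) (Y : Set ℕ) : Prop :=
  ∀ a ∈ Y, ∀ b ∉ Y, A a b → csize n A Y b ≤ csize n A Y a

section Conn

variable {n : ℕ} {A : ℕ → ℕ → Prop} {Y Z : Set ℕ} {a b c : ℕ}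

theorem Conn.refl (a : ℕ) : Conn A Y a a := Relation.ReflTransGen.refl

theorem Conn.trans (h : Conn A Y a b) (h' : Conn A Y b c) : Conn A Y a c :=
  Relation.ReflTransGen.trans h h'

theorem Conn.single (h : A a b) (h' : a ∈ Y ↔ b ∈ Y) : Conn A Y a b :=
  Relation.ReflTransGen.single ⟨h, h'⟩

theorem Conn.symm (hA : IsGraph n A) (h : Conn A Y a b) : Conn A Y b a := by
  induction h with
  | refl => exact .refl _
  | tail _ h ih => exact (Conn.single (hA.symm h.1) h.2.symm).trans ih

theorem Conn.mem_iff (h : Conn A Y a b) : a ∈ Y ↔ b ∈ Y := by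
  induction h with
  | refl => rfl
  | tail _ h ih => exact ih.trans h.2

theorem Conn.lt (hA : IsGraph n A) (h : Conn A Y a b) (ha : a < n) : b < n := by
  induction h with
  | refl => exact ha
  | tail _ h _ => exact hA.lt' h.1

/-- A connection survives a change of the set that does not separate its vertices. -/
theorem Conn.of_forall (h : Conn A Y a b) (hZ : ∀ x, Conn A Y a x → (x ∈ Z ↔ a ∈ Z)) :
    Conn A Z a b := by
  induction h with
  | refl => exact .refl _
  | tail h h' ih =>
    exact ih.trans (.single h'.1 ((hZ _ h).trans (hZ _ (h.tail h')).symm))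

/-- Enlarging the set merges components inside it and, dually (`Conn.anti`), breaks up components
outside it. Both comparisons drive the size estimates below. -/
theorem Conn.mono (h : Conn A Y a b) (hYZ : Y ⊆ Z) (ha : a ∈ Y) : Conn A Z a b :=
  h.of_forall fun _ hx => iff_of_true (hYZ (hx.mem_iff.1 ha)) (hYZ ha)

theorem Conn.anti (h : Conn A Z a b) (hYZ : Y ⊆ Z) (ha : a ∉ Z) : Conn A Y a b :=
  h.of_forall fun _ hx => iff_of_false (fun h => ha (hx.mem_iff.2 (hYZ h))) fun h => ha (hYZ h)

/-- A connection from inside `W` to outside `W` crosses the boundary of `W`. -/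
theorem Conn.exists_crossing (h : Conn A Y a b) {W : Set ℕ} (ha : a ∈ W) (hb : b ∉ W) :
    ∃ x y, Conn A Y a x ∧ A x y ∧ (x ∈ Y ↔ y ∈ Y) ∧ x ∈ W ∧ y ∉ W := by
  induction h with
  | refl => exact absurd ha hb
  | @tail c d h h' ih =>
    by_cases hc : c ∈ W
    · exact ⟨c, d, h, h'.1, h'.2, hc, hb⟩
    · exact ih hc

theorem csize_le {a b : ℕ} (h : ∀ x < n, Conn A Y a x → Conn A Z b x) :
    csize n A Y a ≤ csize n A Z b := by
  classical
  refine Finset.card_le_card fun x hx => ?_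
  simp only [Finset.mem_filter, Finset.mem_range] at *
  exact ⟨hx.1, h x hx.1 hx.2⟩

theorem csize_congr {a b : ℕ} (h : ∀ x < n, Conn A Y a x ↔ Conn A Z b x) :
    csize n A Y a = csize n A Z b :=
  le_antisymm (csize_le fun x hx => (h x hx).1) (csize_le fun x hx => (h x hx).2)

theorem Conn.csize_eq (hA : IsGraph n A) (h : Conn A Y a b) : csize n A Y a = csize n A Y b :=
  csize_congr fun _ _ => ⟨(h.symm hA).trans, h.trans⟩

theorem le_csize (F : Finset ℕ) (h : ∀ x ∈ F, x < n ∧ Conn A Y a x) : F.card ≤ csize n A Y a := by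
  classical
  refine Finset.card_le_card fun x hx => ?_
  simpa using h x hx

theorem csize_pos (ha : a < n) : 0 < csize n A Y a := by
  have h := le_csize (n := n) (A := A) (Y := Y) (a := a) {a} (by simpa using ⟨ha, Conn.refl a⟩)
  rwa [Finset.card_singleton] at h

theorem csize_le_card (F : Finset ℕ) (h : ∀ x < n, Conn A Y a x → x ∈ F) :
    csize n A Y a ≤ F.card := by
  classical
  refine Finset.card_le_card fun x hx => ?_
  simp only [Finset.mem_filter, Finset.mem_range] at hx
  exact h x hx.1 hx.2

/-- The part of a safe set in a union of components of the graph is safe. -/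
theorem Safe.inter (h : Safe n A Y) {U : Set ℕ}
    (hU : ∀ x y, A x y → x ∈ U → y ∈ U) : Safe n A (Y ∩ U) := by
  have key : ∀ c ∈ U, ∀ x, (Conn A (Y ∩ U) c x ↔ Conn A Y c x) := by
    have aux : ∀ Z, ∀ c ∈ U, ∀ x, Conn A Z c x → x ∈ U := by
      intro Z c hc x hx
      induction hx with
      | refl => exact hc
      | tail _ h ih => exact hU _ _ h.1 ih
    intro c hc x
    constructor
    · intro hx
      induction hx with
      | refl => exact .refl _
      | tail h h' ih =>
        refine ih.trans (.single h'.1 ?_)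
        have h1 := aux _ c hc _ h
        have h2 := hU _ _ h'.1 h1
        simpa [h1, h2] using h'.2
    · intro hx
      induction hx with
      | refl => exact .refl _
      | tail h h' ih =>
        refine ih.trans (.single h'.1 ?_)
        have h1 := aux _ c hc _ h
        have h2 := hU _ _ h'.1 h1
        simpa [h1, h2] using h'.2
  intro a ha b hb hab
  have hbU := hU a b hab ha.2
  rw [csize_congr fun x _ => key b hbU x, csize_congr fun x _ => key a ha.2 x]
  exact h a ha.1 b (fun hb' => hb ⟨hb', hbU⟩) hab

end Conn

/-! ### Least elements and growing connected sets -/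

open Classical in
/-- The least element below `n` of `P`, or `n` if there is none. -/
noncomputable def least (n : ℕ) (P : ℕ → Prop) : ℕ :=
  ((Finset.range n).filter fun x => ∀ y < n, y ≤ x → ¬ P y).card

theorem least_of_forall_not {n : ℕ} {P : ℕ → Prop} (h : ∀ x < n, ¬ P x) : least n P = n := by
  classical
  unfold least
  rw [Finset.filter_true_of_mem fun x _ y hy _ => h y hy, Finset.card_range]

theorem least_eq_of {n : ℕ} {P : ℕ → Prop} {v : ℕ} (hv : v < n) (hP : P v)
    (hmin : ∀ y < v, ¬ P y) : least n P = v := by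
  classical
  unfold least
  rw [show (Finset.range n).filter (fun x => ∀ y < n, y ≤ x → ¬ P y) = Finset.range v from ?_,
    Finset.card_range]
  ext x
  simp only [Finset.mem_filter, Finset.mem_range]
  constructor
  · rintro ⟨_, h⟩
    by_contra hx
    exact h v hv (by omega) hP
  · intro hx
    exact ⟨by omega, fun y _ hyx => hmin y (by omega)⟩

theorem least_spec {n : ℕ} {P : ℕ → Prop} (h : ∃ x < n, P x) : least n P < n ∧ P (least n P) := by
  classical
  have h' : ∃ x, x < n ∧ P x := h
  obtain ⟨h1, h2⟩ := Nat.find_spec h'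
  have := least_eq_of h1 h2 fun y hy hPy => Nat.find_min h' hy ⟨by omega, hPy⟩
  rw [this]
  exact ⟨h1, h2⟩

/-- Growing a connected set outside `S` from `v`: the set after `t` rounds and the vertex that was
added last. -/
noncomputable def grow (n : ℕ) (A : ℕ → ℕ → Prop) (S : Set ℕ) (v : ℕ) : ℕ → Set ℕ × ℕ
  | 0 => ({v}, v)
  | t + 1 =>
    let W := grow n A S v t
    let w := least n fun b => b ∉ W.1 ∧ b ∉ S ∧ ∃ a ∈ W.1, A a b
    open Classical in if w < n then (insert w W.1, w) else W

/-- `v` is in a component outside `S` that is too large for the final component in `T` of some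
adjacent vertex of `S`. -/
def Bad (n : ℕ) (A : ℕ → ℕ → Prop) (T S : Set ℕ) (v : ℕ) : Prop :=
  v ∉ S ∧ ∃ a ∈ S, A a v ∧ csize n A T a < csize n A S v

/-- The branching step. If the first `csize n A T a + 1` vertices grown from `v` all avoided `T`,
they would be a connected set outside `T`, adjacent to `a` and larger than the component of `a` in
`T`, against the safety of `T`. -/
theorem exists_grow_mem {n : ℕ} {A : ℕ → ℕ → Prop} (hA : IsGraph n A) {T : Finset ℕ} {S : Set ℕ}
    (hT : Safe n A T) (hST : S ⊆ T) {v : ℕ} (hv : Bad n A T S v) :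
    ∃ t ≤ T.card, (grow n A S v t).2 ∈ T ∧ (grow n A S v t).2 ∉ S := by
  classical
  obtain ⟨hvS, a, haS, hav, hlt⟩ := hv
  by_contra hcon
  push Not at hcon
  have hcK : csize n A T a ≤ T.card :=
    csize_le_card _ fun x _ hx => hx.mem_iff.1 (hST haS)
  have hvn : v < n := hA.lt' hav
  -- As long as `T` is avoided, the grown set has exactly `t + 1` vertices and is connected both
  -- outside `S` and outside `T`.
  have key : ∀ t ≤ csize n A T a, (grow n A S v t).2 ∉ S ∧ ∃ F : Finset ℕ,
      (grow n A S v t).1 = F ∧ F.card = t + 1 ∧ v ∈ F ∧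
      ∀ x ∈ F, x < n ∧ x ∉ T ∧ Conn A T v x ∧ Conn A S v x := by
    intro t
    induction t with
    | zero =>
      intro _
      have h0 : v ∉ T := fun h => hvS (hcon 0 (Nat.zero_le _) h)
      refine ⟨hvS, {v}, by simp [grow], by simp, by simp, ?_⟩
      simp [hvn, h0, Conn.refl]
    | succ t ih =>
      intro ht
      obtain ⟨-, F, hF, hcard, hvF, hx⟩ := ih (by omega)
      have hex : ∃ b < n, b ∉ (grow n A S v t).1 ∧ b ∉ S ∧ ∃ a ∈ (grow n A S v t).1, A a b := by
        -- The component of `v` outside `S` has more than `csize n A T a ≥ t + 1` vertices, so it is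
        -- not exhausted by `F`.
        have : ∃ b, b < n ∧ Conn A S v b ∧ b ∉ F := by
          by_contra hno
          push Not at hno
          have := csize_le_card F hno
          omega
        obtain ⟨b, hbn, hb, hbF⟩ := this
        obtain ⟨x, y, hvx, hxy, hside, hxF, hyF⟩ := hb.exists_crossing (W := ↑F)
          (by simpa using hvF) (by simpa using hbF)
        refine ⟨y, hA.lt' hxy, by rwa [hF], fun hy => hvS ?_, x, by rwa [hF], hxy⟩
        exact hvx.mem_iff.2 (hside.2 hy)
      obtain ⟨hwn, hwF, hwS, c, hcF, hcw⟩ := least_spec hex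
      set w := least n fun b => b ∉ (grow n A S v t).1 ∧ b ∉ S ∧ ∃ a ∈ (grow n A S v t).1, A a b
        with hw
      have hg : grow n A S v (t + 1) = (insert w (grow n A S v t).1, w) := by
        simp only [grow]
        rw [← hw, if_pos hwn]
      have hwT : w ∉ T := fun h => hwS (by
        have := hcon (t + 1) (by omega)
        rw [hg] at this
        exact this h)
      rw [hF] at hwF hcF
      have hcF' : c ∈ F := by simpa using hcF
      obtain ⟨-, hcT, hc1, hc2⟩ := hx c hcF'
      rw [hg]
      refine ⟨hwS, insert w F, by simp [hF], ?_, by simp [hvF], ?_⟩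
      · rw [Finset.card_insert_of_notMem (by simpa using hwF), hcard]
      · intro x hxm
        rcases Finset.mem_insert.1 hxm with rfl | hxm
        · exact ⟨hwn, hwT, hc1.trans (.single hcw (iff_of_false (by simpa using hcT)
            (by simpa using hwT))),
            hc2.trans (.single hcw (iff_of_false (fun h => hvS (hc2.mem_iff.2 h)) hwS))⟩
        · exact hx x hxm
  -- At the last index `F` has one vertex more than the component of `a` in `T`.
  obtain ⟨-, F, -, hcard, hvF, hx⟩ := key _ le_rfl
  have h1 := hT a (hST haS) v (by simpa using (hx v hvF).2.1) hav
  have h2 := le_csize (n := n) (A := A) (Y := T) (a := v) F fun x hxF =>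
    ⟨(hx x hxF).1, (hx x hxF).2.2.1⟩
  omega

/-! ### Runs: the vertices found by branching -/

/-- The first `m` values of `u`. -/
def front (u : ℕ → ℕ) (m : ℕ) : Set ℕ := {x | ∃ i < m, u i = x}

theorem front_congr {u u' : ℕ → ℕ} {m : ℕ} (h : ∀ i < m, u i = u' i) : front u m = front u' m := by
  ext x
  constructor
  · rintro ⟨i, hi, rfl⟩; exact ⟨i, hi, (h i hi).symm⟩
  · rintro ⟨i, hi, rfl⟩; exact ⟨i, hi, h i hi⟩

/-- `u` lists the vertices of `T`, and the first `s` of them arise from `r` by repeatedly growing a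
set from the least bad vertex in `br i` rounds; no bad vertex remains. -/
structure IsRun (n : ℕ) (A : ℕ → ℕ → Prop) (T : Finset ℕ) (u br : ℕ → ℕ) (s : ℕ) : Prop where
  pos : 0 < s
  le : s ≤ T.card
  mem : ∀ i < T.card, u i ∈ T
  inj : ∀ i < T.card, ∀ j < T.card, u i = u j → i = j
  surj : ∀ x ∈ T, ∃ i < T.card, u i = x
  br_le : ∀ i, br i ≤ T.card
  step : ∀ i < s, 0 < i → (∃ v < n, Bad n A T (front u i) v) ∧
    u i = (grow n A (front u i) (least n (Bad n A T (front u i))) (br i)).2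
  not_bad : ∀ v, ¬ Bad n A T (front u s) v

/-- While a bad vertex remains, `exists_grow_mem` yields a new vertex of `T`, so a partial run can
be prolonged. Its entries are distinct elements of `T`; hence some partial run of length at most
`T.card` leaves no bad vertex. -/
theorem exists_isRun {n : ℕ} {A : ℕ → ℕ → Prop} (hA : IsGraph n A) {T : Finset ℕ}
    (hT : Safe n A T) {r : ℕ} (hr : r ∈ T) :
    ∃ u br s, u 0 = r ∧ IsRun n A T u br s := by
  classical
  -- a partial run of length `m`
  let P : ℕ → (ℕ → ℕ) → (ℕ → ℕ) → Prop := fun m u br => u 0 = r ∧ (∀ i < m, u i ∈ T) ∧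
    (∀ i < m, ∀ j < m, u i = u j → i = j) ∧ (∀ i, br i ≤ T.card) ∧
    ∀ i < m, 0 < i → (∃ v < n, Bad n A T (front u i) v) ∧
      u i = (grow n A (front u i) (least n (Bad n A T (front u i))) (br i)).2
  have hcard : ∀ m u br, P m u br → ((Finset.range m).image u) ⊆ T ∧
      ((Finset.range m).image u).card = m := by
    rintro m u br ⟨-, h1, h2, -⟩
    refine ⟨fun x hx => ?_, ?_⟩
    · obtain ⟨i, hi, rfl⟩ := Finset.mem_image.1 hx
      exact h1 i (Finset.mem_range.1 hi)
    · rw [Finset.card_image_of_injOn, Finset.card_range]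
      intro i hi j hj hij
      exact h2 i (by simpa using hi) j (by simpa using hj) hij
  have hfront : ∀ m u br, P m u br → front u m ⊆ T := by
    rintro m u br ⟨-, h1, -⟩ x ⟨i, hi, rfl⟩
    exact h1 i hi
  have hnotbad : ∃ m u br, 0 < m ∧ P m u br ∧ ∀ v, ¬ Bad n A T (front u m) v := by
    by_contra hcon
    push Not at hcon
    -- Otherwise there would be partial runs of every positive length, even `T.card + 1`.
    have hall : ∀ m, 0 < m → ∃ u br, P m u br := by
      intro m hm
      induction m, hm using Nat.le_induction with
      | base =>
        refine ⟨fun _ => r, fun _ => 0, rfl, fun _ _ => hr, ?_, fun _ => Nat.zero_le _, ?_⟩ <;>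
          intros <;> omega
      | succ m hm ih =>
        obtain ⟨u, br, hP⟩ := ih
        obtain ⟨v, hv⟩ := hcon m u br hm hP
        have hvn : v < n := by obtain ⟨-, a, -, hav, -⟩ := hv; exact hA.lt' hav
        have hb := (least_spec ⟨v, hvn, hv⟩).2
        obtain ⟨t, ht, htT, htS⟩ := exists_grow_mem hA hT (hfront _ _ _ hP) hb
        set p := (grow n A (front u m) (least n (Bad n A T (front u m))) t).2 with hp
        obtain ⟨h0, h1, h2, h3, h4⟩ := hP
        have hu : ∀ i < m, Function.update u m p i = u i := fun i hi => by
          rw [Function.update_of_ne hi.ne]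
        have hfr : ∀ i ≤ m, front (Function.update u m p) i = front u i := fun i hi =>
          front_congr fun j hj => hu j (by omega)
        refine ⟨Function.update u m p, Function.update br m t, ?_, ?_, ?_, ?_, ?_⟩
        · rw [hu 0 hm, h0]
        · intro i hi
          rcases Nat.lt_succ_iff_lt_or_eq.1 hi with hi | rfl
          · rw [hu i hi]; exact h1 i hi
          · rw [Function.update_self]; exact htT
        · intro i hi j hj hij
          rcases Nat.lt_succ_iff_lt_or_eq.1 hi with hi | rfl <;>
            rcases Nat.lt_succ_iff_lt_or_eq.1 hj with hj | rfl
          · rw [hu i hi, hu j hj] at hij; exact h2 i hi j hj hij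
          · rw [hu i hi, Function.update_self] at hij
            exact absurd ⟨i, hi, hij⟩ htS
          · rw [hu j hj, Function.update_self] at hij
            exact absurd ⟨j, hj, hij.symm⟩ htS
          · rfl
        · intro i
          rw [Function.update_apply]
          split_ifs
          exacts [ht, h3 i]
        · intro i hi hi0
          rcases Nat.lt_succ_iff_lt_or_eq.1 hi with hi | rfl
          · rw [hfr i hi.le, hu i hi, Function.update_of_ne hi.ne]; exact h4 i hi hi0
          · rw [hfr i le_rfl, Function.update_self, Function.update_self]
            exact ⟨⟨v, hvn, hv⟩, hp⟩
    obtain ⟨u, br, hP⟩ := hall (T.card + 1) (by omega)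
    obtain ⟨h1, h2⟩ := hcard _ _ _ hP
    have := Finset.card_le_card h1
    omega
  obtain ⟨s, u, br, hs0, hP, hst⟩ := hnotbad
  obtain ⟨hsub, hc⟩ := hcard _ _ _ hP
  have hsT : s ≤ T.card := hc ▸ Finset.card_le_card hsub
  obtain ⟨h0, h1, h2, h3, h4⟩ := hP
  -- The vertices of `T` that branching has not found fill the slots from `s` on, in increasing
  -- order, so that `u` enumerates all of `T`.
  set R := T \ (Finset.range s).image u with hR
  have hRc : R.card = T.card - s := by rw [hR, Finset.card_sdiff_of_subset hsub, hc]
  set e := R.orderEmbOfFin hRc with he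
  let u' : ℕ → ℕ := fun i => if h : s ≤ i ∧ i < T.card then e ⟨i - s, by omega⟩ else u i
  have hu1 : ∀ i < s, u' i = u i := fun i hi => dif_neg (by omega)
  have hu2 : ∀ i (h : s ≤ i ∧ i < T.card), u' i = e ⟨i - s, by omega⟩ := fun i h => dif_pos h
  have hfr : ∀ i ≤ s, front u' i = front u i := fun i hi => front_congr fun j hj => hu1 j (by omega)
  have heR : ∀ j, e j ∈ R := fun j => Finset.orderEmbOfFin_mem R hRc j
  have hne : ∀ i < s, ∀ j, u i ≠ e j := fun i hi j hij => by
    have := heR j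
    rw [hR, Finset.mem_sdiff] at this
    exact this.2 (Finset.mem_image.2 ⟨i, Finset.mem_range.2 hi, hij⟩)
  have hmem : ∀ i < T.card, u' i ∈ T := fun i hi => by
    by_cases his : i < s
    · rw [hu1 i his]; exact h1 i his
    · rw [hu2 i ⟨by omega, hi⟩]; exact (Finset.mem_sdiff.1 (heR _)).1
  have hinj : ∀ i < T.card, ∀ j < T.card, u' i = u' j → i = j := fun i hi j hj hij => by
    by_cases his : i < s <;> by_cases hjs : j < s
    · rw [hu1 i his, hu1 j hjs] at hij; exact h2 i his j hjs hij
    · rw [hu1 i his, hu2 j ⟨by omega, hj⟩] at hij; exact absurd hij (hne i his _)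
    · rw [hu1 j hjs, hu2 i ⟨by omega, hi⟩] at hij; exact absurd hij.symm (hne j hjs _)
    · rw [hu2 i ⟨by omega, hi⟩, hu2 j ⟨by omega, hj⟩] at hij
      have := e.injective hij
      simp only [Fin.mk.injEq] at this
      omega
  refine ⟨u', br, s, by rw [hu1 0 hs0, h0], hs0, hsT, hmem, hinj, ?_, h3, ?_, ?_⟩
  · have himg : (Finset.range T.card).image u' = T := by
      refine Finset.eq_of_subset_of_card_le (fun x hx => ?_) ?_
      · obtain ⟨i, hi, rfl⟩ := Finset.mem_image.1 hx
        exact hmem i (Finset.mem_range.1 hi)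
      · rw [Finset.card_image_of_injOn, Finset.card_range]
        intro i hi j hj hij
        exact hinj i (by simpa using hi) j (by simpa using hj) hij
    intro x hx
    rw [← himg] at hx
    obtain ⟨i, hi, rfl⟩ := Finset.mem_image.1 hx
    exact ⟨i, Finset.mem_range.1 hi, rfl⟩
  · intro i hi hi0
    rw [hfr i hi.le, hu1 i hi]
    exact h4 i hi hi0
  · rw [hfr s le_rfl]
    exact hst

end SafeSet

/-! ### Placing the rest of the safe set -/

namespace SafeSet

/-- Every relation that connects the elements below `s` with their roots has a forest of parents. -/
theorem exists_parents {s : ℕ} {H : ℕ → ℕ → Prop} {root : ℕ → ℕ}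
    (hroot : ∀ i < s, root i < s ∧ root (root i) = root i ∧
      Relation.ReflTransGen (fun i j => i < s ∧ j < s ∧ H i j) (root i) i)
    (hH : ∀ i < s, ∀ j < s, H i j → root i = root j) :
    ∃ p : ℕ → ℕ, ∀ i < s, p i < s ∧ (p i = i ∨ H (p i) i) ∧ p (root i) = root i ∧
      ∀ m, s ≤ m → p^[m] i = root i := by
  classical
  -- `R t i` says that at most `t` links lead from some root to `i`. The least such `t` is the
  -- distance `d i`, and a non-root has a neighbour at smaller distance, which becomes its parent.
  let R : ℕ → ℕ → Prop := fun t => Nat.rec (motive := fun _ => ℕ → Prop) (fun i => root i = i)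
    (fun _ P i => P i ∨ ∃ j < s, P j ∧ H j i) t
  have hR : ∀ i < s, ∃ t, R t i := by
    intro i hi
    have : ∀ j, Relation.ReflTransGen (fun i j => i < s ∧ j < s ∧ H i j) (root i) j → ∃ t, R t j :=
        by
      intro j hj
      induction hj with
      | refl => exact ⟨0, (hroot i hi).2.1⟩
      | @tail b c _ h ih =>
        obtain ⟨t, ht⟩ := ih
        exact ⟨t + 1, .inr ⟨b, h.1, ht, h.2.2⟩⟩
    exact this i (hroot i hi).2.2
  let d : ℕ → ℕ := fun i => if h : ∃ t, R t i then Nat.find h else 0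
  have hpar : ∀ i < s, root i ≠ i → ∃ j < s, H j i ∧ d j < d i := by
    intro i hi hne
    have hd : d i = Nat.find (hR i hi) := dif_pos (hR i hi)
    have h1 := Nat.find_spec (hR i hi)
    rw [← hd] at h1
    rcases hdi : d i with _ | t
    · rw [hdi] at h1; exact absurd h1 hne
    · rw [hdi] at h1
      rcases h1 with h1 | ⟨j, hj, h1, h2⟩
      · exact absurd h1 (Nat.find_min (hR i hi) (by omega))
      · refine ⟨j, hj, h2, ?_⟩
        have : d j = Nat.find (hR j hj) := dif_pos (hR j hj)
        have h3 : Nat.find (hR j hj) ≤ t := Nat.find_min' _ h1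
        omega
  choose! p hp using hpar
  let p' : ℕ → ℕ := fun i => if root i = i then i else p i
  have hp'root : ∀ i < s, p' (root i) = root i := fun i hi => if_pos (hroot i hi).2.1
  have hp's : ∀ i < s, p' i < s := fun i hi => by
    by_cases h : root i = i
    · simp only [p', if_pos h, hi]
    · simp only [p', if_neg h, (hp i hi h).1]
  have hroot' : ∀ i < s, root (p' i) = root i := fun i hi => by
    by_cases h : root i = i
    · simp only [p', if_pos h]
    · simp only [p', if_neg h]
      exact hH _ (hp i hi h).1 _ hi (hp i hi h).2.1
  -- Unlike the distance, this rank is below `s` by construction, since `i` itself is not counted.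
  -- It still decreases along parents, so `s` steps lead to the root.
  let rk : ℕ → ℕ := fun i => ((Finset.range s).filter fun j => d j < d i).card
  have hrk : ∀ i < s, root i ≠ i → rk (p' i) < rk i := by
    intro i hi h
    simp only [p', if_neg h]
    obtain ⟨h1, -, h3⟩ := hp i hi h
    refine Finset.card_lt_card (Finset.ssubset_iff_of_subset (fun x hx => ?_) |>.2
      ⟨p i, by simp [h1, h3], by simp⟩)
    simp only [Finset.mem_filter] at *
    exact ⟨hx.1, by omega⟩
  have hrks : ∀ i < s, rk i < s := fun i hi => by
    have : rk i < (Finset.range s).card := by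
      refine Finset.card_lt_card (Finset.ssubset_iff_of_subset (Finset.filter_subset _ _) |>.2
        ⟨i, by simp [hi], by simp⟩)
    simpa using this
  have hit : ∀ m i, i < s → rk i ≤ m → p'^[m] i = root i := by
    intro m
    induction m with
    | zero =>
      intro i hi h0
      by_contra h
      have := hrk i hi (fun h' => h h'.symm)
      omega
    | succ m ih =>
      intro i hi hm
      rw [Function.iterate_succ_apply]
      by_cases h : root i = i
      · have : p' i = i := if_pos h
        rw [this]
        have hfix : ∀ m, p'^[m] i = i := fun m => by
          induction m with
          | zero => rfl
          | succ m ihm => rw [Function.iterate_succ_apply, this, ihm]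
        rw [hfix, h]
      · rw [ih _ (hp's i hi) (by have := hrk i hi h; omega), hroot' i hi]
  refine ⟨p', fun i hi => ⟨hp's i hi, ?_, hp'root i hi, fun m hm =>
    hit m i hi ((hrks i hi).le.trans hm)⟩⟩
  by_cases h : root i = i
  · exact .inl (if_pos h)
  · right
    simp only [p', if_neg h]
    exact (hp i hi h).2.1

/-- The size of the component of `T` for vertices of `S`, and `0` for all other vertices. -/
noncomputable def cap (n : ℕ) (A : ℕ → ℕ → Prop) (T S : Set ℕ) (w : ℕ) : ℕ :=
  open Classical in if w ∈ S then csize n A T w else 0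

/-- No component of the complement of `Y` is larger than both the adjacent component of `Y` and the
values of `val` on it. -/
def Check (n : ℕ) (A : ℕ → ℕ → Prop) (val : ℕ → ℕ) (Y : Set ℕ) : Prop :=
  ∀ a < n, a ∈ Y → ∀ b < n, b ∉ Y → A a b →
    csize n A Y b ≤ csize n A Y a ∨ ∃ w < n, Conn A Y a w ∧ csize n A Y b ≤ val w

open Classical in
/-- The set `X` serves as the `j`-th piece: it provides the connections and the contributions to the
classes of slots that are demanded at time `j`. -/
structure Fits (n : ℕ) (A : ℕ → ℕ → Prop) (K s : ℕ) (u ptr tm lab val : ℕ → ℕ) (S : Set ℕ) (j : ℕ)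
    (X : Set ℕ) : Prop where
  link : ∀ i < n, i < s → tm i = j → Conn A (S ∪ X) (u i) (u (ptr i))
  gain : ∀ i < n, i < s →
    ((Finset.range n).filter fun a => s ≤ a ∧ a < K ∧ tm a = j ∧ lab a = lab i).card ≤
    ((Finset.range n).filter fun x => x ∈ X ∧
      ∃ i' < n, i' < s ∧ lab i' = lab i ∧ Conn A (S ∪ X) x (u i')).card
  size : ((Finset.range n).filter fun x => x ∈ X).card ≤
    ((Finset.range n).filter fun a => s ≤ a ∧ a < K ∧ tm a = j).card
  check : Check n A val (S ∪ X)

open Classical in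
/-- The rank of `v` in `Q`, from `1` on. -/
noncomputable def rank (Q : Finset ℕ) (v : ℕ) : ℕ := (Q.filter fun y => y < v).card + 1

/-- Pointers and times that describe how the safe set `T` arises from its first `s` vertices, by
pieces in the components (outside these vertices) with least vertices in `Q`. -/
structure IsScheme (n : ℕ) (A : ℕ → ℕ → Prop) (T : Finset ℕ) (u : ℕ → ℕ) (s : ℕ)
    (ptr tm : ℕ → ℕ) (Q : Finset ℕ) : Prop where
  ptr_lt_card : ∀ i, ptr i < T.card
  tm_le : ∀ i, tm i ≤ T.card
  lab_iff : ∀ a < T.card, ∀ b < T.card, ptr^[n] a = ptr^[n] b ↔ Conn A T (u a) (u b)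
  ptr_lt : ∀ i < s, ptr i < s
  link_zero : ∀ i < s, tm i = 0 → Conn A (front u s) (u i) (u (ptr i))
  tm_le_card : ∀ i < s, tm i ≤ Q.card
  tm_mem : ∀ a < T.card, s ≤ a → 1 ≤ tm a ∧ tm a ≤ Q.card
  least : ∀ v ∈ Q, v < n ∧ v ∉ front u s ∧ csize n A (front u s) v ≤ T.card ∧
    ∀ y, Conn A (front u s) v y → v ≤ y
  fits : ∀ v ∈ Q, ∃ X ⊆ {x | Conn A (front u s) v x},
    Fits n A T.card s u ptr tm ptr^[n] (cap n A T (front u s)) (front u s) (rank Q v) X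

theorem rank_le_card {Q : Finset ℕ} {v : ℕ} (hv : v ∈ Q) : rank Q v ≤ Q.card := by
  classical
  exact Finset.card_lt_card (Finset.ssubset_iff_of_subset (Finset.filter_subset _ _) |>.2
    ⟨v, hv, by simp⟩)

theorem rank_lt {Q : Finset ℕ} {v w : ℕ} (hv : v ∈ Q) (h : v < w) : rank Q v < rank Q w := by
  classical
  refine Nat.succ_lt_succ (Finset.card_lt_card (Finset.ssubset_iff_of_subset (fun x hx => ?_) |>.2
    ⟨v, by simp [hv, h], by simp⟩))
  simp only [Finset.mem_filter] at *
  exact ⟨hx.1, by omega⟩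

theorem rank_inj {Q : Finset ℕ} {v w : ℕ} (hv : v ∈ Q) (hw : w ∈ Q) (h : rank Q v = rank Q w) :
    v = w := by
  rcases lt_trichotomy v w with hlt | rfl | hlt
  · have := rank_lt hv hlt; omega
  · rfl
  · have := rank_lt hw hlt; omega

theorem front_subset {n : ℕ} {A : ℕ → ℕ → Prop} {T : Finset ℕ} {u br : ℕ → ℕ} {s : ℕ}
    (h : IsRun n A T u br s) : front u s ⊆ T := by
  rintro x ⟨i, hi, rfl⟩
  exact h.mem i (hi.trans_le h.le)

/-- The true pieces of `T` determine pointers and times. The hypothesis that `T` lies in one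
component of the graph makes each component of the complement of `front u s` that meets `T` adjacent
to `front u s`; as no bad vertex remains, it has at most `T.card` vertices. -/
theorem exists_isScheme {n : ℕ} {A : ℕ → ℕ → Prop} (hA : IsGraph n A) {T : Finset ℕ}
    (hT : Safe n A T) (hTn : ∀ x ∈ T, x < n) {u br : ℕ → ℕ} {s : ℕ} (hu : IsRun n A T u br s)
    (hconn : ∀ x ∈ T, Conn A ∅ (u 0) x) :
    ∃ ptr tm Q, IsScheme n A T u s ptr tm Q := by
  classical
  set S := front u s with hS
  have hST : S ⊆ T := front_subset hu
  have hKn : T.card ≤ n := card_le_of_forall_lt hTn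
  have huS : ∀ i < s, u i ∈ S := fun i hi => ⟨i, hi, rfl⟩
  have hnotbad : ∀ v, ¬ Bad n A T S v := hu.not_bad
  have hslot : ∀ a < T.card, u a ∈ S → a < s := by
    rintro a ha ⟨i, hi, h⟩
    rwa [hu.inj i (hi.trans_le hu.le) a ha h] at hi
  -- least vertices of components
  let m : ℕ → ℕ := fun x => sInf {y | Conn A S x y}
  have hm : ∀ x, Conn A S x (m x) := fun x => Nat.sInf_mem (s := {y | Conn A S x y}) ⟨x, .refl x⟩
  have hmle : ∀ x y, Conn A S x y → m x ≤ y := fun x y h => Nat.sInf_le h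
  have hmeq : ∀ x y, Conn A S x y → m x = m y := fun x y h =>
    le_antisymm (hmle _ _ (h.trans (hm y))) (hmle _ _ ((h.symm hA).trans (hm x)))
  have hmS : ∀ x, x ∉ S → m x ∉ S := fun x hx h => hx ((hm x).mem_iff.2 h)
  set Q := (T.filter (· ∉ S)).image m with hQ
  have hmQ : ∀ x ∈ T, x ∉ S → m x ∈ Q := fun x hx hxS =>
    Finset.mem_image.2 ⟨x, Finset.mem_filter.2 ⟨hx, hxS⟩, rfl⟩
  let rk : ℕ → ℕ := fun x => rank Q (m x)
  have hrk1 : ∀ x, 1 ≤ rk x := fun x => Nat.succ_le_succ (Nat.zero_le _)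
  have hrkq : ∀ x ∈ T, x ∉ S → rk x ≤ Q.card := fun x hx hxS => rank_le_card (hmQ x hx hxS)
  have hrkc : ∀ x y, Conn A S x y → rk x = rk y := fun x y h => by simp only [rk, hmeq x y h]
  have hrki : ∀ x ∈ T, x ∉ S → ∀ y ∈ T, y ∉ S → rk x = rk y → Conn A S x y := by
    intro x hx hxS y hy hyS h
    have := rank_inj (hmQ x hx hxS) (hmQ y hy hyS) h
    exact (hm x).trans (this ▸ (hm y).symm hA)
  -- Ranks start at `1`, so `X 0` is empty, and time `0` is free to mark links inside `S` alone.
  let X : ℕ → Set ℕ := fun j => {x | x ∈ T ∧ x ∉ S ∧ rk x = j}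
  have hXT : ∀ j, S ∪ X j ⊆ T := fun j x hx => hx.elim (fun h => hST h) fun h => h.1
  -- roots
  let root : ℕ → ℕ := fun a => sInf {b | b < T.card ∧ Conn A T (u a) (u b)}
  have hroot : ∀ a < T.card, root a < T.card ∧ Conn A T (u a) (u (root a)) := fun a ha =>
    Nat.sInf_mem (s := {b | b < T.card ∧ Conn A T (u a) (u b)}) ⟨a, ha, .refl _⟩
  have hrootle : ∀ a b, b < T.card → Conn A T (u a) (u b) → root a ≤ b := fun a b hb h =>
    Nat.sInf_le ⟨hb, h⟩
  have hrooteq : ∀ a < T.card, ∀ b < T.card, Conn A T (u a) (u b) → root a = root b :=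
    fun a ha b hb h => le_antisymm
      (hrootle _ _ (hroot b hb).1 (h.trans (hroot b hb).2))
      (hrootle _ _ (hroot a ha).1 ((h.symm hA).trans (hroot a ha).2))
  have hrootiff : ∀ a < T.card, ∀ b < T.card, (root a = root b ↔ Conn A T (u a) (u b)) :=
    fun a ha b hb => ⟨fun h => (hroot a ha).2.trans (h ▸ (hroot b hb).2.symm hA), hrooteq a ha b hb⟩
  have hrootroot : ∀ a < T.card, root (root a) = root a := fun a ha =>
    (hrooteq a ha _ (hroot a ha).1 (hroot a ha).2).symm
  have hrootle' : ∀ a < T.card, root a ≤ a := fun a ha => hrootle a a ha (.refl _)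
  -- links between slots
  let H : ℕ → ℕ → Prop := fun i i' => ∃ j ≤ Q.card, Conn A (S ∪ X j) (u i') (u i)
  have hX0 : ∀ x ∈ T, x ∉ S → x ∈ X (rk x) := fun x hx hxS => ⟨hx, hxS, rfl⟩
  -- Follow a walk in `T` from `u i`. Between two visits to `S` it stays in one piece, because
  -- different pieces lie in different components outside `S`. Thus the walk decomposes into links
  -- `H`, followed by a part in a single piece.
  have hreach : ∀ i < s, ∀ y, Conn A T (u i) y → ∃ i' < s,
      Relation.ReflTransGen (fun i j => i < s ∧ j < s ∧ H i j) i i' ∧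
      (y ∈ S ∧ y = u i' ∨ y ∉ S ∧ Conn A (S ∪ X (rk y)) (u i') y) := by
    intro i hi y hy
    induction hy with
    | refl => exact ⟨i, hi, .refl, .inl ⟨huS i hi, rfl⟩⟩
    | @tail y z hy hyz ih =>
      obtain ⟨i', hi', hii', h⟩ := ih
      have hyT : y ∈ (T : Set ℕ) := Conn.mem_iff hy |>.1 (hST (huS i hi))
      have hzT : z ∈ (T : Set ℕ) := hyz.2.1 hyT
      by_cases hzS : z ∈ S
      · obtain ⟨i'', hi'', rfl⟩ := hzS
        refine ⟨i'', hi'', hii'.tail ⟨hi', hi'', ?_⟩, .inl ⟨huS _ hi'', rfl⟩⟩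
        rcases h with ⟨hyS, rfl⟩ | ⟨hyS, h⟩
        · exact ⟨0, Nat.zero_le _, .single (hA.symm hyz.1)
            (iff_of_true (.inl (huS _ hi'')) (.inl (huS _ hi')))⟩
        · refine ⟨rk y, hrkq y hyT hyS, ?_⟩
          exact (h.trans (.single hyz.1
            (iff_of_true (.inr (hX0 y hyT hyS)) (.inl (huS _ hi''))))).symm hA
      · refine ⟨i', hi', hii', .inr ⟨hzS, ?_⟩⟩
        rcases h with ⟨hyS, rfl⟩ | ⟨hyS, h⟩
        · exact .single hyz.1 (iff_of_true (.inl hyS) (.inr (hX0 z hzT hzS)))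
        · have hc : Conn A S y z := .single hyz.1 (iff_of_false hyS hzS)
          rw [hrkc y z hc] at h
          exact h.trans (.single hyz.1 (iff_of_true (.inr ⟨hyT, hyS, hrkc y z hc⟩)
            (.inr (hX0 z hzT hzS))))
  have hHroot : ∀ i < s, ∀ j < s, H i j → root i = root j := by
    rintro i hi j hj ⟨l, -, h⟩
    exact (hrooteq _ (hj.trans_le hu.le) _ (hi.trans_le hu.le)
      (h.mono (hXT l) (.inl (huS _ hj)))).symm
  obtain ⟨p, hp⟩ := exists_parents (s := s) (H := H) (root := root) (by
    intro i hi
    have hiK := hi.trans_le hu.le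
    -- A root is the least slot of its component of `T`, so a component that meets `S` has its root
    -- among the first `s` slots.
    have hri : root i < s := (hrootle' i hiK).trans_lt hi
    refine ⟨hri, hrootroot i hiK, ?_⟩
    obtain ⟨i', hi', h, h' | h'⟩ := hreach (root i) hri (u i) ((hroot i hiK).2.symm hA)
    · obtain rfl := hu.inj i hiK i' (hi'.trans_le hu.le) h'.2
      exact h
    · exact absurd (huS i hi) h'.1) hHroot
  have htime : ∀ i < s, ∃ t ≤ Q.card, Conn A (S ∪ X t) (u i) (u (p i)) := by
    intro i hi
    rcases (hp i hi).2.1 with h | h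
    · exact ⟨0, Nat.zero_le _, by rw [h]; exact .refl _⟩
    · exact h
  choose! tm hptm using htime
  -- Slots from `s` on point directly to the root and carry the number of their piece. The value `0`
  -- beyond `T.card` keeps all entries within the range of the digits.
  let ptr' : ℕ → ℕ := fun i => if i < s then p i else if i < T.card then root i else 0
  let tm' : ℕ → ℕ := fun i => if i < s then tm i else if i < T.card then rk (u i) else 0
  have hp1 : ∀ i < s, ptr' i = p i := fun i hi => if_pos hi
  have ht1 : ∀ i < s, tm' i = tm i := fun i hi => if_pos hi
  have hp2 : ∀ i, s ≤ i → i < T.card → ptr' i = root i := fun i hi hi' => by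
    simp only [ptr', if_neg (show ¬ i < s by omega), if_pos hi']
  have ht2 : ∀ i, s ≤ i → i < T.card → tm' i = rk (u i) := fun i hi hi' => by
    simp only [tm', if_neg (show ¬ i < s by omega), if_pos hi']
  have huT : ∀ a < T.card, s ≤ a → u a ∈ T ∧ u a ∉ S := fun a ha hsa =>
    ⟨hu.mem a ha, fun h => by have := hslot a ha h; omega⟩
  have hQT : Q.card ≤ T.card :=
    Finset.card_image_le.trans (Finset.card_le_card (Finset.filter_subset _ _))
  have hfix : ∀ a < T.card, ptr' (root a) = root a := by
    intro a ha
    have h1 := (hroot a ha).1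
    by_cases h : root a < s
    · rw [hp1 _ h]
      have := (hp _ h).2.2.1
      rwa [hrootroot a ha] at this
    · rw [hp2 _ (by omega) h1, hrootroot a ha]
  have hlab : ∀ a < T.card, ptr'^[n] a = root a := by
    intro a ha
    have hfixm : ∀ m, ptr'^[m] (root a) = root a := fun m => by
      induction m with
      | zero => rfl
      | succ m ih => rw [Function.iterate_succ_apply, hfix a ha, ih]
    by_cases h : a < s
    · have : ∀ m, ptr'^[m] a = p^[m] a ∧ p^[m] a < s := fun m => by
        induction m with
        | zero => exact ⟨rfl, h⟩
        | succ m ih =>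
          rw [Function.iterate_succ_apply', Function.iterate_succ_apply', ih.1, hp1 _ ih.2]
          exact ⟨rfl, (hp _ ih.2).1⟩
      rw [(this n).1]
      exact (hp a h).2.2.2 n (hu.le.trans hKn)
    · obtain ⟨n', rfl⟩ : ∃ n', n = n' + 1 := ⟨n - 1, by omega⟩
      rw [Function.iterate_succ_apply, hp2 a (by omega) ha, hfixm]
  have hlabiff : ∀ a < T.card, ∀ b < T.card,
      (ptr'^[n] a = ptr'^[n] b ↔ Conn A T (u a) (u b)) := fun a ha b hb => by
    rw [hlab a ha, hlab b hb, hrootiff a ha b hb]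
  refine ⟨ptr', tm', Q, ?_, ?_, hlabiff, ?_, ?_, ?_, ?_, ?_, ?_⟩
  · intro i
    by_cases h : i < s
    · rw [hp1 i h]; exact (hp i h).1.trans_le hu.le
    · by_cases h' : i < T.card
      · rw [hp2 i (by omega) h']; exact (hroot i h').1
      · simpa only [ptr', if_neg h, if_neg h'] using hu.pos.trans_le hu.le
  · intro i
    by_cases h : i < s
    · rw [ht1 i h]; exact (hptm i h).1.trans hQT
    · by_cases h' : i < T.card
      · rw [ht2 i (by omega) h']
        obtain ⟨h1, h2⟩ := huT i h' (by omega)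
        exact (hrkq _ h1 h2).trans hQT
      · simp [tm', h, h']
  · intro i hi
    rw [hp1 i hi]; exact (hp i hi).1
  · intro i hi h0
    rw [ht1 i hi] at h0
    have := (hptm i hi).2
    rw [h0] at this
    rw [hp1 i hi]
    have hX : X 0 = ∅ := by
      ext x
      simp only [X, Set.mem_ofPred_eq, Set.mem_empty_iff_false, iff_false]
      rintro ⟨-, -, h⟩
      have := hrk1 x
      omega
    rwa [hX, Set.union_empty] at this
  · intro i hi
    rw [ht1 i hi]; exact (hptm i hi).1
  · intro a ha hsa
    rw [ht2 a hsa ha]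
    obtain ⟨h1, h2⟩ := huT a ha hsa
    exact ⟨hrk1 _, hrkq _ h1 h2⟩
  · intro v hv
    obtain ⟨x, hx, rfl⟩ := Finset.mem_image.1 hv
    obtain ⟨hxT, hxS⟩ := Finset.mem_filter.1 hx
    have hxn := hTn x hxT
    refine ⟨(hm x).lt hA hxn, hmS x hxS, ?_, fun y hy => hmle x y ((hm x).trans hy)⟩
    -- the component of `x` is adjacent to `S`
    obtain ⟨y, z, hxy, hyz, -, hyS, hzS⟩ := ((hconn x hxT).symm hA).exists_crossing
      (W := {y | Conn A S x y}) (.refl x) (fun h => hxS (by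
        have h' : Conn A S x (u 0) := h
        exact h'.mem_iff.2 (huS 0 hu.pos)))
    have hyS' : Conn A S x y := hyS
    have hyn : y ∉ S := fun h => hxS (hyS'.mem_iff.2 h)
    have hz : z ∈ S := by
      by_contra hz
      exact hzS (hyS'.trans (.single hyz (iff_of_false hyn hz)))
    have hnb := hnotbad y
    have h1 : csize n A S y ≤ csize n A T z := by
      by_contra h
      exact hnb ⟨hyn, z, hz, hA.symm hyz, by omega⟩
    rw [← (hm x).csize_eq hA, hyS'.csize_eq hA]
    refine h1.trans (csize_le_card _ fun w _ hw => hw.mem_iff.1 (hST hz))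
  · intro v hv
    obtain ⟨x, hx, rfl⟩ := Finset.mem_image.1 hv
    obtain ⟨hxT, hxS⟩ := Finset.mem_filter.1 hx
    have hXc : ∀ y ∈ X (rk x), Conn A S x y := fun y hy => hrki x hxT hxS y hy.1 hy.2.1 hy.2.2.symm
    have hXc' : ∀ y ∈ T, Conn A S x y → y ∈ X (rk x) := fun y hy h =>
      ⟨hy, fun h' => hxS (h.mem_iff.2 h'), (hrkc x y h).symm⟩
    -- a connection in `T` from the piece stays in the piece or reaches `S` through it
    have hexit : ∀ z ∈ X (rk x), ∀ y, Conn A T z y →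
        (∃ i' < s, Conn A (S ∪ X (rk x)) z (u i')) ∨
          y ∈ X (rk x) ∧ Conn A (S ∪ X (rk x)) z y := by
      intro z hz y hy
      induction hy with
      | refl => exact .inr ⟨hz, .refl _⟩
      | @tail y w hy hyw ih =>
        rcases ih with ih | ⟨hyX, ih⟩
        · exact .inl ih
        · have hwT : w ∈ (T : Set ℕ) := hyw.2.1 hyX.1
          by_cases hwS : w ∈ S
          · obtain ⟨i', hi', rfl⟩ := hwS
            exact .inl ⟨i', hi', ih.trans (.single hyw.1 (iff_of_true (.inr hyX)
              (.inl (huS _ hi'))))⟩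
          · have hwX : w ∈ X (rk x) := hXc' w hwT ((hXc y hyX).trans
              (.single hyw.1 (iff_of_false hyX.2.1 hwS)))
            exact .inr ⟨hwX, ih.trans (.single hyw.1 (iff_of_true (.inr hyX) (.inr hwX)))⟩
    refine ⟨X (rk x), fun y hy => ((hm x).symm hA).trans (hXc y hy), ?_, ?_, ?_, ?_⟩
    · intro i _ hi hti
      rw [ht1 i hi] at hti
      have := (hptm i hi).2
      rw [hti] at this
      rwa [hp1 i hi]
    · intro i hin hi
      -- The vertices in the slots that are demanded witness the gain themselves: each is joined in
      -- `T` to `u i`, so by `hexit` it reaches `S` already through its own piece.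
      refine Finset.card_le_card_of_injOn u (fun a ha => ?_) fun a ha b hb hab => ?_
      · simp only [Finset.coe_filter, Finset.mem_range, Set.mem_ofPred_eq] at ha ⊢
        obtain ⟨han, hsa, haK, hta, hla⟩ := ha
        rw [ht2 a hsa haK] at hta
        obtain ⟨h1, h2⟩ := huT a haK hsa
        have hX : u a ∈ X (rk x) := ⟨h1, h2, hta⟩
        refine ⟨hTn _ h1, hX, ?_⟩
        have hc := (hlabiff a haK i (hi.trans_le hu.le)).1 hla
        rcases hexit _ hX _ hc with ⟨i', hi', h⟩ | ⟨h, -⟩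
        · refine ⟨i', hi'.trans_le (hu.le.trans hKn), hi', ?_, h⟩
          have h3 := h.mono (hXT _) (.inr hX)
          exact (hlabiff _ (hi'.trans_le hu.le) _ (hi.trans_le hu.le)).2 ((h3.symm hA).trans hc)
        · exact absurd (huS i hi) h.2.1
      · simp only [Finset.coe_filter, Finset.mem_range, Set.mem_ofPred_eq] at ha hb
        exact hu.inj a ha.2.2.1 b hb.2.2.1 hab
    · refine (Finset.card_le_card (t := ((Finset.range n).filter fun a => s ≤ a ∧ a < T.card ∧
        tm' a = rk x).image u) fun y hy => ?_).trans Finset.card_image_le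
      obtain ⟨-, hyT, hyS, hyr⟩ := (@Finset.mem_filter _ _ (_) _ _).1 hy
      obtain ⟨a, ha, rfl⟩ := hu.surj y hyT
      have hsa : s ≤ a := by
        by_contra h
        exact hyS (huS a (by omega))
      refine Finset.mem_image.2 ⟨a, ?_, rfl⟩
      simp only [Finset.mem_filter, Finset.mem_range]
      exact ⟨by omega, hsa, ha, by rw [ht2 a hsa ha, hyr]⟩
    · intro a han haY b hbn hbY hab
      have hbS : b ∉ S := fun h => hbY (.inl h)
      have hcap : ∀ w ∈ S, cap n A T S w = csize n A T w := fun w hw => if_pos hw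
      -- If `b` is in the component of the piece, its component outside `S ∪ X` avoids `T`, and the
      -- safety of `T` bounds its size by the component of `a` in `T`. If `a` reaches a vertex of
      -- `S` through the piece, this bound is the cap there; otherwise the component of `a` in `T`
      -- lies entirely in the piece.
      by_cases hxb : Conn A S x b
      · have hbT : b ∉ (T : Set ℕ) := fun h => hbY (.inr (hXc' b h hxb))
        have haT : a ∈ (T : Set ℕ) := hXT _ haY
        have h1 : csize n A (S ∪ X (rk x)) b ≤ csize n A T b := by
          refine csize_le fun y _ hy => hy.of_forall fun w hw => ?_
          refine iff_of_false (fun hwT => ?_) hbT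
          have hwY : w ∉ S ∪ X (rk x) := fun h => hbY (hw.mem_iff.2 h)
          exact hwY (.inr (hXc' w hwT (hxb.trans (hw.anti Set.subset_union_left hbY))))
        have h2 := h1.trans (hT a haT b hbT hab)
        by_cases hw : ∃ i < s, Conn A (S ∪ X (rk x)) a (u i)
        · obtain ⟨i, hi, hw⟩ := hw
          right
          refine ⟨u i, hTn _ (hu.mem i (hi.trans_le hu.le)), hw, ?_⟩
          rw [hcap _ (huS i hi), ← (hw.mono (hXT _) haY).csize_eq hA]
          exact h2
        · left
          refine h2.trans (csize_le fun y _ hy => ?_)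
          have haX : a ∈ X (rk x) := by
            rcases haY with ⟨i, hi, rfl⟩ | h
            · exact absurd ⟨i, hi, .refl _⟩ hw
            · exact h
          rcases hexit a haX y hy with h | h
          · exact absurd h hw
          · exact h.2
      -- If `b` is in another component, `a` must belong to `S`, and the absence of bad vertices
      -- gives the bound.
      · have haS : a ∈ S := by
          rcases haY with h | h
          · exact h
          · exact absurd ((hXc a h).trans (.single hab (iff_of_false h.2.1 hbS))) hxb
        right
        refine ⟨a, han, .refl _, ?_⟩
        rw [hcap a haS]
        have h1 : csize n A S b ≤ csize n A T a := by
          by_contra h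
          exact hnotbad b ⟨hbS, a, haS, hab, by omega⟩
        exact (csize_le fun y _ hy => hy.anti Set.subset_union_left hbY).trans h1

/-- Sets that serve as the pieces, in different components, yield a safe set. -/
theorem IsScheme.safe_union {n : ℕ} {A : ℕ → ℕ → Prop} (hA : IsGraph n A) {T : Finset ℕ}
    (hTn : ∀ x ∈ T, x < n) {u br : ℕ → ℕ} {s : ℕ} (hu : IsRun n A T u br s)
    {ptr tm : ℕ → ℕ} {Q : Finset ℕ} (hs : IsScheme n A T u s ptr tm Q)
    {X : ℕ → Set ℕ} {v : ℕ → ℕ} {J : ℕ} (hJ : Q.card ≤ J)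
    (hX : ∀ j, 1 ≤ j → j ≤ J → v j ∉ front u s ∧ X j ⊆ {x | Conn A (front u s) (v j) x} ∧
      Fits n A T.card s u ptr tm ptr^[n] (cap n A T (front u s)) (front u s) j (X j))
    (hv : ∀ j, 1 ≤ j → j ≤ J → ∀ l, 1 ≤ l → l ≤ J → Conn A (front u s) (v j) (v l) → j = l)
    {Y : Set ℕ} (hY : ∀ x, x ∈ Y ↔ x ∈ front u s ∨ ∃ j, 1 ≤ j ∧ j ≤ J ∧ x ∈ X j)
    (F : Finset ℕ) (hF : ∀ x ∈ F, x < n ∧ x ∈ Y) :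
    Safe n A Y ∧ F.card ≤ T.card := by
  classical
  set S := front u s with hS
  have hST : S ⊆ T := front_subset hu
  have hKn : T.card ≤ n := card_le_of_forall_lt hTn
  have huS : ∀ i < s, u i ∈ S := fun i hi => ⟨i, hi, rfl⟩
  have hnotbad : ∀ v, ¬ Bad n A T S v := hu.not_bad
  have hSY : S ⊆ Y := fun x hx => (hY x).2 (.inl hx)
  have hXY : ∀ j, 1 ≤ j → j ≤ J → S ∪ X j ⊆ Y := fun j h1 h2 x hx =>
    (hY x).2 (hx.imp id fun h => ⟨j, h1, h2, h⟩)
  have hXS : ∀ j, 1 ≤ j → j ≤ J → ∀ x ∈ X j, x ∉ S := fun j h1 h2 x hx h => by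
    have hc : Conn A S (v j) x := (hX j h1 h2).2.1 hx
    exact (hX j h1 h2).1 (hc.mem_iff.2 h)
  have hXX : ∀ j, 1 ≤ j → j ≤ J → ∀ l, 1 ≤ l → l ≤ J → ∀ x, x ∈ X j → x ∈ X l → j = l := by
    intro j h1 h2 l h3 h4 x hx hx'
    have hc : Conn A S (v j) x := (hX j h1 h2).2.1 hx
    have hc' : Conn A S (v l) x := (hX l h3 h4).2.1 hx'
    exact hv j h1 h2 l h3 h4 (hc.trans (hc'.symm hA))
  have hlink : ∀ i < s, Conn A Y (u i) (u (ptr i)) := by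
    intro i hi
    rcases Nat.eq_zero_or_pos (tm i) with h0 | h0
    · exact (hs.link_zero i hi h0).mono hSY (huS i hi)
    · have h1 := (hs.tm_le_card i hi).trans hJ
      exact ((hX _ h0 h1).2.2.link i (by have := hu.le; omega) hi rfl).mono (hXY _ h0 h1)
        (.inl (huS i hi))
  have hlab : ∀ i < s, ∀ m, ptr^[m] i < s ∧ Conn A Y (u i) (u (ptr^[m] i)) := by
    intro i hi m
    induction m with
    | zero => exact ⟨hi, .refl _⟩
    | succ m ih =>
      rw [Function.iterate_succ_apply']
      exact ⟨hs.ptr_lt _ ih.1, ih.2.trans (hlink _ ih.1)⟩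
  have hlabc : ∀ i < s, ∀ i' < s, ptr^[n] i' = ptr^[n] i → Conn A Y (u i) (u i') := by
    intro i hi i' hi' h
    exact (hlab i hi n).2.trans (h ▸ ((hlab i' hi' n).2).symm hA)
  -- Each component of `T` that meets `S` is matched by a component of `Y` that is at least as
  -- large. Its slots below `s` (`D`) stay connected by the links, and its slots demanded at time
  -- `j` (`E j`) are compensated by the vertices `G j` of the `j`-th set. Distinct components keep
  -- the `G j` disjoint.
  have hkey : ∀ w ∈ S, csize n A T w ≤ csize n A Y w := by
    rintro w ⟨i, hi, rfl⟩
    have hiK := hi.trans_le hu.le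
    set D := (Finset.range s).filter fun a => ptr^[n] a = ptr^[n] i with hD
    set E : ℕ → Finset ℕ := fun j => (Finset.range n).filter fun a =>
      s ≤ a ∧ a < T.card ∧ tm a = j ∧ ptr^[n] a = ptr^[n] i with hE
    set G : ℕ → Finset ℕ := fun j => (Finset.range n).filter fun x => x ∈ X j ∧
      ∃ i' < n, i' < s ∧ ptr^[n] i' = ptr^[n] i ∧ Conn A (S ∪ X j) x (u i') with hG
    have h1 : csize n A T (u i) ≤ (D ∪ (Finset.Icc 1 Q.card).biUnion E).card := by
      refine (csize_le_card ((D ∪ (Finset.Icc 1 Q.card).biUnion E).image u) fun x hxn hx =>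
          ?_).trans
        Finset.card_image_le
      obtain ⟨a, ha, rfl⟩ := hu.surj x (hx.mem_iff.1 (hu.mem i hiK))
      have hl := (hs.lab_iff a ha i hiK).2 (hx.symm hA)
      refine Finset.mem_image.2 ⟨a, ?_, rfl⟩
      simp only [Finset.mem_union, Finset.mem_biUnion, Finset.mem_filter, Finset.mem_range,
        Finset.mem_Icc, hD, hE]
      by_cases has : a < s
      · exact .inl ⟨has, hl⟩
      · exact .inr ⟨tm a, hs.tm_mem a ha (by omega), by omega, by omega, ha, rfl, hl⟩
    have h2 : (D ∪ (Finset.Icc 1 Q.card).biUnion E).card ≤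
        D.card + ∑ j ∈ Finset.Icc 1 Q.card, (G j).card := by
      refine (Finset.card_union_le _ _).trans (Nat.add_le_add_left
        (Finset.card_biUnion_le.trans (Finset.sum_le_sum fun j hj => ?_)) _)
      obtain ⟨hj1, hj2⟩ := Finset.mem_Icc.1 hj
      exact (hX j hj1 (hj2.trans hJ)).2.2.gain i (by omega) hi
    have h3 : D.card + ∑ j ∈ Finset.Icc 1 Q.card, (G j).card =
        (D.image u ∪ (Finset.Icc 1 Q.card).biUnion G).card := by
      rw [Finset.card_union_of_disjoint, Finset.card_biUnion, Finset.card_image_of_injOn]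
      · intro a ha b hb hab
        simp only [hD, Finset.coe_filter, Finset.mem_range, Set.mem_ofPred_eq] at ha hb
        exact hu.inj a (ha.1.trans_le hu.le) b (hb.1.trans_le hu.le) hab
      · intro j hj l hl hjl
        rw [Function.onFun, Finset.disjoint_left]
        intro x hx hx'
        obtain ⟨hj1, hj2⟩ := Finset.mem_Icc.1 hj
        obtain ⟨hl1, hl2⟩ := Finset.mem_Icc.1 hl
        exact hjl (hXX j hj1 (hj2.trans hJ) l hl1 (hl2.trans hJ) x (Finset.mem_filter.1 hx).2.1
          (Finset.mem_filter.1 hx').2.1)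
      · rw [Finset.disjoint_left]
        intro x hx hx'
        obtain ⟨j, hj, hxj⟩ := Finset.mem_biUnion.1 hx'
        obtain ⟨hj1, hj2⟩ := Finset.mem_Icc.1 hj
        obtain ⟨a, ha, rfl⟩ := Finset.mem_image.1 hx
        exact hXS j hj1 (hj2.trans hJ) _ (Finset.mem_filter.1 hxj).2.1
          (huS a (Finset.mem_range.1 (Finset.mem_filter.1 ha).1))
    refine (h1.trans (h2.trans h3.le)).trans (le_csize _ fun x hx => ?_)
    rcases Finset.mem_union.1 hx with hx | hx
    · obtain ⟨a, ha, rfl⟩ := Finset.mem_image.1 hx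
      obtain ⟨ha, hl⟩ := Finset.mem_filter.1 ha
      have has := Finset.mem_range.1 ha
      exact ⟨hTn _ (hu.mem a (has.trans_le hu.le)), hlabc i hi a has hl⟩
    · obtain ⟨j, hj, hxj⟩ := Finset.mem_biUnion.1 hx
      obtain ⟨hj1, hj2⟩ := Finset.mem_Icc.1 hj
      obtain ⟨hxn, hxX, i', -, hi', hl, hc⟩ := Finset.mem_filter.1 hxj
      refine ⟨Finset.mem_range.1 hxn, (hlabc i hi i' hi' hl).trans (Conn.symm hA ?_)⟩
      exact hc.mono (hXY j hj1 (hj2.trans hJ)) (.inr hxX)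
  refine ⟨fun a haY b hbY hab => ?_, ?_⟩
  · have hbS : b ∉ S := fun h => hbY (hSY h)
    -- In the component of some `X j` the size is controlled by `check`; elsewhere the absence of
    -- bad vertices suffices. Bounds that refer to `T` are transferred to `Y` by `hkey`.
    by_cases hb : ∃ j, 1 ≤ j ∧ j ≤ J ∧ Conn A S (v j) b
    · obtain ⟨j, hj1, hj2, hb⟩ := hb
      have haX : a ∈ S ∪ X j := by
        rcases (hY a).1 haY with h | ⟨l, hl1, hl2, h⟩
        · exact .inl h
        · have hc : Conn A S (v l) a := (hX l hl1 hl2).2.1 h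
          have := hv l hl1 hl2 j hj1 hj2 ((hc.trans (.single hab
            (iff_of_false (hXS l hl1 hl2 a h) hbS))).trans (hb.symm hA))
          exact .inr (this ▸ h)
      have hbX : b ∉ S ∪ X j := fun h => hbY (hXY j hj1 hj2 h)
      have h1 : csize n A Y b ≤ csize n A (S ∪ X j) b :=
        csize_le fun x _ hx => hx.anti (hXY j hj1 hj2) hbY
      refine h1.trans ?_
      rcases (hX j hj1 hj2).2.2.check a (hA.lt hab) haX b (hA.lt' hab) hbX hab with
        h | ⟨w, hwn, hw, h⟩
      · exact h.trans (csize_le fun x _ hx => hx.mono (hXY j hj1 hj2) haX)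
      -- Off `S` the cap is `0`, which cannot bound the size of a component; hence `w` is in `S`.
      · have hpos : 0 < csize n A (S ∪ X j) b := csize_pos (hA.lt' hab)
        have hwS : w ∈ S := by
          by_contra hwS
          rw [cap, if_neg hwS] at h
          omega
        rw [cap, if_pos hwS] at h
        rw [(hw.mono (hXY j hj1 hj2) haX).csize_eq hA]
        exact h.trans (hkey w hwS)
    · push Not at hb
      have haS : a ∈ S := by
        rcases (hY a).1 haY with h | ⟨l, hl1, hl2, h⟩
        · exact h
        · have hc : Conn A S (v l) a := (hX l hl1 hl2).2.1 h
          exact absurd (hc.trans (.single hab (iff_of_false (hXS l hl1 hl2 a h) hbS)))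
            (hb l hl1 hl2)
      have h1 : csize n A S b ≤ csize n A T a := by
        by_contra h
        exact hnotbad b ⟨hbS, a, haS, hab, by omega⟩
      exact (csize_le fun x _ hx => hx.anti hSY hbY).trans (h1.trans (hkey a haS))
  · have h1 : F ⊆ (Finset.range s).image u ∪ (Finset.Icc 1 J).biUnion fun j =>
        (Finset.range n).filter fun x => x ∈ X j := by
      intro x hx
      obtain ⟨hxn, hxY⟩ := hF x hx
      simp only [Finset.mem_union, Finset.mem_image, Finset.mem_biUnion, Finset.mem_filter,
        Finset.mem_range, Finset.mem_Icc]
      rcases (hY x).1 hxY with ⟨i, hi, h⟩ | ⟨j, h1, h2, h3⟩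
      · exact .inl ⟨i, hi, h⟩
      · exact .inr ⟨j, ⟨h1, h2⟩, hxn, h3⟩
    -- Every slot has only one time, so all demands together concern at most the `T.card - s` slots
    -- from `s` on.
    have h2 : ∑ j ∈ Finset.Icc 1 J,
        ((Finset.range n).filter fun a => s ≤ a ∧ a < T.card ∧ tm a = j).card ≤ T.card - s := by
      rw [← Finset.card_biUnion, ← Nat.card_Ico]
      · refine Finset.card_le_card fun a ha => ?_
        simp only [Finset.mem_biUnion, Finset.mem_filter, Finset.mem_Ico] at *
        obtain ⟨j, -, -, h1, h2, -⟩ := ha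
        exact ⟨h1, h2⟩
      · intro j _ l _ hjl
        rw [Function.onFun, Finset.disjoint_left]
        intro a ha ha'
        exact hjl ((Finset.mem_filter.1 ha).2.2.2.symm.trans (Finset.mem_filter.1 ha').2.2.2)
    have h3 : ((Finset.Icc 1 J).biUnion fun j =>
        (Finset.range n).filter fun x => x ∈ X j).card ≤ T.card - s := by
      refine Finset.card_biUnion_le.trans ((Finset.sum_le_sum fun j hj => ?_).trans h2)
      obtain ⟨hj1, hj2⟩ := Finset.mem_Icc.1 hj
      exact (hX j hj1 hj2).2.2.size
    have h4 : ((Finset.range s).image u).card ≤ s := Finset.card_image_le.trans (by simp)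
    have h5 := (Finset.card_le_card h1).trans (Finset.card_union_le _ _)
    have := hu.le
    omega

end SafeSet

/-! ### Derived expressions and commands -/

namespace SafeSet

namespace Exp

/-- The value is nonzero. -/
def Holds (e : Exp) (s : State) : Prop := e.eval s ≠ 0

/-- Negation. -/
def not (e : Exp) : Exp := ite e (num 0) (num 1)
/-- Conjunction. -/
def and (e f : Exp) : Exp := ite e f (num 0)
/-- Disjunction. -/
def or (e f : Exp) : Exp := ite e (num 1) f
/-- Implication. -/
def imp (e f : Exp) : Exp := ite e f (num 1)
/-- Comparison. -/
def le (e f : Exp) : Exp := not (lt f e)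
/-- Equality. -/
def eq (e f : Exp) : Exp := and (le e f) (le f e)
/-- Bounded universal quantification. -/
def all (x : ℕ) (e : Exp) : Exp := not (cnt x (not e))
/-- The entry `i` of a one-dimensional array. -/
def at0 (a : ℕ) (i : Exp) : Exp := get a i (num 0)
/-- The least value of the register `y` for which `e` holds. -/
def fst (x y : ℕ) (e : Exp) : Exp := cnt x (all y (imp (le (reg y) (reg x)) (not e)))

variable {e f : Exp} {s : State}

theorem holds_not : e.not.Holds s ↔ ¬ e.Holds s := by
  by_cases h : e.eval s = 0 <;> simp [Holds, not, eval, h]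

theorem holds_and : (e.and f).Holds s ↔ e.Holds s ∧ f.Holds s := by
  by_cases h : e.eval s = 0 <;> simp [Holds, and, eval, h]

theorem holds_or : (e.or f).Holds s ↔ e.Holds s ∨ f.Holds s := by
  by_cases h : e.eval s = 0 <;> simp [Holds, or, eval, h]

theorem holds_imp : (e.imp f).Holds s ↔ (e.Holds s → f.Holds s) := by
  by_cases h : e.eval s = 0 <;> simp [Holds, imp, eval, h]

theorem holds_lt : (lt e f).Holds s ↔ e.eval s < f.eval s := by
  simp [Holds, eval]

theorem holds_le : (le e f).Holds s ↔ e.eval s ≤ f.eval s := by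
  rw [le, holds_not, holds_lt, not_lt]

theorem holds_eq : (eq e f).Holds s ↔ e.eval s = f.eval s := by
  rw [eq, holds_and, holds_le, holds_le, le_antisymm_iff]

theorem holds_cnt {x : ℕ} : (cnt x e).Holds s ↔ ∃ i < s.reg 0, e.Holds (s.setReg x i) := by
  simp [Holds, eval, Finset.filter_eq_empty_iff]

theorem holds_all {x : ℕ} : (all x e).Holds s ↔ ∀ i < s.reg 0, e.Holds (s.setReg x i) := by
  simp [all, holds_not, holds_cnt]

theorem holds_reg {x : ℕ} : (reg x).Holds s ↔ s.reg x ≠ 0 := Iff.rfl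

theorem holds_get {a : ℕ} : (get a e f).Holds s ↔ s.arr a (e.eval s) (f.eval s) ≠ 0 := Iff.rfl

theorem holds_at0 {a : ℕ} : (at0 a e).Holds s ↔ s.arr a (e.eval s) 0 ≠ 0 := Iff.rfl

theorem eval_at0 {a : ℕ} : (at0 a e).eval s = s.arr a (e.eval s) 0 := rfl

open Classical in
theorem eval_cnt {x : ℕ} : (cnt x e).eval s =
    ((Finset.range (s.reg 0)).filter fun i => e.Holds (s.setReg x i)).card := by
  simp only [eval, Holds]
  congr

theorem eval_or_ne {e f : Exp} : (e.or f).eval s ≠ 0 ↔ e.Holds s ∨ f.Holds s := holds_or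

/-- The numbers up to which the condition never holds are exactly those below its least witness, so
counting them performs the minimisation. -/
theorem eval_fst {x y : ℕ} (hx : x ≠ 0) (hxy : x ≠ y) {P : ℕ → Prop}
    (h : ∀ i, ∀ v < s.reg 0, e.Holds ((s.setReg x i).setReg y v) ↔ P v) :
    (fst x y e).eval s = least (s.reg 0) P := by
  classical
  rw [fst, eval_cnt, least]
  congr 1
  refine Finset.filter_congr fun i _ => ?_
  simp only [holds_all, holds_imp, holds_le, holds_not, eval, State.setReg_reg, if_neg hx.symm,
    if_true, if_neg hxy]
  exact forall₂_congr fun v hv => by rw [h i v hv]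

end Exp

namespace Cmd

open Exp

open Classical in
theorem run_ite (e : Exp) (c c' : Cmd) (s : State) :
    (ite e c c').run s = if e.Holds s then c.run s else c'.run s := by
  simp only [run, Holds]
  congr

/-- Set all entries of the array `a` with indices below `reg 0`, for the indices `x`, `y`. -/
def tab (a x y : ℕ) (e : Exp) : Cmd := loop x 0 (loop y 0 (put a (reg x) (reg y) e))

/-- Since `e` does not read the array being written, every entry is evaluated as in the state at the
start. This is why updates that depend on the old array go through a temporary one. -/
theorem run_tab {a x y d : ℕ} {e : Exp} (hx : x ≠ 0) (hxy : x ≠ y) (he : e.ok d)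
    (ha : a ∉ e.arrs) (s : State) {i j : ℕ} (hi : i < s.reg 0) (hj : j < s.reg 0) :
    ((tab a x y e).run s).arr a i j = e.eval ((s.setReg x i).setReg y j) := by
  let P : ℕ → State → Prop := fun k s' => (∀ z ≠ x, s'.reg z = s.reg z) ∧
    (∀ b ≠ a, s'.arr b = s.arr b) ∧
    ∀ p < k, ∀ q < s.reg 0, s'.arr a p q = e.eval ((s.setReg x p).setReg y q)
  have key : P (s.reg 0) (iter (fun i s => (loop y 0 (put a (reg x) (reg y) e)).run
      (s.setReg x i)) (s.reg 0) s) := by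
    refine iter_induction (P := P) ⟨fun _ _ => rfl, fun _ _ => rfl, fun p hp => by omega⟩ ?_
    rintro k hk s1 ⟨h1, h2, h3⟩
    let P' : ℕ → State → Prop := fun l s' => (∀ z ≠ y, s'.reg z = (s1.setReg x k).reg z) ∧
      (∀ b ≠ a, s'.arr b = s.arr b) ∧
      (∀ p < k, ∀ q < s.reg 0, s'.arr a p q = e.eval ((s.setReg x p).setReg y q)) ∧
      ∀ q < l, s'.arr a k q = e.eval ((s.setReg x k).setReg y q)
    have hN : (s1.setReg x k).reg 0 = s.reg 0 := by
      rw [State.setReg_reg, if_neg hx.symm, h1 0 hx.symm]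
    have key' : P' (s.reg 0) (iter (fun i s => (put a (reg x) (reg y) e).run (s.setReg y i))
        (s.reg 0) (s1.setReg x k)) := by
      refine iter_induction (P := P') ⟨fun _ _ => rfl, h2, h3, fun q hq => by omega⟩ ?_
      rintro l hl s2 ⟨g1, g2, g3, g4⟩
      have hx2 : s2.reg x = k := by rw [g1 x hxy, State.setReg_reg, if_pos rfl]
      have hev : e.eval (s2.setReg y l) = e.eval ((s.setReg x k).setReg y l) := by
        refine eval_congr he (fun z _ => ?_) fun b hb => ?_
        · simp only [State.setReg_reg]
          split_ifs with hzy hzx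
          · rfl
          · rw [hzx, hx2]
          · rw [g1 z hzy, State.setReg_reg, if_neg hzx, h1 z hzx]
        · exact g2 b fun h => ha (h ▸ hb)
      simp only [run, eval, State.setReg_reg, if_true, if_neg hxy, hx2, hev]
      refine ⟨fun z hz => ?_, fun b hb => ?_, fun p hp q hq => ?_, fun q hq => ?_⟩
      · simp only [State.setArr_reg]
        rw [State.setReg_reg, if_neg hz, g1 z hz]
      · funext i j
        rw [State.setArr_arr, if_neg (by tauto), State.setReg_arr, g2 b hb]
      · rw [State.setArr_arr, if_neg (by omega)]
        exact g3 p hp q hq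
      · rw [State.setArr_arr]
        split_ifs with h
        · rw [h.2.2]
        · exact g4 q (by omega)
    obtain ⟨g1, g2, g3, g4⟩ := key'
    simp only [run, hN]
    simp only [run] at g1 g2 g3 g4
    refine ⟨fun z hz => ?_, g2, fun p hp q hq => ?_⟩
    · rw [State.setReg_reg]
      split_ifs with hzy
      · rw [hzy, State.setReg_reg, if_neg hxy.symm, h1 y hxy.symm]
      · rw [g1 z hzy, State.setReg_reg, if_neg hz, h1 z hz]
    · rcases Nat.lt_succ_iff_lt_or_eq.1 hp with hp | rfl
      · exact g3 p hp q hq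
      · exact g4 q hq
  exact key.2.2 i hi j hj

/-- Iterating over a loop: an invariant that may depend on the number of iterations. -/
theorem loop_induction {P : ℕ → State → Prop} {x y : ℕ} {c : Cmd} {s : State}
    (h0 : P 0 s) (hs : ∀ i < s.reg y, ∀ s', P i s' → P (i + 1) (c.run (s'.setReg x i)))
    (hx : ∀ i s' v, P i s' → P i (s'.setReg x v)) : P (s.reg y) ((loop x y c).run s) :=
  hx _ _ _ (iter_induction h0 hs)

/-- A property that is established in some iteration and kept by the other ones. -/
theorem loop_reaches {P : ℕ → State → Prop} {G : State → Prop} {x y : ℕ} {c : Cmd} {s : State}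
    {k : ℕ} (hk : k < s.reg y) (h0 : P 0 s)
    (hs : ∀ i < s.reg y, ∀ s', P i s' → P (i + 1) (c.run (s'.setReg x i)))
    (hx : ∀ s' v, G s' → G (s'.setReg x v))
    (hG : ∀ s', P k s' → G (c.run (s'.setReg x k)))
    (hkeep : ∀ i < s.reg y, ∀ s', P i s' → G s' → G (c.run (s'.setReg x i))) :
    G ((loop x y c).run s) := by
  refine hx _ _ ?_
  have := iter_induction (f := fun i s => c.run (s.setReg x i))
    (P := fun i s' => P i s' ∧ (k < i → G s')) (k := s.reg y) (s := s) ⟨h0, fun h => by omega⟩ (by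
      rintro i hi s' ⟨h1, h2⟩
      refine ⟨hs i hi s' h1, fun h => ?_⟩
      rcases Nat.lt_succ_iff_lt_or_eq.1 h with h | rfl
      · exact hkeep i hi s' h1 (h2 h)
      · exact hG s' h1)
  exact this.2 hk

end Cmd

/-! ### Graphs and vertex sets in memory; transitive closure -/

/-- The state holds the graph. -/
structure Ctx (n : ℕ) (A : ℕ → ℕ → Prop) (s : State) : Prop where
  reg : s.reg 0 = n
  arr : ∀ i < n, ∀ j < n, s.arr 0 i j ≠ 0 ↔ A i j

theorem Ctx.run {n : ℕ} {A : ℕ → ℕ → Prop} {s : State} (h : Ctx n A s) {c : Cmd}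
    (h0 : 0 ∉ c.wr) (h1 : 0 ∉ c.wa) : Ctx n A (c.run s) :=
  ⟨(Cmd.run_reg h0 s).trans h.reg, by rw [Cmd.run_arr h1]; exact h.arr⟩

theorem Ctx.setReg {n : ℕ} {A : ℕ → ℕ → Prop} {s : State} (h : Ctx n A s) {x v : ℕ} (hx : x ≠ 0) :
    Ctx n A (s.setReg x v) :=
  ⟨by rw [State.setReg_reg, if_neg hx.symm, h.reg], h.arr⟩

/-- The array `a` holds the characteristic function of `Y`. -/
def IsSet (n a : ℕ) (Y : Set ℕ) (s : State) : Prop := ∀ i < n, s.arr a i 0 ≠ 0 ↔ i ∈ Y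

/-- The array `a` holds the connectivity relation for `Y`. -/
def IsConn (n : ℕ) (A : ℕ → ℕ → Prop) (a : ℕ) (Y : Set ℕ) (s : State) : Prop :=
  ∀ i < n, ∀ j < n, s.arr a i j ≠ 0 ↔ Conn A Y i j

theorem IsConn.card_eq {n : ℕ} {A : ℕ → ℕ → Prop} {a : ℕ} {Y : Set ℕ} {s : State}
    (h : IsConn n A a Y s) {i : ℕ} (hi : i < n) {p : ℕ → Prop} [DecidablePred p]
    (hp : ∀ j < n, p j ↔ s.arr a i j ≠ 0) :
    ((Finset.range n).filter p).card = csize n A Y i := by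
  classical
  unfold csize
  congr 1
  ext j
  simp only [Finset.mem_filter, Finset.mem_range, and_congr_right_iff]
  exact fun hj => (hp j hj).trans (h i hi j hj)

namespace Cmd

open Exp

/-- The connectivity relation for the set in array `y` is written into array `t`. -/
def closure (y t tmp : ℕ) : Cmd :=
  (tab t 20 21 (or (eq (reg 20) (reg 21)) (and (get 0 (reg 20) (reg 21))
    (eq (not (at0 y (reg 20))) (not (at0 y (reg 21))))))).seq
  (loop 39 0 ((tab tmp 20 21 (or (get t (reg 20) (reg 21))
      (cnt 22 (and (get t (reg 20) (reg 22)) (get t (reg 22) (reg 21)))))).seq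
    (tab t 20 21 (get tmp (reg 20) (reg 21)))))

/-- The relation is composed with itself `n` times. In each round a row is already complete or gains
an entry. Since a row has at most `n` entries, all rows are complete in the end; this is cruder than
repeated squaring but simpler to count. -/
theorem closure_spec {n : ℕ} {A : ℕ → ℕ → Prop} {s : State} (hs : Ctx n A s) {y t tmp : ℕ}
    {Y : Set ℕ} (hY : IsSet n y Y s) (hA : IsGraph n A) (hyt : y ≠ t) (htt : t ≠ tmp) (ht0 : t ≠ 0)
        :
    IsConn n A t Y ((closure y t tmp).run s) := by
  classical
  set s0 := (tab t 20 21 (or (eq (reg 20) (reg 21)) (and (get 0 (reg 20) (reg 21))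
    (eq (not (at0 y (reg 20))) (not (at0 y (reg 21))))))).run s with hs0
  have hreg0 : s0.reg 0 = n := by
    rw [hs0, run_reg (by simp [tab, wr]), hs.reg]
  -- Array `y` may hold arbitrary nonzero entries. Their negations are `0` or `1`, so comparing
  -- these amounts to comparing membership in `Y`.
  have h0 : ∀ i < n, ∀ j < n, s0.arr t i j ≠ 0 ↔ i = j ∨ A i j ∧ (i ∈ Y ↔ j ∈ Y) := by
    intro i hi j hj
    rw [hs0, run_tab (d := 50) (by decide) (by decide) (by rfl)
      (by simp [Exp.arrs, Exp.or, Exp.and, Exp.eq, Exp.le, Exp.not, at0, ht0, hyt.symm]) s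
      (by rwa [hs.reg]) (by rwa [hs.reg]), eval_or_ne]
    simp only [holds_eq, holds_and, holds_get, Exp.eval, State.setReg_reg, Exp.not, eval_at0,
      State.setReg_arr]
    simp only [if_true, show (20 : ℕ) ≠ 21 by decide, if_false]
    rw [hs.arr i hi j hj]
    have h1 := hY i hi
    have h2 := hY j hj
    by_cases hiY : i ∈ Y <;> by_cases hjY : j ∈ Y <;> simp_all
  let P : ℕ → State → Prop := fun r s' => s'.reg 0 = n ∧
    (∀ i < n, ∀ j < n, s'.arr t i j ≠ 0 → Conn A Y i j) ∧
    (∀ i < n, ∀ j < n, i = j ∨ A i j ∧ (i ∈ Y ↔ j ∈ Y) → s'.arr t i j ≠ 0) ∧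
    ∀ i < n, (∀ j < n, Conn A Y i j → s'.arr t i j ≠ 0) ∨
      r + 1 ≤ ((Finset.range n).filter fun j => s'.arr t i j ≠ 0).card
  have key : P (s0.reg 0) ((loop 39 0 ((tab tmp 20 21 (or (get t (reg 20) (reg 21))
      (cnt 22 (and (get t (reg 20) (reg 22)) (get t (reg 22) (reg 21)))))).seq
    (tab t 20 21 (get tmp (reg 20) (reg 21))))).run s0) := by
    refine loop_induction (P := P) ⟨hreg0, ?_, fun i hi j hj => (h0 i hi j hj).2, ?_⟩ ?_ ?_
    · intro i hi j hj h
      rcases (h0 i hi j hj).1 h with rfl | h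
      · exact .refl _
      · exact .single h.1 h.2
    · intro i hi
      right
      exact Finset.card_pos.2 ⟨i, by simp only [Finset.mem_filter, Finset.mem_range]; exact
        ⟨hi, (h0 i hi i hi).2 (.inl rfl)⟩⟩
    · rintro r - s1 ⟨g0, g1, g2, g3⟩
      have hstep : ∀ i < n, ∀ j < n, (((tab tmp 20 21 (or (get t (reg 20) (reg 21))
          (cnt 22 (and (get t (reg 20) (reg 22)) (get t (reg 22) (reg 21)))))).seq
          (tab t 20 21 (get tmp (reg 20) (reg 21)))).run (s1.setReg 39 r)).arr t i j ≠ 0 ↔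
          s1.arr t i j ≠ 0 ∨ ∃ k < n, s1.arr t i k ≠ 0 ∧ s1.arr t k j ≠ 0 := by
        intro i hi j hj
        have e1 : (s1.setReg 39 r).reg 0 = n := g0
        rw [run, run_tab (d := 50) (by decide) (by decide) (by rfl)
          (by simp [Exp.arrs, htt]) _ (by rwa [run_reg (by simp [tab, wr]), e1])
          (by rwa [run_reg (by simp [tab, wr]), e1])]
        simp only [Exp.eval, State.setReg_reg, State.setReg_arr]
        simp only [if_true, show (20 : ℕ) ≠ 21 by decide, if_false]
        rw [run_tab (d := 50) (by decide) (by decide) (by rfl)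
          (by simp [Exp.arrs, Exp.or, Exp.and, htt.symm]) _ (by rwa [e1]) (by rwa [e1]), eval_or_ne]
        simp only [holds_cnt, holds_get, holds_and, Exp.eval, State.setReg_reg, State.setReg_arr]
        simp [g0]
      have hmono : ∀ i < n, ∀ j < n, s1.arr t i j ≠ 0 → (((tab tmp 20 21 (or (get t (reg 20) (reg
          21))
          (cnt 22 (and (get t (reg 20) (reg 22)) (get t (reg 22) (reg 21)))))).seq
          (tab t 20 21 (get tmp (reg 20) (reg 21)))).run (s1.setReg 39 r)).arr t i j ≠ 0 :=
        fun i hi j hj h => (hstep i hi j hj).2 (.inl h)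
      refine ⟨by rw [run_reg (by simp [tab, wr])]; exact g0, ?_,
        fun i hi j hj h => hmono i hi j hj (g2 i hi j hj h), ?_⟩
      · intro i hi j hj h
        rcases (hstep i hi j hj).1 h with h | ⟨k, hk, h1, h2⟩
        · exact g1 i hi j hj h
        · exact (g1 i hi k hk h1).trans (g1 k hk j hj h2)
      · intro i hi
        rcases g3 i hi with h | h
        · exact .inl fun j hj hc => hmono i hi j hj (h j hj hc)
        · by_cases hfull : ∀ j < n, Conn A Y i j → s1.arr t i j ≠ 0
          · exact .inl fun j hj hc => hmono i hi j hj (hfull j hj hc)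
          · push Not at hfull
            obtain ⟨j, hj, hc, hj0⟩ := hfull
            -- A walk to a missing vertex `j` leaves the set of known entries along an edge from `p`
            -- to `q`; composition with this edge adds `q`.
            obtain ⟨p, q, hip, hpq, hside, hpW, hqW⟩ := hc.exists_crossing
              (W := {j | s1.arr t i j ≠ 0}) (g2 i hi i hi (.inl rfl)) (fun h => h hj0)
            right
            have hp := hip.lt hA hi
            have hq := hA.lt' hpq
            refine Nat.succ_le_of_lt (h.trans_lt (Finset.card_lt_card
              (Finset.ssubset_iff_of_subset (fun x hx => ?_) |>.2 ⟨q, ?_, ?_⟩)))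
            · simp only [Finset.mem_filter, Finset.mem_range] at hx ⊢
              exact ⟨hx.1, hmono i hi x hx.1 hx.2⟩
            · simp only [Finset.mem_filter, Finset.mem_range]
              exact ⟨hq, (hstep i hi q hq).2 (.inr ⟨p, hp, hpW, g2 p hp q hq (.inr ⟨hpq, hside⟩)⟩)⟩
            · simp only [Finset.mem_filter, Finset.mem_range]
              exact fun h => hqW h.2
    · rintro r s1 v h
      exact h
  obtain ⟨-, g1, -, g3⟩ := key
  intro i hi j hj
  refine ⟨g1 i hi j hj, fun h => ?_⟩
  rcases g3 i hi with h' | h'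
  · exact h' j hj h
  -- After `n` rounds an incomplete row would have `n + 1` entries.
  · have := Finset.card_le_card (Finset.filter_subset (fun j => ((loop 39 0 ((tab tmp 20 21
      (or (get t (reg 20) (reg 21))
      (cnt 22 (and (get t (reg 20) (reg 22)) (get t (reg 22) (reg 21)))))).seq
      (tab t 20 21 (get tmp (reg 20) (reg 21))))).run s0).arr t i j ≠ 0) (Finset.range n))
    rw [Finset.card_range] at this
    omega

end Cmd

end SafeSet

/-! ### Counting through all strings of digits -/

namespace SafeSet

/-- The `i`-th digit of `t` in the mixed radix system with bases `b`. -/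
def dig (b : ℕ → ℕ) (t i : ℕ) : ℕ := t / (∏ l ∈ Finset.range i, b l) % b i

theorem dig_zero (b : ℕ → ℕ) (i : ℕ) : dig b 0 i = 0 := by simp [dig]

theorem dig_add_one_eq_iff {b : ℕ → ℕ} {i : ℕ} (hb : 0 < b i) (t : ℕ) :
    dig b t i + 1 = b i ↔ b i ∣ t / (∏ l ∈ Finset.range i, b l) + 1 := by
  unfold dig
  generalize t / (∏ l ∈ Finset.range i, b l) = q
  have hlt := Nat.mod_lt q hb
  have h1 := Nat.div_add_mod q (b i)
  constructor
  · intro h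
    refine ⟨q / b i + 1, ?_⟩
    rw [mul_add, mul_one]; omega
  · intro h
    have h2 : b i ∣ q % b i + 1 := by
      have h3 : b i ∣ b i * (q / b i) + (q % b i + 1) := by rwa [← add_assoc, h1]
      exact (Nat.dvd_add_right (Dvd.intro _ rfl)).1 h3
    exact le_antisymm hlt (Nat.le_of_dvd (by omega) h2)

/-- A carry reaches position `i` when the last `i` digits of `t` are all maximal, that is, when the
last `i` digits of `t + 1` all vanish. -/
theorem dig_carry_iff {b : ℕ → ℕ} {i : ℕ} (hb : ∀ l < i, 0 < b l) (t : ℕ) :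
    (∀ l < i, dig b t l + 1 = b l) ↔ (∏ l ∈ Finset.range i, b l) ∣ t + 1 := by
  induction i with
  | zero => simp
  | succ i ih =>
    have hP : 0 < ∏ l ∈ Finset.range i, b l :=
      Finset.prod_pos fun l hl => hb l (by have := Finset.mem_range.1 hl; omega)
    rw [Finset.prod_range_succ]
    have h1 : (∀ l < i + 1, dig b t l + 1 = b l) ↔
        (∀ l < i, dig b t l + 1 = b l) ∧ dig b t i + 1 = b i := by
      constructor
      · exact fun h => ⟨fun l hl => h l (by omega), h i (by omega)⟩
      · rintro ⟨h, h'⟩ l hl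
        rcases Nat.lt_succ_iff_lt_or_eq.1 hl with hl | rfl
        exacts [h l hl, h']
    rw [h1, ih fun l hl => hb l (by omega), dig_add_one_eq_iff (hb i (by omega))]
    constructor
    · rintro ⟨h, h'⟩
      have : (t + 1) / (∏ l ∈ Finset.range i, b l) = t / (∏ l ∈ Finset.range i, b l) + 1 := by
        rw [Nat.succ_div, if_pos h]
      rw [← this] at h'
      obtain ⟨c, hc⟩ := h'
      refine ⟨c, ?_⟩
      rw [mul_assoc, ← hc, Nat.mul_div_cancel' h]
    · intro h
      have h' := (Dvd.intro _ rfl : (∏ l ∈ Finset.range i, b l) ∣ _ * b i).trans h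
      refine ⟨h', ?_⟩
      rw [← Nat.succ_div_of_dvd h']
      exact Nat.dvd_div_of_mul_dvd h

theorem dig_succ {b : ℕ → ℕ} {i : ℕ} (hb : ∀ l ≤ i, 0 < b l) (t : ℕ) :
    dig b (t + 1) i = if ∀ l < i, dig b t l + 1 = b l then
      (if dig b t i + 1 = b i then 0 else dig b t i + 1) else dig b t i := by
  have hbi := hb i le_rfl
  have h1 := dig_carry_iff (fun l (hl : l < i) => hb l hl.le) t
  have h2 := dig_add_one_eq_iff hbi t
  by_cases h : ∀ l < i, dig b t l + 1 = b l
  · rw [if_pos h]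
    have h3 : dig b (t + 1) i = (t / (∏ l ∈ Finset.range i, b l) + 1) % b i := by
      rw [dig, Nat.succ_div_of_dvd (h1.1 h)]
    rw [h3]
    split_ifs with h4
    · exact Nat.mod_eq_zero_of_dvd (h2.1 h4)
    · have hlt : dig b t i < b i := Nat.mod_lt _ hbi
      rw [Nat.add_mod, Nat.mod_eq_of_lt (a := t / (∏ l ∈ Finset.range i, b l) % b i + 1 % b i)]
      · have : 1 < b i := by omega
        rw [Nat.mod_eq_of_lt this]; rfl
      · have : 1 < b i := by omega
        rw [Nat.mod_eq_of_lt this]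
        change dig b t i + 1 < b i
        omega
  · rw [if_neg h, dig, Nat.succ_div_of_not_dvd fun hd => h (h1.2 hd)]
    rfl

/-- Every string of digits occurs. -/
theorem exists_dig_eq {b d : ℕ → ℕ} (n : ℕ) (hd : ∀ i < n, d i < b i) :
    ∃ t < ∏ l ∈ Finset.range n, b l, ∀ i < n, dig b t i = d i := by
  induction n with
  | zero => exact ⟨0, by simp, fun i hi => by omega⟩
  | succ n ih =>
    obtain ⟨t, ht, hdt⟩ := ih fun i hi => hd i (by omega)
    have hdn := hd n (by omega)
    set P := ∏ l ∈ Finset.range n, b l with hP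
    -- The new leading digit has the weight `P`, which is divisible by all weights up to position
    -- `n`, so the lower digits are unchanged.
    refine ⟨t + d n * P, ?_, fun i hi => ?_⟩
    · rw [Finset.prod_range_succ, ← hP]
      calc t + d n * P < P + d n * P := by omega
        _ = (d n + 1) * P := by ring
        _ ≤ b n * P := Nat.mul_le_mul_right _ hdn
        _ = P * b n := mul_comm _ _
    · rcases Nat.lt_succ_iff_lt_or_eq.1 hi with hi | rfl
      · rw [← hdt i hi]
        have hdvd : (∏ l ∈ Finset.range i, b l) * b i ∣ P := by
          rw [← Finset.prod_range_succ, hP]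
          exact Finset.prod_dvd_prod_of_subset _ _ _ (Finset.range_subset_range.2 hi)
        obtain ⟨c, hc⟩ := hdvd
        have hpos : 0 < ∏ l ∈ Finset.range i, b l :=
          Finset.prod_pos fun l hl => (Nat.zero_le _).trans_lt
            (hd l (by have := Finset.mem_range.1 hl; omega))
        unfold dig
        rw [hc, show t + d n * ((∏ l ∈ Finset.range i, b l) * b i * c) =
          t + (∏ l ∈ Finset.range i, b l) * (b i * (d n * c)) by ring,
          Nat.add_mul_div_left _ _ hpos, Nat.add_mul_mod_self_left]
      · unfold dig
        rw [← hP, Nat.add_mul_div_right _ _ (by omega), Nat.div_eq_of_lt ht, zero_add,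
          Nat.mod_eq_of_lt hdn]

namespace Cmd

open Exp

/-- The array `a` of digits is increased by one, where `base i` is the base at position `i`. -/
def incr (a tmp : ℕ) (base : Exp → Exp) : Cmd :=
  (tab tmp 20 21 (.ite (all 22 (imp (lt (reg 22) (reg 20))
      (eq (succ (at0 a (reg 22))) (base (reg 22)))))
    (.ite (eq (succ (at0 a (reg 20))) (base (reg 20))) (num 0) (succ (at0 a (reg 20))))
    (at0 a (reg 20)))).seq
  (tab a 20 21 (at0 tmp (reg 20)))

/-- Each new digit is computed from the old digits alone, as in `dig_succ`, and written to a
temporary array first; no carry has to be propagated. -/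
theorem incr_spec {n : ℕ} {s : State} (hn : s.reg 0 = n) {a tmp : ℕ} {base : Exp → Exp} {b : ℕ → ℕ}
    (hat : a ≠ tmp) (hok : (base (reg 22)).ok 50) (hok' : (base (reg 20)).ok 50)
    (ha : tmp ∉ (base (reg 22)).arrs) (ha' : tmp ∉ (base (reg 20)).arrs)
    (hb : ∀ i < n, ∀ j < n, ∀ l < n,
      (base (reg 20)).eval ((s.setReg 20 i).setReg 21 j) = b i ∧
      (base (reg 22)).eval (((s.setReg 20 i).setReg 21 j).setReg 22 l) = b l)
    (hpos : ∀ i < n, 0 < b i) {t : ℕ} (hd : ∀ i < n, s.arr a i 0 = dig b t i) :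
    ∀ i < n, ((incr a tmp base).run s).arr a i 0 = dig b (t + 1) i := by
  intro i hi
  have hn0 : 0 < n := by omega
  rw [incr, run, run_tab (d := 50) (by decide) (by decide) (by rfl)
    (by simp [at0, arrs, hat]) _ (by rwa [run_reg (by simp [tab, wr]), hn])
    (by rwa [run_reg (by simp [tab, wr]), hn])]
  simp only [eval_at0, Exp.eval, State.setReg_reg, State.setReg_arr]
  simp only [if_true, show (20 : ℕ) ≠ 21 by decide, if_false]
  rw [run_tab (d := 50) (by decide) (by decide)
    (by simp [Exp.ok, all, imp, Exp.eq, Exp.le, Exp.and, Exp.not, at0, hok, hok'])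
    (by simp [Exp.arrs, all, imp, Exp.eq, Exp.le, Exp.and, Exp.not, at0, ha, ha', hat.symm]) _
    (by rwa [hn]) (by rwa [hn])]
  have h1 : (Exp.all 22 (imp (lt (reg 22) (reg 20))
      (Exp.eq (succ (at0 a (reg 22))) (base (reg 22))))).Holds ((s.setReg 20 i).setReg 21 0) ↔
      ∀ l < i, dig b t l + 1 = b l := by
    simp only [holds_all, holds_imp, holds_lt, holds_eq]
    have e0 : ((s.setReg 20 i).setReg 21 0).reg 0 = n := hn
    rw [e0]
    constructor
    · intro h l hl
      have := h l (by omega) (by simp [Exp.eval, State.setReg_reg, hl])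
      rw [(hb i hi 0 hn0 l (by omega)).2] at this
      simpa [Exp.eval, eval_at0, State.setReg_reg, hd l (by omega : l < n)] using this
    · intro h l hl hli
      rw [(hb i hi 0 hn0 l hl).2]
      have hli' : l < i := by simpa [Exp.eval, State.setReg_reg] using hli
      simpa [Exp.eval, eval_at0, State.setReg_reg, hd l hl] using h l hli'
  have h2 : (Exp.eq (succ (at0 a (reg 20))) (base (reg 20))).Holds ((s.setReg 20 i).setReg 21 0) ↔
      dig b t i + 1 = b i := by
    rw [holds_eq, (hb i hi 0 hn0 0 hn0).1]
    simp [Exp.eval, eval_at0, State.setReg_reg, hd i hi]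
  rw [dig_succ (fun l hl => hpos l (by omega))]
  have h3 : (at0 a (reg 20)).eval ((s.setReg 20 i).setReg 21 0) = dig b t i := by
    simp [Exp.eval, eval_at0, State.setReg_reg, hd i hi]
  have h4 : (succ (at0 a (reg 20))).eval ((s.setReg 20 i).setReg 21 0) = dig b t i + 1 := by
    rw [Exp.eval, h3]
  unfold Holds at h1 h2
  rw [Exp.eval, Exp.eval, Exp.eval, h3, h4]
  simp only [h1, h2]

/-- All entries of the array are set to zero. -/
def clear (a : ℕ) : Cmd := tab a 20 21 (num 0)

theorem clear_spec {n a : ℕ} {s : State} (hn : s.reg 0 = n) :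
    ∀ i < n, ∀ j < n, ((clear a).run s).arr a i j = 0 := by
  intro i hi j hj
  rw [clear, run_tab (d := 50) (by decide) (by decide) (by rfl) (by simp [arrs]) _
    (by rwa [hn]) (by rwa [hn])]
  rfl

/-! ### Computing powers -/

/-- The body of the loop for computing a power. -/
def powBody (dst base : ℕ) : Cmd := .ite (lt (reg 40) (reg 2))
  ((set 13 (num 0)).seq ((loop 41 dst (loop 42 base (set 13 (succ (reg 13))))).seq
    (set dst (reg 13)))) skip

/-- `dst` becomes the power of register `base` with the exponent in register `2`. -/
def pow (dst base : ℕ) : Cmd := (set dst (num 1)).seq (loop 40 0 (powBody dst base))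

/-- The invariant for computing the power `b ^ k`. -/
def PowInv (dst base b k i : ℕ) (s : State) : Prop :=
  s.reg 2 = k ∧ s.reg base = b ∧ s.reg dst = b ^ min i k

/-- With increments only, a multiplication is a double loop that counts in register `13`. The
outermost loop has `reg 0` iterations, of which those from `k` on do nothing; hence the exponent
`min i k`. -/
theorem PowInv.step {dst base b k i : ℕ} {s : State} (h1 : dst ∉ [0, 2, 13, 40, 41, 42])
    (h2 : base ∉ [dst, 13, 40, 41, 42]) (h : PowInv dst base b k i s) :
    PowInv dst base b k (i + 1) ((powBody dst base).run (s.setReg 40 i)) := by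
  simp only [List.mem_cons, List.not_mem_nil, or_false, not_or] at h1 h2
  obtain ⟨d0, d2, d13, d40, d41, d42⟩ := h1
  obtain ⟨bd, b13, b40, b41, b42⟩ := h2
  have hinner' : ∀ s : State, ((loop 42 base (set 13 (succ (reg 13)))).run s).reg 13 =
      s.reg 13 + s.reg base := fun s =>
    loop_induction (P := fun i s' => s'.reg 13 = s.reg 13 + i) rfl
      (fun i _ s' h => by simp [run, Exp.eval, State.setReg_reg, h, add_assoc])
      (fun i s' v h => by simpa [State.setReg_reg] using h)
  have hinner : ∀ s : State, ((loop 41 dst (loop 42 base (set 13 (succ (reg 13))))).run s).reg 13 =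
      s.reg 13 + s.reg dst * s.reg base := fun s =>
    (loop_induction (P := fun i s' => s'.reg base = s.reg base ∧ s'.reg 13 =
      s.reg 13 + i * s.reg base) ⟨rfl, by simp⟩
      (fun i _ s' h => by
        rw [hinner', run_reg (by simpa [wr] using b13), State.setReg_reg, State.setReg_reg,
          if_neg b41, if_neg (by decide), h.1, h.2]
        exact ⟨rfl, by ring⟩)
      (fun i s' v h => by simpa [State.setReg_reg, b41] using h)).2
  obtain ⟨h1, h2, h3⟩ := h
  rw [powBody, run_ite]
  have hc : (lt (reg 40) (reg 2)).Holds (s.setReg 40 i) ↔ i < k := by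
    simp [holds_lt, Exp.eval, State.setReg_reg, h1]
  split_ifs with h
  · rw [hc] at h
    simp only [PowInv, run.eq_4, run.eq_2, State.setReg_reg, Exp.eval, hinner, if_neg bd, if_true,
      if_neg (Ne.symm d2), if_neg b13, if_neg b40, if_neg d13, if_neg d40]
    refine ⟨?_, ?_, ?_⟩
    · rw [run_reg (by simp [wr])]
      simp [State.setReg_reg, h1]
    · rw [run_reg (by simpa [wr] using b13)]
      simp [State.setReg_reg, h2, b13, b40]
    · rw [h3, h2, min_eq_left (by omega), min_eq_left (by omega), pow_succ]
      simp
  · rw [hc] at h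
    rw [min_eq_right (by omega)] at h3
    simp only [PowInv, run, State.setReg_reg]
    rw [min_eq_right (by omega), if_neg d40, if_neg b40]
    exact ⟨by simpa using h1, h2, h3⟩

theorem powInv_zero {s : State} {dst base : ℕ} (h2 : dst ≠ 2) (hb : base ≠ dst) :
    PowInv dst base (s.reg base) (s.reg 2) 0 (s.setReg dst 1) :=
  ⟨by simp [State.setReg_reg, Ne.symm h2], by simp [State.setReg_reg, hb], by
      simp [State.setReg_reg]⟩

theorem pow_spec {s : State} {dst base : ℕ} (h1 : dst ∉ [0, 2, 13, 40, 41, 42])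
    (h2 : base ∉ [dst, 13, 40, 41, 42]) (hle : s.reg 2 ≤ s.reg 0) :
    ((pow dst base).run s).reg dst = s.reg base ^ s.reg 2 := by
  have h1' := h1
  have h2' := h2
  simp only [List.mem_cons, List.not_mem_nil, or_false, not_or] at h1' h2'
  have key := loop_induction (x := 40) (y := 0) (s := s.setReg dst 1) (c := powBody dst base)
    (P := PowInv dst base (s.reg base) (s.reg 2)) (powInv_zero h1'.2.1 h2'.1)
    (fun i _ s' h => h.step h1 h2)
    (fun i s' v h => by
      simpa [PowInv, State.setReg_reg, h2'.2.2.1, h1'.2.2.2.1] using h)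
  have e0 : (s.setReg dst 1).reg 0 = s.reg 0 := by simp [State.setReg_reg, Ne.symm h1'.1]
  have := key.2.2
  rw [e0, min_eq_right hle] at this
  exact this

end Cmd

end SafeSet

/-! ### The algorithm

Registers: `0` number of vertices, `1` bound, `2` size `K` of the set, `3` number of digit strings,
`4` the number `2 ^ K`, `5` success flag, `6` number of vertices in the first phase, `7` current
vertex, `8` new vertex, `9` number of the next piece, `10` flag, `11` picked vertex, `12` start
vertex, `13` accumulator, `14` the number `K + 1`, `15` the number `2`.

Arrays: `0` adjacency, `1` output, `2` to `4` the digit strings for branches, pointers and times,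
`5` temporary, `6` labels, `7` class sizes, `8` the set of the first phase, `9` its list of
vertices, `10` sizes to be reached, `11` connectivity, `13` the set that grows, `14` connectivity
for the set of the first phase, `15` the components that were used, `16` the current piece, `17` the
union of array `8` and the current piece. -/

namespace SafeSet

namespace Cmd

open Exp

/-- Labels of the slots, by following the pointers, and sizes of their classes. -/
def labels : Cmd :=
  (tab 6 20 21 (reg 20)).seq
  ((loop 40 0 ((tab 5 20 21 (at0 3 (at0 6 (reg 20)))).seq (tab 6 20 21 (at0 5 (reg 20))))).seq
  (tab 7 20 21 (cnt 22 (and (lt (reg 22) (reg 2)) (eq (at0 6 (reg 22)) (at0 6 (reg 20)))))))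

/-- Start the first phase with the vertex in register `12`. -/
def start : Cmd :=
  (tab 8 20 21 (eq (reg 20) (reg 12))).seq
  ((tab 10 20 21 (.ite (eq (reg 20) (reg 12)) (at0 7 (num 0)) (num 0))).seq
  ((put 9 (num 0) (num 0) (reg 12)).seq
  (set 6 (num 1))))

/-- The vertex in register `21` is in too large a component outside the set. -/
def badExp : Exp :=
  and (not (at0 8 (reg 21))) (cnt 22 (and (at0 8 (reg 22)) (and (get 0 (reg 22) (reg 21))
    (lt (at0 10 (reg 22)) (cnt 23 (get 14 (reg 21) (reg 23)))))))

/-- The vertex in register `21` can be added to the set that grows. -/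
def growExp : Exp :=
  and (not (at0 13 (reg 21))) (and (not (at0 8 (reg 21)))
    (cnt 22 (and (at0 13 (reg 22)) (get 0 (reg 22) (reg 21)))))

/-- Grow a set from the vertex in register `7`; the vertex that is added last goes to register
`11`. -/
def growCmd : Cmd :=
  (tab 13 20 21 (eq (reg 20) (reg 7))).seq
  ((set 11 (reg 7)).seq
  (loop 36 0 (.ite (lt (reg 36) (at0 2 (reg 6)))
    ((set 8 (fst 20 21 growExp)).seq
    (.ite (lt (reg 8) (reg 0)) ((put 13 (reg 8) (num 0) (num 1)).seq (set 11 (reg 8))) skip))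
    skip)))

/-- Add the vertex in register `11` to the set of the first phase. -/
def addPick : Cmd :=
  (put 8 (reg 11) (num 0) (num 1)).seq
  ((put 9 (reg 6) (num 0) (reg 11)).seq
  ((put 10 (reg 11) (num 0) (at0 7 (reg 6))).seq
  (set 6 (succ (reg 6)))))

/-- A round of the first phase. -/
def round : Cmd :=
  (closure 8 14 5).seq
  ((set 7 (fst 20 21 badExp)).seq
  (.ite (lt (reg 7) (reg 0)) (growCmd.seq addPick) skip))

/-- The current piece fits. -/
def fitsExp : Exp :=
  and (all 20 (imp (lt (reg 20) (reg 6)) (imp (eq (at0 4 (reg 20)) (reg 9))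
    (get 11 (at0 9 (reg 20)) (at0 9 (at0 3 (reg 20)))))))
  (and (all 20 (imp (lt (reg 20) (reg 6))
    (le (cnt 21 (and (le (reg 6) (reg 21)) (and (lt (reg 21) (reg 2))
        (and (eq (at0 4 (reg 21)) (reg 9)) (eq (at0 6 (reg 21)) (at0 6 (reg 20)))))))
      (cnt 21 (and (at0 16 (reg 21)) (cnt 22 (and (lt (reg 22) (reg 6))
        (and (eq (at0 6 (reg 22)) (at0 6 (reg 20)))
          (get 11 (reg 21) (at0 9 (reg 22)))))))))))
  (and (le (cnt 20 (at0 16 (reg 20)))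
    (cnt 21 (and (le (reg 6) (reg 21)) (and (lt (reg 21) (reg 2)) (eq (at0 4 (reg 21)) (reg 9))))))
  (all 20 (imp (at0 17 (reg 20)) (all 21 (imp (not (at0 17 (reg 21)))
    (imp (get 0 (reg 20) (reg 21))
      (or (le (cnt 22 (get 11 (reg 21) (reg 22))) (cnt 22 (get 11 (reg 20) (reg 22))))
        (cnt 23 (and (get 11 (reg 20) (reg 23))
          (le (cnt 22 (get 11 (reg 21) (reg 22))) (at0 10 (reg 23)))))))))))))

/-- Add the current piece to the output. -/
def place : Cmd :=
  (set 10 (num 1)).seq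
  ((tab 5 20 21 (or (at0 1 (reg 20)) (at0 16 (reg 20)))).seq
  ((tab 1 20 21 (at0 5 (reg 20))).seq
  ((tab 5 20 21 (or (at0 15 (reg 20)) (get 14 (reg 7) (reg 20)))).seq
  ((tab 15 20 21 (at0 5 (reg 20))).seq
  (set 9 (succ (reg 9)))))))

/-- Try the current piece. -/
def tryPiece : Cmd :=
  (tab 17 20 21 (or (at0 8 (reg 20)) (at0 16 (reg 20)))).seq
  ((closure 17 11 5).seq (.ite fitsExp place skip))

/-- The bases for running through the subsets of the current component. -/
def bitBase (i : Exp) : Exp := .ite (get 14 (reg 7) i) (num 2) (num 1)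

/-- Try to place the next piece in the component of the vertex in register `7`. -/
def scan : Cmd :=
  .ite (or (at0 8 (reg 7)) (at0 15 (reg 7))) skip
    ((set 10 (num 0)).seq
    ((clear 16).seq
    (loop 38 4 ((Cmd.ite (reg 10) skip tryPiece).seq (incr 16 5 bitBase)))))

/-- The second phase. -/
def pieces : Cmd :=
  (closure 8 14 5).seq
  ((tab 1 20 21 (at0 8 (reg 20))).seq
  ((clear 15).seq
  ((set 9 (num 1)).seq
  (loop 7 0 scan))))

/-- The output is a safe set of size at most `K`. -/
def finalExp : Exp :=
  and (cnt 20 (at0 1 (reg 20))) (and (le (cnt 20 (at0 1 (reg 20))) (reg 2))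
    (all 20 (imp (at0 1 (reg 20)) (all 21 (imp (not (at0 1 (reg 21)))
      (imp (get 0 (reg 20) (reg 21))
        (le (cnt 22 (get 11 (reg 21) (reg 22))) (cnt 22 (get 11 (reg 20) (reg 22))))))))))

/-- The attempt for given strings of digits and a given start vertex. -/
def attempt : Cmd :=
  labels.seq (start.seq ((loop 35 0 round).seq (pieces.seq
    ((closure 1 11 5).seq (set 5 finalExp)))))

/-- The bases for running through the strings of digits. -/
def digitBase (i : Exp) : Exp := .ite (lt i (reg 2)) (succ (reg 2)) (num 1)

/-- The attempts for all start vertices, until success. -/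
def attempts : Cmd := loop 12 0 (.ite (reg 5) skip attempt)

/-- The search for a safe set of size `K`. -/
def search : Cmd :=
  (set 14 (succ (reg 2))).seq
  ((pow 3 14).seq
  ((set 15 (num 2)).seq
  ((pow 4 15).seq
  ((clear 2).seq
  (loop 31 3 (((clear 3).seq
    (loop 32 3 (((clear 4).seq
      (loop 33 3 (attempts.seq (incr 4 5 digitBase)))).seq
      (incr 3 5 digitBase)))).seq
    (incr 2 5 digitBase)))))))

/-- The search for a safe set of size at most the number in register `1`. -/
def main : Cmd :=
  loop 30 0 (.ite (or (reg 5) (le (reg 1) (reg 30))) skip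
    ((set 2 (succ (reg 30))).seq search))

theorem main_ok : main.ok 50 := by rfl

end Cmd

end SafeSet

/-! ### Correctness of the first phase -/

namespace SafeSet

open Cmd Exp

/-- The state holds the graph and the strings that describe the safe set `T`. -/
structure Static (n : ℕ) (A : ℕ → ℕ → Prop) (T : Finset ℕ) (u br ptr tm : ℕ → ℕ) (s : State) :
    Prop where
  ctx : Ctx n A s
  size : s.reg 2 = T.card
  pow : s.reg 4 = 2 ^ T.card
  root : s.reg 12 = u 0
  br_eq : ∀ i < T.card, s.arr 2 i 0 = br i
  ptr_eq : ∀ i < T.card, s.arr 3 i 0 = ptr i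
  tm_eq : ∀ i < T.card, s.arr 4 i 0 = tm i

/-- The state holds labels and class sizes, too. -/
structure Labeled (n : ℕ) (A : ℕ → ℕ → Prop) (T : Finset ℕ) (u br ptr tm : ℕ → ℕ) (s : State) :
    Prop extends Static n A T u br ptr tm s where
  lab : ∀ i < T.card, s.arr 6 i 0 = ptr^[n] i
  sz : ∀ i < T.card, s.arr 7 i 0 = csize n A T (u i)

/-- The first phase has found the first `m` vertices. -/
structure Found (n : ℕ) (A : ℕ → ℕ → Prop) (T : Finset ℕ) (u : ℕ → ℕ) (m : ℕ) (s : State) :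
    Prop where
  count : s.reg 6 = m
  set : IsSet n 8 (front u m) s
  list : ∀ i < m, s.arr 9 i 0 = u i
  cap : ∀ w < n, s.arr 10 w 0 = cap n A T (front u m) w

section

variable {n : ℕ} {A : ℕ → ℕ → Prop} {T : Finset ℕ} {u br ptr tm : ℕ → ℕ} {s : State} {m : ℕ}

theorem Static.run (h : Static n A T u br ptr tm s) {c : Cmd}
    (h1 : ∀ x ∈ [0, 2, 4, 12], x ∉ c.wr) (h2 : ∀ a ∈ [0, 2, 3, 4], a ∉ c.wa) :
    Static n A T u br ptr tm (c.run s) := by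
  simp only [List.forall_mem_cons, List.not_mem_nil, false_imp_iff, implies_true, and_true] at h1 h2
  obtain ⟨a0, a2, a4, a12⟩ := h1
  obtain ⟨b0, b2, b3, b4⟩ := h2
  exact ⟨h.ctx.run a0 b0, (run_reg a2 s).trans h.size, (run_reg a4 s).trans h.pow,
    (run_reg a12 s).trans h.root, by rw [run_arr b2]; exact h.br_eq, by
        rw [run_arr b3]; exact h.ptr_eq,
    by rw [run_arr b4]; exact h.tm_eq⟩

theorem Static.setReg (h : Static n A T u br ptr tm s) {x v : ℕ} (h1 : x ∉ [0, 2, 4, 12]) :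
    Static n A T u br ptr tm (s.setReg x v) := by
  simp only [List.mem_cons, List.not_mem_nil, or_false, not_or] at h1
  obtain ⟨a0, a2, a4, a12⟩ := h1
  refine ⟨h.ctx.setReg a0, ?_, ?_, ?_, h.br_eq, h.ptr_eq, h.tm_eq⟩
  · rw [State.setReg_reg, if_neg (Ne.symm a2), h.size]
  · rw [State.setReg_reg, if_neg (Ne.symm a4), h.pow]
  · rw [State.setReg_reg, if_neg (Ne.symm a12), h.root]

theorem Labeled.run (h : Labeled n A T u br ptr tm s) {c : Cmd}
    (h1 : ∀ x ∈ [0, 2, 4, 12], x ∉ c.wr) (h2 : ∀ a ∈ [0, 2, 3, 4, 6, 7], a ∉ c.wa) :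
    Labeled n A T u br ptr tm (c.run s) := by
  refine ⟨h.toStatic.run h1 fun a ha => h2 a (by simp at *; omega), ?_, ?_⟩
  · rw [run_arr (h2 6 (by simp))]; exact h.lab
  · rw [run_arr (h2 7 (by simp))]; exact h.sz

theorem Labeled.setReg (h : Labeled n A T u br ptr tm s) {x v : ℕ} (h1 : x ∉ [0, 2, 4, 12]) :
    Labeled n A T u br ptr tm (s.setReg x v) :=
  ⟨h.toStatic.setReg h1, h.lab, h.sz⟩

theorem Found.run (h : Found n A T u m s) {c : Cmd} (h1 : 6 ∉ c.wr)
    (h2 : ∀ a ∈ [8, 9, 10], a ∉ c.wa) : Found n A T u m (c.run s) := by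
  simp only [List.forall_mem_cons, List.not_mem_nil, false_imp_iff, implies_true, and_true] at h2
  refine ⟨(run_reg h1 s).trans h.count, ?_, ?_, ?_⟩
  · unfold IsSet; rw [run_arr h2.1]; exact h.set
  · rw [run_arr h2.2.1]; exact h.list
  · rw [run_arr h2.2.2]; exact h.cap

theorem Found.setReg (h : Found n A T u m s) {x v : ℕ} (h1 : x ≠ 6) :
    Found n A T u m (s.setReg x v) :=
  ⟨by rw [State.setReg_reg, if_neg h1.symm, h.count], h.set, h.list, h.cap⟩

/-- Counting via the enumeration of `T`. -/
theorem IsRun.card_filter (hu : IsRun n A T u br m) (hTn : ∀ x ∈ T, x < n) {i : ℕ}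
    (hi : i < T.card) {p : ℕ → Prop} [DecidablePred p]
    (hp : ∀ b < T.card, p b ↔ Conn A T (u b) (u i)) (hp' : ∀ b, p b → b < T.card)
    (hA : IsGraph n A) (hKn : T.card ≤ n) :
    ((Finset.range n).filter p).card = csize n A T (u i) := by
  classical
  refine Finset.card_bij (fun b _ => u b) (fun b hb => ?_) (fun b hb c hc hbc => ?_) fun x hx => ?_
  · obtain ⟨-, hb⟩ := Finset.mem_filter.1 hb
    have hb' := hp' b hb
    simp only [Finset.mem_filter, Finset.mem_range]
    exact ⟨hTn _ (hu.mem b hb'), ((hp b hb').1 hb).symm hA⟩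
  · exact hu.inj b (hp' b (Finset.mem_filter.1 hb).2) c (hp' c (Finset.mem_filter.1 hc).2) hbc
  · simp only [Finset.mem_filter, Finset.mem_range] at hx
    obtain ⟨b, hb, rfl⟩ := hu.surj x (hx.2.mem_iff.1 (hu.mem i hi))
    exact ⟨b, by simp only [Finset.mem_filter, Finset.mem_range]; exact
      ⟨by omega, (hp b hb).2 (hx.2.symm hA)⟩, rfl⟩

theorem tab_spec {a : ℕ} {e : Exp} (he : e.ok 50) (ha : a ∉ e.arrs) {i j : ℕ} (hi : i < s.reg 0)
    (hj : j < s.reg 0) :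
    ((tab a 20 21 e).run s).arr a i j = e.eval ((s.setReg 20 i).setReg 21 j) :=
  run_tab (by decide) (by decide) he ha s hi hj

/-- After `t` rounds the labels are the `t`-fold iterates of the pointers. Equal labels mean equal
components of `T`, so the class sizes are the final component sizes, known before any vertex other
than the start vertex is chosen. -/
theorem labels_spec (hA : IsGraph n A) (hTn : ∀ x ∈ T, x < n) (hKn : T.card ≤ n)
    (hu : IsRun n A T u br m) (hptr : ∀ i, ptr i < T.card)
    (hlab : ∀ a < T.card, ∀ b < T.card, ptr^[n] a = ptr^[n] b ↔ Conn A T (u a) (u b))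
    (h : Static n A T u br ptr tm s) : Labeled n A T u br ptr tm (labels.run s) := by
  classical
  set s1 := (tab 6 20 21 (reg 20)).run s with hs1
  have h1 : Static n A T u br ptr tm s1 := h.run (by decide) (by decide)
  have hn : s.reg 0 = n := h.ctx.reg
  have hinit : ∀ i < n, s1.arr 6 i 0 = i := fun i hi => by
    rw [hs1, tab_spec (by rfl) (by decide) (by omega) (by omega)]
    simp [Exp.eval, State.setReg_reg]
  have hit : ∀ t, ∀ i < T.card, ptr^[t] i < T.card := fun t i hi => by
    cases t with
    | zero => exact hi
    | succ t => rw [Function.iterate_succ_apply']; exact hptr _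
  set s2 := (loop 40 0 ((tab 5 20 21 (at0 3 (at0 6 (reg 20)))).seq
    (tab 6 20 21 (at0 5 (reg 20))))).run s1 with hs2
  have h2 : Static n A T u br ptr tm s2 ∧ ∀ i < T.card, s2.arr 6 i 0 = ptr^[n] i := by
    have := loop_induction (x := 40) (y := 0) (s := s1)
      (c := (tab 5 20 21 (at0 3 (at0 6 (reg 20)))).seq (tab 6 20 21 (at0 5 (reg 20))))
      (P := fun t s' => Static n A T u br ptr tm s' ∧ ∀ i < T.card, s'.arr 6 i 0 = ptr^[t] i)
      ⟨h1, fun i hi => hinit i (by omega)⟩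
      (by
        rintro t - s' ⟨g1, g2⟩
        have g3 : Static n A T u br ptr tm (s'.setReg 40 t) := g1.setReg (by decide)
        refine ⟨g3.run (by decide) (by decide), fun i hi => ?_⟩
        have hn' := g3.ctx.reg
        rw [Cmd.run, tab_spec (by rfl) (by decide)
          (by rw [run_reg (by decide)]; omega) (by rw [run_reg (by decide)]; omega)]
        simp only [eval_at0, Exp.eval, State.setReg_reg, State.setReg_arr]
        simp only [if_true, show (20 : ℕ) ≠ 21 by decide, if_false]
        rw [tab_spec (by rfl) (by decide) (by omega) (by omega)]
        simp only [eval_at0, Exp.eval, State.setReg_reg, State.setReg_arr]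
        simp only [if_true, show (20 : ℕ) ≠ 21 by decide, if_false]
        rw [g2 i hi, g1.ptr_eq _ (hit t i hi), Function.iterate_succ_apply'])
      (fun t s' v hP => ⟨hP.1.setReg (by decide), hP.2⟩)
    rw [h1.ctx.reg] at this
    exact this
  have hn2 : s2.reg 0 = n := h2.1.ctx.reg
  have h3 : labels.run s = (tab 7 20 21 (cnt 22 (and (lt (reg 22) (reg 2))
      (eq (at0 6 (reg 22)) (at0 6 (reg 20)))))).run s2 := rfl
  rw [h3]
  refine ⟨h2.1.run (by decide) (by decide), by rw [run_arr (by decide)]; exact h2.2, fun i hi => ?_⟩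
  rw [tab_spec (by rfl) (by decide) (by omega) (by omega), eval_cnt]
  have e0 : ((s2.setReg 20 i).setReg 21 0).reg 0 = n := hn2
  rw [e0]
  have hp : ∀ b, (and (lt (reg 22) (reg 2)) (eq (at0 6 (reg 22)) (at0 6 (reg 20)))).Holds
      (((s2.setReg 20 i).setReg 21 0).setReg 22 b) ↔ b < T.card ∧ ptr^[n] b = ptr^[n] i := by
    intro b
    simp only [holds_and, holds_lt, holds_eq, eval_at0, Exp.eval, State.setReg_reg,
      State.setReg_arr]
    simp only [if_true, show (22 : ℕ) ≠ 21 by decide, show (20 : ℕ) ≠ 21 by decide,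
      show (2 : ℕ) ≠ 22 by decide, show (2 : ℕ) ≠ 21 by decide, show (2 : ℕ) ≠ 20 by decide,
      show (20 : ℕ) ≠ 22 by decide, if_false, h2.1.size, h2.2 i hi]
    exact and_congr_right fun hb => by rw [h2.2 b hb]
  refine hu.card_filter hTn hi (fun b hb => ?_) (fun b hb => ((hp b).1 hb).1) hA hKn
  rw [hp, and_iff_right hb, hlab b hb i hi]

/-- The start vertex occupies slot `0`, so the class size of that slot is its cap. -/
theorem start_spec (hu : IsRun n A T u br m)
    (h : Labeled n A T u br ptr tm s) :
    Labeled n A T u br ptr tm (start.run s) ∧ Found n A T u 1 (start.run s) := by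
  have hK : 0 < T.card := hu.pos.trans_le hu.le
  have hfront : ∀ x, x ∈ front u 1 ↔ x = u 0 := fun x =>
    ⟨fun ⟨i, hi, h⟩ => by rw [← h, show i = 0 by omega], fun h => ⟨0, by omega, h.symm⟩⟩
  refine ⟨h.run (by decide) (by decide), ?_, ?_, ?_, ?_⟩
  · rfl
  · intro i hi
    have hn := h.ctx.reg
    have : (start.run s).arr 8 = ((tab 8 20 21 (eq (reg 20) (reg 12))).run s).arr 8 := by
      rw [start, Cmd.run, run_arr (by decide)]
    rw [this, tab_spec (by rfl) (by decide) (by omega) (by omega), hfront]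
    change Exp.Holds _ _ ↔ _
    simp [holds_eq, Exp.eval, State.setReg_reg, h.root]
  · intro i hi
    obtain rfl : i = 0 := by omega
    simp only [start, Cmd.run, State.setReg_arr, State.setArr_arr, Exp.eval]
    simp only [and_self, if_true]
    rw [run_reg (by decide), run_reg (by decide), h.root]
  · intro i hi
    set s1 := (tab 8 20 21 (eq (reg 20) (reg 12))).run s with hs1
    have h1 : Labeled n A T u br ptr tm s1 := h.run (by decide) (by decide)
    have hn := h1.ctx.reg
    have : (start.run s).arr 10 = ((tab 10 20 21 (.ite (eq (reg 20) (reg 12)) (at0 7 (num 0))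
        (num 0))).run s1).arr 10 := by
      rw [start, Cmd.run, ← hs1, Cmd.run, run_arr (by decide)]
    rw [this, tab_spec (by rfl) (by decide) (by omega) (by omega), cap, Exp.eval]
    have hc : (eq (reg 20) (reg 12)).eval ((s1.setReg 20 i).setReg 21 0) ≠ 0 ↔ i ∈ front u 1 := by
      rw [hfront]
      change Exp.Holds _ _ ↔ _
      simp [holds_eq, Exp.eval, State.setReg_reg, h1.root]
    by_cases hif : i ∈ front u 1
    · rw [if_pos (hc.2 hif), if_pos hif, eval_at0]
      change s1.arr 7 0 0 = _
      rw [h1.sz 0 hK, (hfront i).1 hif]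
    · rw [if_neg fun h => hif (hc.1 h), if_neg hif]
      rfl

theorem eval_bad (hA : IsGraph n A) (hs : Ctx n A s) (hF : Found n A T u m s)
    (hC : IsConn n A 14 (front u m) s) :
    (fst 20 21 badExp).eval s = least n (Bad n A T (front u m)) := by
  classical
  rw [← hs.reg]
  refine eval_fst (by decide) (by decide) fun i v hv => ?_
  rw [hs.reg] at hv
  simp only [badExp, holds_and, holds_not, holds_at0, holds_cnt, holds_get, holds_lt, Exp.eval,
    eval_at0, State.setReg_reg, State.setReg_arr]
  simp only [if_true, show (22 : ℕ) ≠ 21 by decide, show (21 : ℕ) ≠ 22 by decide,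
    show (0 : ℕ) ≠ 21 by decide, show (0 : ℕ) ≠ 20 by decide, if_false, hs.reg,
    show (21 : ℕ) ≠ 23 by decide, show (0 : ℕ) ≠ 22 by decide]
  rw [hF.set v hv, Bad, hC.card_eq hv fun j _ => Iff.rfl]
  refine and_congr_right fun _ => ⟨?_, ?_⟩
  · rintro ⟨a, ha, h1, h2, h3⟩
    have h1 := (hF.set a ha).1 h1
    refine ⟨a, h1, (hs.arr a ha v hv).1 h2, ?_⟩
    rwa [hF.cap a ha, cap, if_pos h1] at h3
  · rintro ⟨a, h1, h2, h3⟩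
    have ha := hA.lt h2
    exact ⟨a, ha, (hF.set a ha).2 h1, (hs.arr a ha v hv).2 h2, by rwa [hF.cap a ha, cap, if_pos h1]⟩

theorem eval_grow (hA : IsGraph n A) (hs : Ctx n A s) {S W : Set ℕ} (hS : IsSet n 8 S s)
    (hW : IsSet n 13 W s) :
    (fst 20 21 growExp).eval s = least n fun b => b ∉ W ∧ b ∉ S ∧ ∃ a ∈ W, A a b := by
  classical
  rw [← hs.reg]
  refine eval_fst (by decide) (by decide) fun i v hv => ?_
  rw [hs.reg] at hv
  simp only [growExp, holds_and, holds_not, holds_at0, holds_cnt, holds_get, Exp.eval,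
    State.setReg_reg, State.setReg_arr]
  simp only [if_true, show (21 : ℕ) ≠ 22 by decide,
    show (0 : ℕ) ≠ 21 by decide, show (0 : ℕ) ≠ 20 by decide, if_false, hs.reg]
  rw [hS v hv, hW v hv]
  refine and_congr_right fun _ => and_congr_right fun _ => ⟨?_, ?_⟩
  · rintro ⟨a, ha, h1, h2⟩
    exact ⟨a, (hW a ha).1 h1, (hs.arr a ha v hv).1 h2⟩
  · rintro ⟨a, h1, h2⟩
    have ha := hA.lt h2
    exact ⟨a, ha, (hW a ha).2 h1, (hs.arr a ha v hv).2 h2⟩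

/-- The loop runs `n` times but acts in the first `br m` iterations only, so the invariant refers to
`min t (br m)`; the bounds `br m ≤ T.card ≤ n` ensure that all of these take place. -/
theorem growCmd_spec (hA : IsGraph n A) (hKn : T.card ≤ n) (hm : m < T.card) (hbr : br m ≤ T.card)
    (h : Labeled n A T u br ptr tm s) (hF : Found n A T u m s) :
    Labeled n A T u br ptr tm (growCmd.run s) ∧ Found n A T u m (growCmd.run s) ∧
      (growCmd.run s).reg 11 = (grow n A (front u m) (s.reg 7) (br m)).2 := by
  classical
  refine ⟨h.run (by decide) (by decide), hF.run (by decide) (by decide), ?_⟩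
  set s1 := (set 11 (reg 7)).run ((tab 13 20 21 (eq (reg 20) (reg 7))).run s) with hs1
  set c : Cmd := .ite (lt (reg 36) (at0 2 (reg 6)))
    ((set 8 (fst 20 21 growExp)).seq
    (.ite (lt (reg 8) (reg 0)) ((put 13 (reg 8) (num 0) (num 1)).seq (set 11 (reg 8))) skip))
    skip with hc
  set G := grow n A (front u m) (s.reg 7) with hG
  let P : ℕ → State → Prop := fun t s' => Labeled n A T u br ptr tm s' ∧ Found n A T u m s' ∧
    IsSet n 13 (G (min t (br m))).1 s' ∧ s'.reg 11 = (G (min t (br m))).2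
  have hn := h.ctx.reg
  have key : P (s1.reg 0) ((loop 36 0 c).run s1) := by
    refine loop_induction (P := P) ⟨(h.run (c := (tab 13 20 21 (eq (reg 20) (reg 7)))) (by decide)
      (by decide)).setReg (by
          decide), (hF.run (c := (tab 13 20 21 (eq (reg 20) (reg 7)))) (by decide)
      (by decide)).setReg (by decide), ?_, ?_⟩ ?_ ?_
    · intro i hi
      rw [hs1, Cmd.run, State.setReg_arr, tab_spec (by rfl) (by decide) (by omega) (by omega)]
      change Exp.Holds _ _ ↔ _
      simp [holds_eq, Exp.eval, State.setReg_reg, hG, grow]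
    · rw [hs1, Cmd.run, State.setReg_reg, if_pos rfl, Nat.zero_min, Exp.eval, run_reg (by decide)]
      rfl
    · rintro t - s' ⟨g1, g2, g3, g4⟩
      have g1' : Labeled n A T u br ptr tm (s'.setReg 36 t) := g1.setReg (by decide)
      have g2' : Found n A T u m (s'.setReg 36 t) := g2.setReg (by decide)
      have hcond : (lt (reg 36) (at0 2 (reg 6))).Holds (s'.setReg 36 t) ↔ t < br m := by
        simp only [holds_lt, Exp.eval, eval_at0, State.setReg_reg, State.setReg_arr]
        simp only [if_true, show (6 : ℕ) ≠ 36 by decide, if_false]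
        rw [g2.count, g1.br_eq m hm]
      refine ⟨g1'.run (by decide) (by decide), g2'.run (by decide) (by decide), ?_⟩
      rw [hc, run_ite]
      split_ifs with hlt
      · rw [hcond] at hlt
        rw [min_eq_left (by omega)] at g3 g4
        rw [min_eq_left (by omega)]
        have hev : (fst 20 21 growExp).eval (s'.setReg 36 t) =
            least n fun b => b ∉ (G t).1 ∧ b ∉ front u m ∧ ∃ a ∈ (G t).1, A a b :=
          eval_grow hA g1'.ctx g2'.set g3
        have hstep : G (t + 1) = if least n (fun b => b ∉ (G t).1 ∧ b ∉ front u m ∧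
            ∃ a ∈ (G t).1, A a b) < n then (insert (least n fun b => b ∉ (G t).1 ∧ b ∉ front u m ∧
            ∃ a ∈ (G t).1, A a b) (G t).1, least n fun b => b ∉ (G t).1 ∧ b ∉ front u m ∧
            ∃ a ∈ (G t).1, A a b) else G t := by
          simp only [hG, grow]
        rw [hstep, Cmd.run, Cmd.run, hev]
        set w := least n fun b => b ∉ (G t).1 ∧ b ∉ front u m ∧ ∃ a ∈ (G t).1, A a b with hw
        rw [run_ite]
        have hcond' : (lt (reg 8) (reg 0)).Holds ((s'.setReg 36 t).setReg 8 w) ↔ w < n := by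
          simp only [holds_lt, Exp.eval, State.setReg_reg]
          simp only [if_true, show (0 : ℕ) ≠ 8 by decide, show (0 : ℕ) ≠ 36 by decide, if_false]
          rw [g1.ctx.reg]
        by_cases hwn : w < n
        · rw [if_pos (hcond'.2 hwn), if_pos hwn]
          refine ⟨fun i hi => ?_, ?_⟩
          · simp only [Cmd.run, State.setReg_arr, State.setArr_arr, Exp.eval, State.setReg_reg,
              if_true, true_and, and_true, Set.mem_insert_iff]
            split_ifs with hiw
            · simp [hiw]
            · rw [or_iff_right hiw]; exact g3 i hi
          · simp [Cmd.run, Exp.eval, State.setReg_reg]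
        · rw [if_neg fun h => hwn (hcond'.1 h), if_neg hwn]
          exact ⟨g3, g4⟩
      · rw [hcond] at hlt
        rw [min_eq_right (by omega)] at g3 g4
        rw [min_eq_right (by omega)]
        exact ⟨g3, g4⟩
    · rintro t s' v ⟨g1, g2, g3, g4⟩
      exact ⟨g1.setReg (by decide), g2.setReg (by decide), g3, g4⟩
  have e1 : s1.reg 0 = n := by
    rw [hs1, run_reg (by decide), run_reg (by decide), hn]
  have key' := key.2.2.2
  rw [e1, show min n (br m) = br m by omega] at key'
  exact key'

theorem addPick_spec {i : ℕ} (hi : i < T.card)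
    (h : Labeled n A T u br ptr tm s) (hF : Found n A T u i s) (hp : s.reg 11 = u i) :
    Found n A T u (i + 1) (addPick.run s) := by
  have hfront : ∀ x, x ∈ front u (i + 1) ↔ x = u i ∨ x ∈ front u i := by
    intro x
    constructor
    · rintro ⟨j, hj, rfl⟩
      rcases Nat.lt_succ_iff_lt_or_eq.1 hj with hj | rfl
      exacts [.inr ⟨j, hj, rfl⟩, .inl rfl]
    · rintro (rfl | ⟨j, hj, rfl⟩)
      exacts [⟨i, by omega, rfl⟩, ⟨j, by omega, rfl⟩]
  refine ⟨?_, fun x hx => ?_, fun j hj => ?_, fun w hw => ?_⟩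
  · simp [addPick, Cmd.run, Exp.eval, State.setReg_reg, hF.count]
  · have : (addPick.run s).arr 8 x 0 = if x = u i then 1 else s.arr 8 x 0 := by
      simp [addPick, Cmd.run, Exp.eval, State.setArr_arr, hp]
    rw [this, hfront]
    split_ifs with hxi
    · simp [hxi]
    · rw [or_iff_right hxi]; exact hF.set x hx
  · have : (addPick.run s).arr 9 j 0 = if j = i then u i else s.arr 9 j 0 := by
      simp [addPick, Cmd.run, Exp.eval, State.setArr_arr, hp, hF.count]
    rw [this]
    split_ifs with hji
    · rw [hji]
    · exact hF.list j (by omega)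
  · have : (addPick.run s).arr 10 w 0 = if w = u i then csize n A T (u i) else s.arr 10 w 0 := by
      simp [addPick, Cmd.run, Exp.eval, eval_at0, State.setArr_arr, hp, hF.count, h.sz i hi]
    rw [this]
    split_ifs with hwi
    · rw [cap, if_pos ((hfront w).2 (.inl hwi)), hwi]
    · rw [hF.cap w hw, cap, cap]
      rw [show w ∈ front u (i + 1) ↔ w ∈ front u i from (hfront w).trans (or_iff_right hwi)]

/-- If `i < m`, the round reproduces the step of the run and finds `u i`. If `i = m`, the search for
a bad vertex returns `n` and the round changes nothing, so surplus rounds are harmless. -/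
theorem round_spec (hA : IsGraph n A) (hKn : T.card ≤ n)
    (hu : IsRun n A T u br m) {i : ℕ} (hi0 : 0 < i) (him : i ≤ m)
    (h : Labeled n A T u br ptr tm s) (hF : Found n A T u i s) :
    Labeled n A T u br ptr tm (round.run s) ∧ Found n A T u (min (i + 1) m) (round.run s) := by
  classical
  refine ⟨h.run (by decide) (by decide), ?_⟩
  set s1 := (closure 8 14 5).run s with hs1
  have h1 : Labeled n A T u br ptr tm s1 := h.run (by decide) (by decide)
  have hF1 : Found n A T u i s1 := hF.run (by decide) (by decide)
  have hC : IsConn n A 14 (front u i) s1 :=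
    closure_spec h.ctx hF.set hA (by decide) (by decide) (by decide)
  have hev := eval_bad hA h1.ctx hF1 hC
  set v := least n (Bad n A T (front u i)) with hv
  have h2 : Labeled n A T u br ptr tm (s1.setReg 7 v) := h1.setReg (by decide)
  have hF2 : Found n A T u i (s1.setReg 7 v) := hF1.setReg (by decide)
  have hrun : round.run s = (Cmd.ite (lt (reg 7) (reg 0)) (growCmd.seq addPick) skip).run
      (s1.setReg 7 v) := by
    rw [Cmd.round, Cmd.run, Cmd.run, ← hs1]
    congr 1
    rw [Cmd.run, hev]
  have hcond : (lt (reg 7) (reg 0)).Holds (s1.setReg 7 v) ↔ v < n := by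
    simp only [holds_lt, Exp.eval, State.setReg_reg]
    simp only [if_true, show (0 : ℕ) ≠ 7 by decide, if_false]
    rw [h1.ctx.reg]
  rw [hrun, run_ite]
  rcases him.lt_or_eq with him | rfl
  · have hiT : i < T.card := him.trans_le hu.le
    obtain ⟨hbad, hui⟩ := hu.step i him hi0
    have hvn : v < n := (least_spec hbad).1
    rw [if_pos (hcond.2 hvn), min_eq_left (by omega)]
    obtain ⟨g1, g2, g3⟩ := growCmd_spec hA hKn hiT (hu.br_le i) h2 hF2
    refine addPick_spec hiT g1 g2 ?_
    rw [g3, hui]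
    simp [State.setReg_reg, hv]
  · have hvn : v = n := least_of_forall_not fun x _ => hu.not_bad x
    rw [if_neg fun h => by have := hcond.1 h; omega, min_eq_right (by omega)]
    exact hF2

theorem rounds_spec (hA : IsGraph n A) (hKn : T.card ≤ n)
    (hu : IsRun n A T u br m) (h : Labeled n A T u br ptr tm s) (hF : Found n A T u 1 s) :
    Labeled n A T u br ptr tm ((loop 35 0 round).run s) ∧
      Found n A T u m ((loop 35 0 round).run s) := by
  have hm := hu.pos
  have key := loop_induction (x := 35) (y := 0) (s := s) (c := round)
    (P := fun t s' => Labeled n A T u br ptr tm s' ∧ Found n A T u (min (t + 1) m) s')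
    ⟨h, by rwa [zero_add, min_eq_left (by omega)]⟩
    (by
      rintro t - s' ⟨g1, g2⟩
      have := round_spec hA hKn hu (i := min (t + 1) m) (by omega) (min_le_right _ _)
        (g1.setReg (x := 35) (v := t) (by decide)) (g2.setReg (by decide))
      rwa [show min (min (t + 1) m + 1) m = min (t + 1 + 1) m by omega] at this)
    (fun t s' v ⟨g1, g2⟩ => ⟨g1.setReg (by decide), g2.setReg (by decide)⟩)
  rw [h.ctx.reg] at key
  have hle := hu.le
  rwa [show min (n + 1) m = m by omega] at key

end

end SafeSet

/-! ### Correctness of the second phase -/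

namespace SafeSet

open Cmd Exp

section

variable {n : ℕ} {A : ℕ → ℕ → Prop} {T : Finset ℕ} {u br ptr tm : ℕ → ℕ} {s : State} {m : ℕ}

theorem filter_card_congr {n : ℕ} {p q : ℕ → Prop} [DecidablePred p] [DecidablePred q]
    (h : ∀ i < n, p i ↔ q i) :
    ((Finset.range n).filter p).card = ((Finset.range n).filter q).card := by
  rw [Finset.filter_congr fun i hi => h i (Finset.mem_range.1 hi)]

/-- The four conjuncts of the expression are the fields of `Fits`, in this order. Only the first `m`
entries of the list of vertices are known, so the pointers of these slots have to stay below `m`. -/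
theorem holds_fitsExp (hmK : m ≤ T.card) (hun : ∀ i < T.card, u i < n)
    (hptr : ∀ i < m, ptr i < m) (h : Labeled n A T u br ptr tm s)
    (hF : Found n A T u m s) {X : Set ℕ} (hX : IsSet n 16 X s)
    (hY : IsSet n 17 (front u m ∪ X) s) (hC : IsConn n A 11 (front u m ∪ X) s) :
    fitsExp.Holds s ↔ Fits n A T.card m u ptr tm ptr^[n] (cap n A T (front u m)) (front u m)
      (s.reg 9) X := by
  classical
  rw [fitsExp, holds_and, holds_and, holds_and]
  have hn := h.ctx.reg
  have hc := hF.count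
  have hs := h.size
  refine (and_congr ?_ (and_congr ?_ (and_congr ?_ ?_))).trans
    ⟨fun ⟨a, b, c, d⟩ => ⟨a, b, c, d⟩, fun ⟨a, b, c, d⟩ => ⟨a, b, c, d⟩⟩
  · simp only [holds_all, holds_imp, holds_lt, holds_eq, holds_get, eval_at0, Exp.eval,
      State.setReg_reg, State.setReg_arr, reduceIte, Nat.reduceEqDiff, hn, hc]
    refine forall₂_congr fun i hi => forall_congr' fun him => ?_
    have hp := hptr i him
    rw [h.tm_eq i (by omega), h.ptr_eq i (by omega), hF.list i him, hF.list _ hp,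
      hC _ (hun _ (by omega)) _ (hun _ (by omega))]
  · simp only [holds_all, holds_imp, holds_lt, holds_le, eval_cnt, holds_and, holds_at0, holds_eq,
      holds_cnt, holds_get]
    simp only [eval_at0, Exp.eval, State.setReg_reg, State.setReg_arr, reduceIte, Nat.reduceEqDiff,
      hn, hc, hs]
    refine forall₂_congr fun i hi => forall_congr' fun him => ?_
    rw [h.lab i (by omega)]
    refine iff_of_eq (congrArg₂ _ (filter_card_congr fun a ha => ?_) (filter_card_congr fun x hx =>
        ?_))
    · refine and_congr_right fun _ => and_congr_right fun haK => ?_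
      rw [h.tm_eq a haK, h.lab a haK]
    · rw [hX x hx]
      refine and_congr_right fun _ => exists_congr fun i' => and_congr_right fun _ =>
        and_congr_right fun hi' => ?_
      rw [h.lab i' (by omega), hF.list i' hi', hC x hx _ (hun _ (by omega))]
  · simp only [holds_le, eval_cnt, holds_and, holds_at0, holds_eq, holds_lt]
    simp only [eval_at0, Exp.eval, State.setReg_reg, State.setReg_arr, reduceIte, Nat.reduceEqDiff,
      hn, hc, hs]
    refine iff_of_eq (congrArg₂ _ (filter_card_congr fun x hx => hX x hx)
      (filter_card_congr fun a ha => ?_))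
    refine and_congr_right fun _ => and_congr_right fun haK => ?_
    rw [h.tm_eq a haK]
  · simp only [holds_all, holds_imp, holds_not, holds_or, holds_le, eval_cnt, holds_and, holds_at0,
      holds_cnt, holds_get]
    simp only [eval_at0, Exp.eval, State.setReg_reg, State.setReg_arr, reduceIte, Nat.reduceEqDiff,
      hn]
    refine forall₂_congr fun a ha => imp_congr (hY a ha) (forall₂_congr fun b hb =>
      imp_congr (not_congr (hY b hb)) (imp_congr (h.ctx.arr a ha b hb) (or_congr ?_ ?_)))
    · rw [hC.card_eq hb fun _ _ => Iff.rfl, hC.card_eq ha fun _ _ => Iff.rfl]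
    · refine exists_congr fun w => and_congr_right fun hw => ?_
      rw [hC.card_eq hb fun _ _ => Iff.rfl, hC a ha w hw, hF.cap w hw]

/-- The first phase is complete. -/
structure Ready (n : ℕ) (A : ℕ → ℕ → Prop) (T : Finset ℕ) (u br ptr tm : ℕ → ℕ) (m : ℕ)
    (s : State) : Prop where
  labeled : Labeled n A T u br ptr tm s
  found : Found n A T u m s
  conn : IsConn n A 14 (front u m) s

theorem Ready.run (h : Ready n A T u br ptr tm m s) {c : Cmd} (h1 : ∀ x ∈ [0, 2, 4, 6, 12], x ∉
    c.wr)
    (h2 : ∀ a ∈ [0, 2, 3, 4, 6, 7, 8, 9, 10, 14], a ∉ c.wa) :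
    Ready n A T u br ptr tm m (c.run s) := by
  refine ⟨h.labeled.run (fun x hx => h1 x ?_) (fun a ha => h2 a ?_), h.found.run (h1 6 (by simp))
    (fun a ha => h2 a ?_), ?_⟩
  · simp at *; omega
  · simp at *; omega
  · simp at *; omega
  · unfold IsConn; rw [run_arr (h2 14 (by simp))]; exact h.conn

theorem Ready.setReg (h : Ready n A T u br ptr tm m s) {x v : ℕ} (h1 : x ∉ [0, 2, 4, 6, 12]) :
    Ready n A T u br ptr tm m (s.setReg x v) :=
  ⟨h.labeled.setReg (by simp at *; omega), h.found.setReg (by simp at h1; omega), h.conn⟩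

/-- The second phase has placed the pieces `X 1, …, X J` in the components of the vertices
`v 1, …, v J`, which are less than `w`. -/
structure Placed (n : ℕ) (A : ℕ → ℕ → Prop) (T : Finset ℕ) (u ptr tm : ℕ → ℕ) (m w : ℕ)
    (X : ℕ → Set ℕ) (v : ℕ → ℕ) (J : ℕ) (s : State) : Prop where
  count : s.reg 9 = J + 1
  lt : ∀ j, 1 ≤ j → j ≤ J → v j < w
  piece : ∀ j, 1 ≤ j → j ≤ J → v j ∉ front u m ∧ X j ⊆ {x | Conn A (front u m) (v j) x} ∧
    Fits n A T.card m u ptr tm ptr^[n] (cap n A T (front u m)) (front u m) j (X j)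
  disj : ∀ j, 1 ≤ j → j ≤ J → ∀ l, 1 ≤ l → l ≤ J → Conn A (front u m) (v j) (v l) → j = l
  out : IsSet n 1 {x | x ∈ front u m ∨ ∃ j, 1 ≤ j ∧ j ≤ J ∧ x ∈ X j} s
  used : IsSet n 15 {x | ∃ j, 1 ≤ j ∧ j ≤ J ∧ Conn A (front u m) (v j) x} s

variable {w : ℕ} {X : ℕ → Set ℕ} {v : ℕ → ℕ} {J : ℕ}

theorem Placed.run (h : Placed n A T u ptr tm m w X v J s) {c : Cmd} (h1 : 9 ∉ c.wr)
    (h2 : ∀ a ∈ [1, 15], a ∉ c.wa) : Placed n A T u ptr tm m w X v J (c.run s) := by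
  refine ⟨(run_reg h1 s).trans h.count, h.lt, h.piece, h.disj, ?_, ?_⟩
  · unfold IsSet; rw [run_arr (h2 1 (by simp))]; exact h.out
  · unfold IsSet; rw [run_arr (h2 15 (by simp))]; exact h.used

theorem Placed.setReg (h : Placed n A T u ptr tm m w X v J s) {x a : ℕ} (h1 : x ≠ 9) :
    Placed n A T u ptr tm m w X v J (s.setReg x a) :=
  ⟨by rw [State.setReg_reg, if_neg h1.symm, h.count], h.lt, h.piece, h.disj, h.out, h.used⟩

theorem Placed.mono (h : Placed n A T u ptr tm m w X v J s) {w' : ℕ} (hw : w ≤ w') :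
    Placed n A T u ptr tm m w' X v J s :=
  ⟨h.count, fun j h1 h2 => (h.lt j h1 h2).trans_le hw, h.piece, h.disj, h.out, h.used⟩

/-- Two steps that add an array to another one, elementwise. -/
theorem or_spec {a b : ℕ} {e : Exp} (he : e.ok 50) (ha : a ∉ e.arrs) (hab : a ≠ b) {Y Z : Set ℕ} (hn
    : s.reg 0 = n) (hY : IsSet n b Y s)
    (hZ : ∀ i < n, e.Holds ((s.setReg 20 i).setReg 21 0) ↔ i ∈ Z) :
    IsSet n b (Y ∪ Z) (((tab a 20 21 (or (at0 b (reg 20)) e)).seq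
      (tab b 20 21 (at0 a (reg 20)))).run s) := by
  intro i hi
  have e1 : ((tab a 20 21 (or (at0 b (reg 20)) e)).run s).reg 0 = n :=
    (run_reg (by simp [tab, wr]) s).trans hn
  rw [Cmd.run, tab_spec (by rfl) (by simp [arrs, at0]; omega) (by omega) (by omega)]
  simp only [eval_at0, Exp.eval, State.setReg_reg, State.setReg_arr, reduceIte, Nat.reduceEqDiff]
  rw [tab_spec (by simp [Exp.or, Exp.ok, at0, he]) (by simp [arrs, at0, Exp.or, ha, hab]) (by omega)
    (by omega)]
  change Exp.Holds _ _ ↔ _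
  rw [holds_or, hZ i hi, holds_at0, Set.mem_union, ← hY i hi]
  simp [Exp.eval, State.setReg_reg]

/-- As `w` is in no component that was used before, the components of the pieces remain distinct,
which disjointness in `IsScheme.safe_union` relies on. -/
theorem place_spec (hA : IsGraph n A) (h : Ready n A T u br ptr tm m s)
    (hP : Placed n A T u ptr tm m w X v J s) (hw : s.reg 7 = w) (hwn : w < n)
    (hwS : w ∉ front u m) (hwU : ∀ j, 1 ≤ j → j ≤ J → ¬ Conn A (front u m) (v j) w) {Z : Set ℕ}
    (hZ : IsSet n 16 Z s) (hZw : Z ⊆ {x | Conn A (front u m) w x})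
    (hfit : Fits n A T.card m u ptr tm ptr^[n] (cap n A T (front u m)) (front u m) (J + 1) Z) :
    Placed n A T u ptr tm m (w + 1) (Function.update X (J + 1) Z) (Function.update v (J + 1) w)
      (J + 1) (place.run s) ∧ (place.run s).reg 10 = 1 := by
  have hn := h.labeled.ctx.reg
  have hX1 : ∀ j, j ≤ J → Function.update X (J + 1) Z j = X j := fun j hj =>
    Function.update_of_ne (by omega) _ _
  have hv1 : ∀ j, j ≤ J → Function.update v (J + 1) w j = v j := fun j hj =>
    Function.update_of_ne (by omega) _ _
  set s1 := s.setReg 10 1 with hs1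
  set s2 := ((tab 5 20 21 (or (at0 1 (reg 20)) (at0 16 (reg 20)))).seq
    (tab 1 20 21 (at0 5 (reg 20)))).run s1 with hs2
  set s3 := ((tab 5 20 21 (or (at0 15 (reg 20)) (get 14 (reg 7) (reg 20)))).seq
    (tab 15 20 21 (at0 5 (reg 20)))).run s2 with hs3
  have h1 : Ready n A T u br ptr tm m s1 := h.setReg (by decide)
  have h2 : Ready n A T u br ptr tm m s2 := h1.run (by decide) (by decide)
  have hP1 : Placed n A T u ptr tm m w X v J s1 := hP.setReg (by decide)
  have hrun : place.run s = s3.setReg 9 (s3.reg 9 + 1) := rfl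
  have ho1 : IsSet n 1 ({x | x ∈ front u m ∨ ∃ j, 1 ≤ j ∧ j ≤ J ∧ x ∈ X j} ∪ Z) s2 := by
    refine or_spec (by rfl) (by decide) (by decide) hn hP1.out fun i hi => ?_
    rw [holds_at0, ← hZ i hi]
    rfl
  have hw2 : s2.reg 7 = w := by rw [hs2, run_reg (by decide), hs1, State.setReg_reg]; exact hw
  have ho2 : IsSet n 15 ({x | ∃ j, 1 ≤ j ∧ j ≤ J ∧ Conn A (front u m) (v j) x} ∪
      {x | Conn A (front u m) w x}) s3 := by
    refine or_spec (by rfl) (by decide) (by decide) h2.labeled.ctx.reg (fun i hi => ?_)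
      fun i hi => ?_
    · rw [hs2, run_arr (by decide)]; exact hP1.used i hi
    · rw [holds_get]
      simp only [Exp.eval, State.setReg_reg, State.setReg_arr, reduceIte, Nat.reduceEqDiff, hw2]
      exact h2.conn w hwn i hi
  rw [hrun]
  refine ⟨⟨?_, ?_, ?_, ?_, fun i hi => ?_, fun i hi => ?_⟩, ?_⟩
  · rw [State.setReg_reg, if_pos rfl, hs3, run_reg (by decide), hs2, run_reg (by decide), hP1.count]
  · intro j h1 h2
    rcases Nat.le_succ_iff.1 h2 with h2 | rfl
    · rw [hv1 j h2]; have := hP.lt j h1 h2; omega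
    · rw [Function.update_self]; omega
  · intro j h1 h2
    rcases Nat.le_succ_iff.1 h2 with h2 | rfl
    · rw [hv1 j h2, hX1 j h2]; exact hP.piece j h1 h2
    · rw [Function.update_self, Function.update_self]; exact ⟨hwS, hZw, hfit⟩
  · intro j h1 h2 l h3 h4 hc
    rcases Nat.le_succ_iff.1 h2 with h2 | rfl <;> rcases Nat.le_succ_iff.1 h4 with h4 | rfl
    · rw [hv1 j h2, hv1 l h4] at hc; exact hP.disj j h1 h2 l h3 h4 hc
    · rw [hv1 j h2, Function.update_self] at hc; exact absurd hc (hwU j h1 h2)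
    · rw [hv1 l h4, Function.update_self] at hc; exact absurd (hc.symm hA) (hwU l h3 h4)
    · rfl
  · rw [State.setReg_arr, hs3, run_arr (by decide), ho1 i hi, Set.mem_union, Set.mem_ofPred_eq,
      Set.mem_ofPred_eq, or_assoc]
    refine or_congr_right ⟨?_, ?_⟩
    · rintro (⟨j, h3, h4, h5⟩ | h5)
      · exact ⟨j, h3, by omega, by rwa [hX1 j h4]⟩
      · exact ⟨J + 1, by omega, le_rfl, by rwa [Function.update_self]⟩
    · rintro ⟨j, h3, h4, h5⟩
      rcases Nat.le_succ_iff.1 h4 with h4 | rfl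
      · exact .inl ⟨j, h3, h4, by rwa [hX1 j h4] at h5⟩
      · exact .inr (by rwa [Function.update_self] at h5)
  · rw [State.setReg_arr, ho2 i hi, Set.mem_union, Set.mem_ofPred_eq, Set.mem_ofPred_eq]
    refine ⟨?_, ?_⟩
    · rintro (⟨j, h3, h4, h5⟩ | h5)
      · exact ⟨j, h3, by omega, by rwa [hv1 j h4]⟩
      · exact ⟨J + 1, by omega, le_rfl, by rwa [Function.update_self]⟩
    · rintro ⟨j, h3, h4, h5⟩
      rcases Nat.le_succ_iff.1 h4 with h4 | rfl
      · exact .inl ⟨j, h3, h4, by rwa [hv1 j h4] at h5⟩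
      · exact .inr (by rwa [Function.update_self] at h5)
  · rw [State.setReg_reg, if_neg (by decide), hs3, run_reg (by decide), hs2, run_reg (by decide)]
    rfl

open Classical in
-- The work before the decision is summarised by a command `c` of which only the untouched registers
-- and arrays matter; every invariant passes through it by the frame rules.
theorem tryPiece_spec (hA : IsGraph n A) (hmK : m ≤ T.card) (hun : ∀ i < T.card, u i < n)
    (hptr : ∀ i < m, ptr i < m) (h : Ready n A T u br ptr tm m s)
    (hP : Placed n A T u ptr tm m w X v J s) {Z : Set ℕ} (hZ : IsSet n 16 Z s) :
    ∃ c : Cmd, (∀ x ∈ [0, 2, 4, 6, 7, 9, 10, 12], x ∉ c.wr) ∧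
      (∀ a ∈ [0, 1, 2, 3, 4, 6, 7, 8, 9, 10, 14, 15, 16], a ∉ c.wa) ∧
      tryPiece.run s =
        if Fits n A T.card m u ptr tm ptr^[n] (cap n A T (front u m)) (front u m) (J + 1) Z
        then place.run (c.run s) else c.run s := by
  set c := (tab 17 20 21 (or (at0 8 (reg 20)) (at0 16 (reg 20)))).seq (closure 17 11 5) with hc
  refine ⟨c, by decide, by decide, ?_⟩
  set s1 := (tab 17 20 21 (or (at0 8 (reg 20)) (at0 16 (reg 20)))).run s with hs1
  have h1 : Ready n A T u br ptr tm m s1 := h.run (by decide) (by decide)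
  have hn := h.labeled.ctx.reg
  have hY : IsSet n 17 (front u m ∪ Z) s1 := by
    intro i hi
    rw [hs1, tab_spec (by rfl) (by decide) (by omega) (by omega), eval_or_ne, holds_at0, holds_at0,
      Set.mem_union, ← h.found.set i hi, ← hZ i hi]
    rfl
  have hC : IsConn n A 11 (front u m ∪ Z) (c.run s) :=
    closure_spec h1.labeled.ctx hY hA (by decide) (by decide) (by decide)
  have h2 : Ready n A T u br ptr tm m (c.run s) := h.run (by decide) (by decide)
  have hP2 : Placed n A T u ptr tm m w X v J (c.run s) := hP.run (by decide) (by decide)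
  have hZ2 : IsSet n 16 Z (c.run s) := by unfold IsSet; rw [run_arr (by decide)]; exact hZ
  have hY2 : IsSet n 17 (front u m ∪ Z) (c.run s) := by
    have : (c.run s).arr 17 = s1.arr 17 := by rw [hc, Cmd.run, ← hs1, run_arr (by decide)]
    unfold IsSet; rw [this]; exact hY
  have hrun : tryPiece.run s = (Cmd.ite fitsExp place skip).run (c.run s) := rfl
  rw [hrun, run_ite]
  have := holds_fitsExp hmK hun hptr h2.labeled h2.found hZ2 hY2 hC
  rw [hP2.count] at this
  simp only [this]
  rfl

end

end SafeSet

/-! ### Scanning the components for pieces -/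

namespace SafeSet

open Cmd Exp

section

variable {n : ℕ} {A : ℕ → ℕ → Prop} {T : Finset ℕ} {u br ptr tm : ℕ → ℕ} {s : State} {m : ℕ}
variable {w : ℕ} {X : ℕ → Set ℕ} {v : ℕ → ℕ} {J : ℕ}

open Classical in
theorem prod_two_or_one (n : ℕ) (A : ℕ → ℕ → Prop) (S : Set ℕ) (w : ℕ) :
    ∏ i ∈ Finset.range n, (if Conn A S w i then 2 else 1) = 2 ^ csize n A S w := by
  rw [Finset.prod_ite, Finset.prod_const, Finset.prod_const_one, mul_one]
  rfl

/-- Binary digits at the vertices of the component of `w`, and trivial digits elsewhere, run through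
its subsets. A piece is placed only if it fits, so the invariant holds in any case. If the component
has at most `T.card` vertices, then `2 ^ T.card` iterations see all its subsets and miss no set that
fits. -/
theorem scan_spec (hA : IsGraph n A) (hmK : m ≤ T.card) (hun : ∀ i < T.card, u i < n)
    (hptr : ∀ i < m, ptr i < m) (h : Ready n A T u br ptr tm m s) (hw : s.reg 7 = w) (hwn : w < n)
    (hP : Placed n A T u ptr tm m w X v J s) :
    ∃ X' v' J', Placed n A T u ptr tm m (w + 1) X' v' J' (scan.run s) ∧ J ≤ J' ∧
      (w ∉ front u m → (∀ j, 1 ≤ j → j ≤ J → ¬ Conn A (front u m) (v j) w) →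
        csize n A (front u m) w ≤ T.card →
        (∃ Z ⊆ {x | Conn A (front u m) w x}, Fits n A T.card m u ptr tm ptr^[n]
          (cap n A T (front u m)) (front u m) (J + 1) Z) → J + 1 ≤ J') := by
  classical
  set c : Cmd := (Cmd.ite (reg 10) skip tryPiece).seq (incr 16 5 bitBase) with hc
  have hskip : (or (at0 8 (reg 7)) (at0 15 (reg 7))).Holds s ↔
      w ∈ front u m ∨ ∃ j, 1 ≤ j ∧ j ≤ J ∧ Conn A (front u m) (v j) w := by
    rw [holds_or, holds_at0, holds_at0]
    simp only [Exp.eval, hw]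
    rw [h.found.set w hwn, hP.used w hwn]
    rfl
  rw [scan, run_ite]
  by_cases hsk : (or (at0 8 (reg 7)) (at0 15 (reg 7))).Holds s
  · rw [if_pos hsk]
    refine ⟨X, v, J, hP.mono (Nat.le_succ w), le_rfl, fun h1 h2 => ?_⟩
    rcases hskip.1 hsk with h | ⟨j, h3, h4, h5⟩
    exacts [absurd h h1, absurd h5 (h2 j h3 h4)]
  rw [if_neg hsk]
  rw [hskip, not_or] at hsk
  obtain ⟨hwS, hwU⟩ := hsk
  have hwU : ∀ j, 1 ≤ j → j ≤ J → ¬ Conn A (front u m) (v j) w := fun j h1 h2 h3 =>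
    hwU ⟨j, h1, h2, h3⟩
  set b : ℕ → ℕ := fun i => if Conn A (front u m) w i then 2 else 1 with hb
  set s1 := (clear 16).run (s.setReg 10 0) with hs1
  have h1 : Ready n A T u br ptr tm m s1 := (h.setReg (by decide)).run (by decide) (by decide)
  have hP1 : Placed n A T u ptr tm m w X v J s1 :=
    (hP.setReg (by decide)).run (by decide) (by decide)
  let D : ℕ → Set ℕ := fun t => {x | x < n ∧ dig b t x ≠ 0}
  have hDw : ∀ t, D t ⊆ {x | Conn A (front u m) w x} := by
    rintro t x ⟨hx, hd⟩
    by_contra hcx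
    have : dig b t x < b x := Nat.mod_lt _ (by simp only [hb]; split_ifs <;> omega)
    have hbx : b x = 1 := if_neg hcx
    omega
  -- Register `10` tells whether a piece was placed during this scan; once it is set, no further set
  -- is tried.
  let P : ℕ → State → Prop := fun t s' => Ready n A T u br ptr tm m s' ∧ s'.reg 7 = w ∧
    (∀ i < n, s'.arr 16 i 0 = dig b t i) ∧
    ((s'.reg 10 = 0 ∧ Placed n A T u ptr tm m w X v J s') ∨
      (s'.reg 10 ≠ 0 ∧ ∃ X' v', Placed n A T u ptr tm m (w + 1) X' v' (J + 1) s'))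
  have hset : ∀ t s', P t s' → IsSet n 16 (D t) s' := fun t s' hPt i hi => by
    rw [hPt.2.2.1 i hi]
    exact ⟨fun h => ⟨hi, h⟩, fun h => h.2⟩
  have hsetReg : ∀ t s' a, P t s' → P t (s'.setReg 38 a) := by
    rintro t s' a ⟨g1, g2, g3, g4⟩
    refine ⟨g1.setReg (by decide), g2, g3, g4.imp (fun h => ⟨h.1, h.2.setReg (by decide)⟩)
      fun ⟨h, X', v', h'⟩ => ⟨h, X', v', h'.setReg (by decide)⟩⟩
  have hincr : ∀ t s', P t s' → P (t + 1) ((incr 16 5 bitBase).run s') := by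
    rintro t s' ⟨g1, g2, g3, g4⟩
    refine ⟨g1.run (by decide) (by decide), (run_reg (by decide) _).trans g2, ?_,
      g4.imp (fun h => ⟨(run_reg (by decide) _).trans h.1, h.2.run (by decide) (by decide)⟩)
      fun ⟨h, X', v', h'⟩ => ⟨by rwa [run_reg (by decide)], X', v', h'.run (by decide) (by decide)⟩⟩
    refine incr_spec (b := b) g1.labeled.ctx.reg (by decide) (by rfl) (by rfl) (by decide)
      (by decide) (fun i hi j hj l hl => ?_) (fun i _ => by simp only [hb]; split_ifs <;> omega) g3
    simp only [bitBase, Exp.eval, State.setReg_reg, State.setReg_arr, reduceIte, Nat.reduceEqDiff,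
      g2, hb, g1.conn w hwn i hi, g1.conn w hwn l hl, and_self]
  have htry : ∀ t s', P t s' → P t ((Cmd.ite (reg 10) skip tryPiece).run s') ∧
      ((s'.reg 10 ≠ 0 ∨ Fits n A T.card m u ptr tm ptr^[n] (cap n A T (front u m)) (front u m)
        (J + 1) (D t)) → ((Cmd.ite (reg 10) skip tryPiece).run s').reg 10 ≠ 0) := by
    intro t s' hPt
    have hst := hset t s' hPt
    obtain ⟨g1, g2, g3, g4⟩ := hPt
    rw [run_ite, holds_reg]
    rcases g4 with ⟨g4, g5⟩ | ⟨g4, g5⟩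
    · rw [if_neg (by simpa using g4)]
      obtain ⟨c', hc1, hc2, hc3⟩ := tryPiece_spec hA hmK hun hptr g1 g5 hst
      have k1 : Ready n A T u br ptr tm m (c'.run s') :=
        g1.run (fun x hx => hc1 x (by simp at *; omega)) fun a ha => hc2 a (by simp at *; omega)
      have k2 := g5.run (hc1 9 (by simp)) fun a ha => hc2 a (by simp at *; omega)
      have k3 : (c'.run s').reg 7 = w := (run_reg (hc1 7 (by simp)) s').trans g2
      have k4 : (c'.run s').reg 10 = 0 := (run_reg (hc1 10 (by simp)) s').trans g4
      have k5 : (c'.run s').arr 16 = s'.arr 16 := run_arr (hc2 16 (by simp)) s'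
      rw [hc3]
      split_ifs with hfit
      · obtain ⟨k6, k7⟩ := place_spec hA k1 k2 k3 hwn hwS hwU (Z := D t)
          (by unfold IsSet; rw [k5]; exact hst) (hDw t) hfit
        exact ⟨⟨k1.run (by decide) (by decide), (run_reg (by decide) _).trans k3,
          by rw [run_arr (by decide), k5]; exact g3, .inr ⟨by
              rw [k7]; exact one_ne_zero, _, _, k6⟩⟩,
          fun _ => by rw [k7]; exact one_ne_zero⟩
      · exact ⟨⟨k1, k3, by rw [k5]; exact g3, .inl ⟨k4, k2⟩⟩,
          fun h => (h.elim (· g4) hfit).elim⟩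
    · rw [if_pos g4]
      exact ⟨⟨g1, g2, g3, .inr ⟨g4, g5⟩⟩, fun _ => g4⟩
  have hP0 : P 0 s1 := by
    refine ⟨h1, ?_, fun i hi => ?_, .inl ⟨?_, hP1⟩⟩
    · rw [hs1, run_reg (by decide)]; exact hw
    · rw [dig_zero]
      exact clear_spec (n := n) (by exact h.labeled.ctx.reg) i hi 0 (by omega)
    · rw [hs1, run_reg (by decide)]; rfl
  have hstep : ∀ t s', P t s' → P (t + 1) (c.run (s'.setReg 38 t)) := fun t s' hPt =>
    hincr t _ (htry t _ (hsetReg t s' t hPt)).1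
  have hfin : P (s1.reg 4) ((loop 38 4 c).run s1) :=
    loop_induction hP0 (fun t _ s' => hstep t s') hsetReg
  have hrun : ((Cmd.set 10 (num 0)).seq ((clear 16).seq (loop 38 4 c))).run s =
      (loop 38 4 c).run s1 := rfl
  rw [hrun]
  have hgoal : csize n A (front u m) w ≤ T.card →
      (∃ Z ⊆ {x | Conn A (front u m) w x}, Fits n A T.card m u ptr tm ptr^[n]
          (cap n A T (front u m)) (front u m) (J + 1) Z) → ((loop 38 4 c).run s1).reg 10 ≠ 0 := by
    rintro hcs ⟨Z, hZw, hZ⟩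
    obtain ⟨t, ht, hdt⟩ := exists_dig_eq (b := b) (d := fun i => if i ∈ Z then 1 else 0) n (by
      intro i hi
      by_cases hiZ : i ∈ Z
      · have : b i = 2 := if_pos (hZw hiZ)
        simp only [if_pos hiZ, this]; omega
      · simp only [if_neg hiZ, hb]; split_ifs <;> omega)
    have hDZ : D t = Z := by
      ext x
      constructor
      · rintro ⟨hx, hd⟩
        rw [hdt x hx] at hd
        by_contra hxZ
        exact hd (if_neg hxZ)
      · intro hx
        have hxn := (show Conn A (front u m) w x from hZw hx).lt hA hwn
        exact ⟨hxn, by rw [hdt x hxn, if_pos hx]; exact one_ne_zero⟩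
    -- The digit string of `Z` occurs before `2 ^ csize`, hence within the `2 ^ T.card` iterations.
    rw [prod_two_or_one] at ht
    have hkeep : ∀ s', (c.run s').reg 10 = ((Cmd.ite (reg 10) skip tryPiece).run s').reg 10 :=
      fun s' => run_reg (c := incr 16 5 bitBase) (by decide) _
    refine loop_reaches (P := P) (G := fun s' => s'.reg 10 ≠ 0) (k := t)
      (ht.trans_le ?_) hP0 (fun t _ s' => hstep t s') (fun _ _ h => h) (fun s' hs' => ?_)
      fun i _ s' hs' hG => ?_
    · rw [h1.labeled.pow]; exact Nat.pow_le_pow_right (by omega) hcs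
    · rw [hkeep]
      exact (htry t _ (hsetReg t s' t hs')).2 (.inr (by rwa [hDZ]))
    · rw [hkeep]
      exact (htry i _ (hsetReg i s' i hs')).2 (.inl hG)
  rcases hfin.2.2.2 with ⟨g1, g2⟩ | ⟨g1, X', v', g2⟩
  · exact ⟨X, v, J, g2.mono (Nat.le_succ w), le_rfl, fun _ _ h3 h4 => absurd g1 (hgoal h3 h4)⟩
  · exact ⟨X', v', J + 1, g2, Nat.le_succ J, fun _ _ _ _ => le_rfl⟩

/-- The greedy choice stays ahead: before vertex `w` is scanned, at least as many pieces are placed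
as there are elements of `Q` below `w`. There may be more pieces than elements of `Q` in the end,
but no slots are demanded for the surplus ones. -/
theorem pieces_spec (hA : IsGraph n A) (hTn : ∀ x ∈ T, x < n) (hu : IsRun n A T u br m)
    {Q : Finset ℕ} (hQ : IsScheme n A T u m ptr tm Q) (h : Labeled n A T u br ptr tm s)
    (hF : Found n A T u m s) :
    ∃ X v J, Placed n A T u ptr tm m n X v J (pieces.run s) ∧ Q.card ≤ J := by
  classical
  have hmK := hu.le
  have hun : ∀ i < T.card, u i < n := fun i hi => hTn _ (hu.mem i hi)
  set s1 := (closure 8 14 5).run s with hs1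
  have h1 : Ready n A T u br ptr tm m s1 := ⟨h.run (by decide) (by decide),
    hF.run (by decide) (by decide), closure_spec h.ctx hF.set hA (by decide) (by
        decide) (by decide)⟩
  set s2 := (tab 1 20 21 (at0 8 (reg 20))).run s1 with hs2
  have h2 : Ready n A T u br ptr tm m s2 := h1.run (by decide) (by decide)
  have hn1 := h1.labeled.ctx.reg
  have hn2 := h2.labeled.ctx.reg
  have hout : IsSet n 1 (front u m) s2 := by
    intro i hi
    rw [hs2, tab_spec (by rfl) (by decide) (by omega) (by omega)]
    exact h1.found.set i hi
  set s3 := ((clear 15).seq (Cmd.set 9 (num 1))).run s2 with hs3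
  have h3 : Ready n A T u br ptr tm m s3 := h2.run (by decide) (by decide)
  have hP3 : Placed n A T u ptr tm m 0 (fun _ => ∅) (fun _ => 0) 0 s3 := by
    refine ⟨rfl, fun j h1 h2 => by omega, fun j h1 h2 => by omega, fun j h1 h2 => by omega, ?_, ?_⟩
    · intro i hi
      rw [hs3, run_arr (by decide), hout i hi]
      exact ⟨.inl, fun h => h.elim id fun ⟨j, h1, h2, _⟩ => by omega⟩
    · intro i hi
      have : s3.arr 15 i 0 = 0 := clear_spec hn2 i hi 0 (by omega)
      rw [this]
      exact ⟨fun h => absurd rfl h, fun ⟨j, h1, h2, _⟩ => by omega⟩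
  let P : ℕ → State → Prop := fun w s' => Ready n A T u br ptr tm m s' ∧
    ∃ X v J, Placed n A T u ptr tm m w X v J s' ∧ (Q.filter (· < w)).card ≤ J
  have key : P (s3.reg 0) ((loop 7 0 scan).run s3) := by
    refine loop_induction (P := P) ⟨h3, _, _, _, hP3, by simp⟩ ?_ ?_
    · rintro w hw s' ⟨g1, X, v, J, g2, g3⟩
      rw [h3.labeled.ctx.reg] at hw
      have g1' : Ready n A T u br ptr tm m (s'.setReg 7 w) := g1.setReg (by decide)
      refine ⟨g1'.run (by decide) (by decide), ?_⟩
      obtain ⟨X', v', J', k1, k2, k3⟩ := scan_spec hA hmK hun hQ.ptr_lt g1'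
        (by rw [State.setReg_reg, if_pos rfl]) hw (g2.setReg (by decide))
      refine ⟨X', v', J', k1, ?_⟩
      by_cases hwQ : w ∈ Q
      · have hcard : (Q.filter (· < w + 1)).card = (Q.filter (· < w)).card + 1 := by
          rw [← Finset.card_insert_of_notMem (s := Q.filter (· < w)) (a := w) (by simp)]
          congr 1
          ext x
          simp only [Finset.mem_filter, Finset.mem_insert]
          constructor
          · rintro ⟨h1, h2⟩
            by_cases hxw : x = w
            exacts [.inl hxw, .inr ⟨h1, by omega⟩]
          · rintro (rfl | ⟨h1, h2⟩)
            exacts [⟨hwQ, by omega⟩, ⟨h1, by omega⟩]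
        rw [hcard]
        -- If the greedy choice is strictly ahead, nothing is to be shown. In a tie, the next number
        -- is the rank of `w`, so the true piece at `w` fits; and its component is unused, because
        -- `w` is its least vertex while all vertices used so far are smaller.
        rcases g3.lt_or_eq with g3 | g3
        · omega
        · obtain ⟨-, l2, l3, l4⟩ := hQ.least w hwQ
          obtain ⟨Z, hZ, hfit⟩ := hQ.fits w hwQ
          rw [rank, g3] at hfit
          rw [g3]
          refine k3 l2 (fun j h1 h2 hc => ?_) l3 ⟨Z, hZ, hfit⟩
          have := l4 _ (hc.symm hA)
          have := g2.lt j h1 h2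
          omega
      · refine le_trans (Finset.card_le_card fun x hx => ?_) (g3.trans k2)
        simp only [Finset.mem_filter] at hx ⊢
        have : x ≠ w := fun h => hwQ (h ▸ hx.1)
        exact ⟨hx.1, by omega⟩
    · rintro w s' a ⟨g1, X, v, J, g2, g3⟩
      exact ⟨g1.setReg (by decide), X, v, J, g2.setReg (by decide), g3⟩
  rw [h3.labeled.ctx.reg] at key
  obtain ⟨-, X, v, J, g1, g2⟩ := key
  refine ⟨X, v, J, g1, ?_⟩
  rwa [Finset.filter_true_of_mem fun x hx => (hQ.least x hx).1] at g2

/-! ### Verification of the output; correctness of one attempt -/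

open Classical in
/-- The output array holds a safe set with at most `k` vertices. -/
def Good (n : ℕ) (A : ℕ → ℕ → Prop) (k : ℕ) (s : State) : Prop :=
  (∃ x < n, s.arr 1 x 0 ≠ 0) ∧ ((Finset.range n).filter fun x => s.arr 1 x 0 ≠ 0).card ≤ k ∧
    Safe n A {x | x < n ∧ s.arr 1 x 0 ≠ 0}

theorem holds_finalExp (hA : IsGraph n A) (h : Ctx n A s)
    (hC : IsConn n A 11 {x | x < n ∧ s.arr 1 x 0 ≠ 0} s) :
    finalExp.Holds s ↔ Good n A (s.reg 2) s := by
  classical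
  rw [finalExp, holds_and, holds_and]
  have hn := h.reg
  refine and_congr ?_ (and_congr ?_ ?_)
  · simp only [holds_cnt, holds_at0, Exp.eval, State.setReg_reg, State.setReg_arr, reduceIte, hn]
  · simp only [holds_le, eval_cnt, holds_at0]
    simp only [Exp.eval, State.setReg_reg, State.setReg_arr, reduceIte, hn]
  · simp only [holds_all, holds_imp, holds_not, holds_le, eval_cnt, holds_at0, holds_get]
    simp only [Exp.eval, State.setReg_reg, State.setReg_arr, reduceIte, Nat.reduceEqDiff, hn]
    constructor
    · rintro hs a ⟨han, ha⟩ b hb hab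
      have hbn := hA.lt' hab
      have := hs a han ha b hbn (fun h => hb ⟨hbn, h⟩) ((h.arr a han b hbn).2 hab)
      rwa [hC.card_eq hbn fun _ _ => Iff.rfl, hC.card_eq han fun _ _ => Iff.rfl] at this
    · intro hs a han ha b hbn hb hab
      rw [hC.card_eq hbn fun _ _ => Iff.rfl, hC.card_eq han fun _ _ => Iff.rfl]
      exact hs a ⟨han, ha⟩ b (fun h => hb h.2) ((h.arr a han b hbn).1 hab)

/-- Soundness for arbitrary strings: the flag is set by a final test of the output array,
independently of how the output was found. -/
theorem attempt_iff (hA : IsGraph n A) (h : Ctx n A s) :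
    (attempt.run s).reg 5 ≠ 0 ↔ Good n A (s.reg 2) (attempt.run s) := by
  obtain ⟨s1, hs1, h1, h12⟩ : ∃ s1, attempt.run s = (Cmd.set 5 finalExp).run
      ((closure 1 11 5).run s1) ∧ Ctx n A s1 ∧ s1.reg 2 = s.reg 2 := by
    refine ⟨pieces.run ((loop 35 0 Cmd.round).run (start.run (labels.run s))), rfl,
      (((h.run (by decide) (by decide)).run (by decide) (by decide)).run (by decide)
        (by decide)).run (by decide) (by decide), ?_⟩
    rw [run_reg (by decide), run_reg (by decide), run_reg (by decide), run_reg (by decide)]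
  have h2 : Ctx n A ((closure 1 11 5).run s1) := h1.run (by decide) (by decide)
  have hset : IsSet n 1 {x | x < n ∧ s1.arr 1 x 0 ≠ 0} s1 := fun i hi =>
    ⟨fun h => ⟨hi, h⟩, fun h => h.2⟩
  have hC := closure_spec h1 hset hA (t := 11) (tmp := 5) (by decide) (by decide) (by decide)
  have harr : ((closure 1 11 5).run s1).arr 1 = s1.arr 1 := run_arr (by decide) _
  have h22 : ((closure 1 11 5).run s1).reg 2 = s.reg 2 := (run_reg (by decide) _).trans h12
  rw [hs1]
  generalize (closure 1 11 5).run s1 = s2 at *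
  rw [← harr] at hC
  have := holds_finalExp hA h2 hC
  rw [h22] at this
  have e1 : ((Cmd.set 5 finalExp).run s2).reg 5 = finalExp.eval s2 := by
    rw [Cmd.run, State.setReg_reg, if_pos rfl]
  have e2 : ((Cmd.set 5 finalExp).run s2).arr = s2.arr := by rw [Cmd.run, State.setReg_arr]
  rw [e1, Good, e2]
  exact this

/-- With the right strings the first phase reproduces the run, and the second phase places enough
pieces for `IsScheme.safe_union`. The output may differ from `T`, but it passes the final test. -/
theorem attempt_complete (hA : IsGraph n A) (hTn : ∀ x ∈ T, x < n) (hu : IsRun n A T u br m)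
    {Q : Finset ℕ} (hQ : IsScheme n A T u m ptr tm Q) (h : Static n A T u br ptr tm s) :
    (attempt.run s).reg 5 ≠ 0 := by
  classical
  have hKn : T.card ≤ n := card_le_of_forall_lt hTn
  rw [attempt_iff hA h.ctx]
  have h1 := labels_spec hA hTn hKn hu hQ.ptr_lt_card hQ.lab_iff h
  obtain ⟨h2, hF2⟩ := start_spec hu h1
  obtain ⟨h3, hF3⟩ := rounds_spec hA hKn hu h2 hF2
  obtain ⟨X, v, J, hP, hJ⟩ := pieces_spec hA hTn hu hQ h3 hF3
  set s4 := pieces.run ((loop 35 0 Cmd.round).run (start.run (labels.run s))) with hs4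
  have hrun : attempt.run s = (Cmd.set 5 finalExp).run ((closure 1 11 5).run s4) := rfl
  have harr : (attempt.run s).arr 1 = s4.arr 1 := by
    rw [hrun, run_arr (by decide), run_arr (by decide)]
  set Y : Set ℕ := {x | x ∈ front u m ∨ ∃ j, 1 ≤ j ∧ j ≤ J ∧ x ∈ X j} with hY
  have hYn : ∀ x ∈ Y, x < n := by
    rintro x (⟨i, hi, rfl⟩ | ⟨j, h1, h2, h3⟩)
    · exact hTn _ (hu.mem i (hi.trans_le hu.le))
    · have hc : Conn A (front u m) (v j) x := (hP.piece j h1 h2).2.1 h3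
      exact hc.lt hA (hP.lt j h1 h2)
  obtain ⟨hsafe, hcard⟩ := hQ.safe_union hA hTn hu hJ hP.piece hP.disj (Y := Y) (fun x => Iff.rfl)
    ((Finset.range n).filter (· ∈ Y)) (fun x hx => by
      simp only [Finset.mem_filter, Finset.mem_range] at hx; exact hx)
  have hmem : ∀ x, x < n ∧ s4.arr 1 x 0 ≠ 0 ↔ x ∈ Y := fun x =>
    ⟨fun h => (hP.out x h.1).1 h.2, fun h => ⟨hYn x h, (hP.out x (hYn x h)).2 h⟩⟩
  rw [Good, harr]
  refine ⟨?_, ?_, ?_⟩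
  · have h0 : u 0 ∈ Y := .inl ⟨0, hu.pos, rfl⟩
    exact ⟨u 0, (hmem _).2 h0⟩
  · rw [h.size]
    refine le_trans (Finset.card_le_card fun x hx => ?_) hcard
    simp only [Finset.mem_filter, Finset.mem_range] at hx ⊢
    exact ⟨hx.1, (hmem x).1 hx⟩
  · rw [show {x | x < n ∧ s4.arr 1 x 0 ≠ 0} = Y from Set.ext hmem]
    exact hsafe

end

end SafeSet

/-! ### Correctness of the search -/

namespace SafeSet

open Cmd Exp

section

variable {n : ℕ} {A : ℕ → ℕ → Prop} {K : ℕ} {s : State}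

/-- The state is prepared for a search for a safe set of size `K`, and if the success flag is set,
then the output is good. -/
structure Setup (n : ℕ) (A : ℕ → ℕ → Prop) (K : ℕ) (s : State) : Prop where
  ctx : Ctx n A s
  size : s.reg 2 = K
  strings : s.reg 3 = (K + 1) ^ K
  pow : s.reg 4 = 2 ^ K
  good : s.reg 5 ≠ 0 → Good n A K s

theorem Good.run {c : Cmd} (h : Good n A K s) (hc : 1 ∉ c.wa) : Good n A K (c.run s) := by
  unfold Good; rw [run_arr hc]; exact h

theorem Setup.run (h : Setup n A K s) {c : Cmd} (h1 : ∀ x ∈ [0, 2, 3, 4, 5], x ∉ c.wr)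
    (h2 : ∀ a ∈ [0, 1], a ∉ c.wa) : Setup n A K (c.run s) := by
  refine ⟨h.ctx.run (h1 0 (by simp)) (h2 0 (by simp)), (run_reg (h1 2 (by simp)) s).trans h.size,
    (run_reg (h1 3 (by simp)) s).trans h.strings, (run_reg (h1 4 (by simp)) s).trans h.pow, ?_⟩
  rw [run_reg (h1 5 (by simp))]
  exact fun h5 => (h.good h5).run (h2 1 (by simp))

theorem Setup.setReg (h : Setup n A K s) {x v : ℕ} (h1 : x ∉ [0, 2, 3, 4, 5]) :
    Setup n A K (s.setReg x v) := by
  simp only [List.mem_cons, List.not_mem_nil, or_false, not_or] at h1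
  obtain ⟨a0, a2, a3, a4, a5⟩ := h1
  refine ⟨h.ctx.setReg a0, ?_, ?_, ?_, ?_⟩
  · rw [State.setReg_reg, if_neg (Ne.symm a2), h.size]
  · rw [State.setReg_reg, if_neg (Ne.symm a3), h.strings]
  · rw [State.setReg_reg, if_neg (Ne.symm a4), h.pow]
  · rw [State.setReg_reg, if_neg (Ne.symm a5)]; exact h.good

theorem attempts_spec (hA : IsGraph n A) (h : Setup n A K s) :
    Setup n A K (attempts.run s) ∧ (s.reg 5 ≠ 0 → (attempts.run s).reg 5 ≠ 0) ∧
    ((∃ (T : Finset ℕ) (u br ptr tm : ℕ → ℕ) (m : ℕ) (Q : Finset ℕ), T.card = K ∧ (∀ x ∈ T, x < n) ∧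
      IsRun n A T u br m ∧ IsScheme n A T u m ptr tm Q ∧ ∀ i < K, s.arr 2 i 0 = br i ∧
        s.arr 3 i 0 = ptr i ∧ s.arr 4 i 0 = tm i) → (attempts.run s).reg 5 ≠ 0) := by
  have hwr : ∀ x ∈ [0, 2, 3, 4, 12], x ∉ attempt.wr := by decide
  have hwa : ∀ a ∈ [0, 2, 3, 4], a ∉ attempt.wa := by decide
  let P : ℕ → State → Prop := fun _ s' => Setup n A K s' ∧ (s.reg 5 ≠ 0 → s'.reg 5 ≠ 0) ∧
    ∀ a ∈ [2, 3, 4], s'.arr a = s.arr a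
  have hstep : ∀ i s', P i s' → P (i + 1) ((Cmd.ite (reg 5) skip attempt).run (s'.setReg 12 i)) :=
      by
    rintro i s' ⟨g1, g2, g3⟩
    have g1' : Setup n A K (s'.setReg 12 i) := g1.setReg (by decide)
    rw [run_ite, holds_reg]
    split_ifs with h5
    · exact ⟨g1', fun _ => h5, g3⟩
    · have hat := attempt_iff hA g1'.ctx
      rw [g1'.size] at hat
      refine ⟨⟨g1'.ctx.run (hwr 0 (by simp)) (hwa 0 (by simp)),
        (run_reg (hwr 2 (by simp)) _).trans g1'.size, (run_reg (hwr 3 (by simp)) _).trans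
            g1'.strings,
        (run_reg (hwr 4 (by simp)) _).trans g1'.pow, hat.1⟩, fun h => absurd (g2 h) h5,
        fun a ha => ?_⟩
      rw [run_arr (hwa a (by simp at *; omega))]
      exact g3 a ha
  have hset : ∀ i s' v, P i s' → P i (s'.setReg 12 v) := fun i s' v ⟨g1, g2, g3⟩ =>
    ⟨g1.setReg (by decide), g2, g3⟩
  have hP0 : P 0 s := ⟨h, id, fun _ _ => rfl⟩
  obtain ⟨g1, g2, -⟩ := loop_induction (x := 12) (y := 0) hP0 (fun i _ => hstep i) hset
  refine ⟨g1, g2, ?_⟩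
  rintro ⟨T, u, br, ptr, tm, m, Q, rfl, hTn, hu, hQ, hs⟩
  have hK : 0 < T.card := hu.pos.trans_le hu.le
  -- The iteration with start vertex `u 0` succeeds unless an earlier one has; afterwards the flag
  -- blocks all further attempts, which preserves the output.
  refine loop_reaches (x := 12) (y := 0) (P := P) (G := fun s' => s'.reg 5 ≠ 0) (k := u 0) ?_ hP0
    (fun i _ => hstep i) (fun _ _ h => h) ?_ ?_
  · rw [h.ctx.reg]; exact hTn _ (hu.mem 0 hK)
  · rintro s' ⟨g1, g2, g3⟩
    rw [run_ite, holds_reg]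
    split_ifs with h5
    · exact h5
    · refine attempt_complete hA hTn hu hQ (br := br)
        ⟨g1.ctx.setReg (by decide), g1.size, g1.pow, rfl, ?_, ?_, ?_⟩
      · intro i hi; rw [← (hs i hi).1, ← g3 2 (by simp)]; rfl
      · intro i hi; rw [← (hs i hi).2.1, ← g3 3 (by simp)]; rfl
      · intro i hi; rw [← (hs i hi).2.2, ← g3 4 (by simp)]; rfl
  · rintro i - s' - h5
    rw [run_ite, holds_reg, if_pos (show (s'.setReg 12 i).reg 5 ≠ 0 from h5)]
    exact h5

theorem prod_digitBase (hK : K ≤ n) :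
    ∏ i ∈ Finset.range n, (if i < K then K + 1 else 1) = (K + 1) ^ K := by
  rw [Finset.prod_ite, Finset.prod_const, Finset.prod_const_one, mul_one,
    show (Finset.range n).filter (· < K) = Finset.range K by ext; simp; omega, Finset.card_range]

/-- Running through all strings of digits in the array `a`. -/
theorem strings_spec {c : Cmd} {a x : ℕ} {R : State → Prop} (hK : K ≤ n) (ha : a ∈ [2, 3, 4])
    (hx : x ∉ [0, 2, 3, 4, 5])
    (hc : ∀ s, Setup n A K s → Setup n A K (c.run s))
    (hkeep : ∀ s, Setup n A K s → s.reg 5 ≠ 0 → (c.run s).reg 5 ≠ 0) (hca : a ∉ c.wa)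
    (hRc : ∀ s, R s → R (c.run s)) (hRi : ∀ s, R s → R ((incr a 5 digitBase).run s))
    (hRx : ∀ s v, R s → R (s.setReg x v)) (hRz : ∀ s, R s → R ((clear a).run s))
    (h : Setup n A K s) (hR : R s) :
    Setup n A K (((clear a).seq (loop x 3 (c.seq (incr a 5 digitBase)))).run s) ∧
    (s.reg 5 ≠ 0 → (((clear a).seq (loop x 3 (c.seq (incr a 5 digitBase)))).run s).reg 5 ≠ 0) ∧
    ∀ d : ℕ → ℕ, (∀ i < K, d i ≤ K) → (∀ s, Setup n A K s → R s → (∀ i < K, s.arr a i 0 = d i) →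
      (c.run s).reg 5 ≠ 0) →
      (((clear a).seq (loop x 3 (c.seq (incr a 5 digitBase)))).run s).reg 5 ≠ 0 := by
  have hx5 : (5 : ℕ) ≠ x := fun h => hx (by simp [← h])
  have hwr : ∀ y ∈ [0, 2, 3, 4, 5], y ∉ (incr a 5 digitBase).wr := by
    simp [incr, tab, wr]
  have hwa : ∀ b ∈ [0, 1], b ∉ (incr a 5 digitBase).wa := by
    simp at ha; simp [incr, tab, wa]; omega
  have h1 : Setup n A K ((clear a).run s) := h.run (by simp [clear, tab, wr]) (by
    simp at ha; simp [clear, tab, wa]; omega)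
  have h15 : ((clear a).run s).reg 5 = s.reg 5 := run_reg (by simp [clear, tab, wr]) s
  set s1 := (clear a).run s with hs1
  set b : ℕ → ℕ := fun i => if i < K then K + 1 else 1 with hb
  let P : ℕ → State → Prop := fun t s' => Setup n A K s' ∧ R s' ∧ (s.reg 5 ≠ 0 → s'.reg 5 ≠ 0) ∧
    ∀ i < n, s'.arr a i 0 = dig b t i
  have hset : ∀ t s' v, P t s' → P t (s'.setReg x v) := by
    rintro t s' v ⟨g1, g2, g3, g4⟩
    exact ⟨g1.setReg hx, hRx _ _ g2, fun h => by rw [State.setReg_reg, if_neg hx5]; exact g3 h, g4⟩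
  have hkeep' : ∀ s', ((c.seq (incr a 5 digitBase)).run s').reg 5 = (c.run s').reg 5 := fun s' =>
    run_reg (hwr 5 (by simp)) _
  have hstep : ∀ t s', P t s' → P (t + 1) ((c.seq (incr a 5 digitBase)).run (s'.setReg x t)) := by
    intro t s' hPt
    obtain ⟨g1, g2, g3, g4⟩ := hset t s' t hPt
    have k1 := hc _ g1
    refine ⟨k1.run hwr hwa, hRi _ (hRc _ g2), fun h => ?_, ?_⟩
    · rw [hkeep']; exact hkeep _ g1 (g3 h)
    · refine incr_spec (b := b) k1.ctx.reg (by simp at ha; omega) (by rfl) (by rfl) (by decide)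
        (by decide) (fun i hi j hj l hl => ?_) (fun i _ => by simp only [hb]; split_ifs <;> omega)
        (by rw [run_arr hca]; exact g4)
      simp only [digitBase, Exp.eval, State.setReg_reg, reduceIte, Nat.reduceEqDiff, k1.size, hb,
        ne_eq, ite_eq_right_iff, one_ne_zero, imp_false, not_not]
      simp
  have hP0 : P 0 s1 := ⟨h1, hRz _ hR, fun h => by rwa [h15], fun i hi => by
    rw [dig_zero]; exact clear_spec h.ctx.reg i hi 0 (by omega)⟩
  obtain ⟨g1, -, g3, -⟩ := loop_induction (x := x) (y := 3) hP0 (fun t _ => hstep t) hset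
  refine ⟨g1, g3, fun d hd hfound => ?_⟩
  -- Positions from `K` on have base `1`, so their digit is `0`; this leaves `(K + 1) ^ K` strings.
  obtain ⟨t, ht, hdt⟩ := exists_dig_eq (b := b) (d := fun i => if i < K then d i else 0) n (by
    intro i hi
    simp only [hb]
    split_ifs with h
    · have := hd i h; omega
    · omega)
  rw [prod_digitBase hK] at ht
  refine loop_reaches (x := x) (y := 3) (P := P) (G := fun s' => s'.reg 5 ≠ 0) (k := t)
    (by rwa [h1.strings]) hP0 (fun t _ => hstep t)
    (fun s' v h => by rwa [State.setReg_reg, if_neg hx5]) (fun s' hs' => ?_) fun i _ s' hs' hG => ?_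
  · obtain ⟨k1, k2, k3, k4⟩ := hset t s' t hs'
    rw [hkeep']
    exact hfound _ k1 k2 fun i hi => by rw [k4 i (by omega), hdt i (by omega), if_pos hi]
  · obtain ⟨k1, k2, k3, k4⟩ := hset i s' i hs'
    rw [hkeep']
    exact hkeep _ k1 (by rwa [State.setReg_reg, if_neg hx5])

/-- Running through the strings of times. -/
def timeLoop : Cmd := (clear 4).seq (loop 33 3 (attempts.seq (incr 4 5 digitBase)))

/-- Running through the strings of pointers and the strings of times. -/
def ptrLoop : Cmd := (clear 3).seq (loop 32 3 (timeLoop.seq (incr 3 5 digitBase)))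

/-- Running through all strings. -/
def branchLoop : Cmd := (clear 2).seq (loop 31 3 (ptrLoop.seq (incr 2 5 digitBase)))

/-- Each of the three nested enumerations removes one string from the assumptions on the state: here
the times, then the pointers, then the branches. -/
theorem timeLoop_spec (hA : IsGraph n A) (hK : K ≤ n) (h : Setup n A K s) :
    Setup n A K (timeLoop.run s) ∧ (s.reg 5 ≠ 0 → (timeLoop.run s).reg 5 ≠ 0) ∧
    ((∃ (T : Finset ℕ) (u br ptr tm : ℕ → ℕ) (m : ℕ) (Q : Finset ℕ), T.card = K ∧ (∀ x ∈ T, x < n) ∧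
      IsRun n A T u br m ∧ IsScheme n A T u m ptr tm Q ∧ ∀ i < K, s.arr 2 i 0 = br i ∧
        s.arr 3 i 0 = ptr i) → (timeLoop.run s).reg 5 ≠ 0) := by
  have hwa : ∀ a ∈ [2, 3, 4], a ∉ attempts.wa := by decide
  obtain ⟨g1, g2, g3⟩ := strings_spec (c := attempts) (a := 4) (x := 33)
    (R := fun s' => s'.arr 2 = s.arr 2 ∧ s'.arr 3 = s.arr 3) hK (by decide) (by decide)
    (fun s' h' => (attempts_spec hA h').1) (fun s' h' => (attempts_spec hA h').2.1)
    (hwa 4 (by decide))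
    (fun s' h' => ⟨(run_arr (hwa 2 (by decide)) s').trans h'.1,
      (run_arr (hwa 3 (by decide)) s').trans h'.2⟩)
    (fun s' h' => ⟨(run_arr (by decide) s').trans h'.1, (run_arr (by decide) s').trans h'.2⟩)
    (fun s' v h' => h')
    (fun s' h' => ⟨(run_arr (by decide) s').trans h'.1, (run_arr (by decide) s').trans h'.2⟩)
    h ⟨rfl, rfl⟩
  refine ⟨g1, g2, ?_⟩
  rintro ⟨T, u, br, ptr, tm, m, Q, h1, h2, h3, h4, h5⟩
  refine g3 tm (fun i _ => h1 ▸ h4.tm_le i) fun s' h' hR hd => (attempts_spec hA h').2.2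
    ⟨T, u, br, ptr, tm, m, Q, h1, h2, h3, h4, fun i hi => ?_⟩
  rw [hR.1, hR.2]
  exact ⟨(h5 i hi).1, (h5 i hi).2, hd i hi⟩

theorem ptrLoop_spec (hA : IsGraph n A) (hK : K ≤ n) (h : Setup n A K s) :
    Setup n A K (ptrLoop.run s) ∧ (s.reg 5 ≠ 0 → (ptrLoop.run s).reg 5 ≠ 0) ∧
    ((∃ (T : Finset ℕ) (u br ptr tm : ℕ → ℕ) (m : ℕ) (Q : Finset ℕ), T.card = K ∧ (∀ x ∈ T, x < n) ∧
      IsRun n A T u br m ∧ IsScheme n A T u m ptr tm Q ∧ ∀ i < K, s.arr 2 i 0 = br i) →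
        (ptrLoop.run s).reg 5 ≠ 0) := by
  have hwa : ∀ a ∈ [2, 3], a ∉ timeLoop.wa := by decide
  obtain ⟨g1, g2, g3⟩ := strings_spec (c := timeLoop) (a := 3) (x := 32)
    (R := fun s' => s'.arr 2 = s.arr 2) hK (by decide) (by decide)
    (fun s' h' => (timeLoop_spec hA hK h').1) (fun s' h' => (timeLoop_spec hA hK h').2.1)
    (hwa 3 (by decide)) (fun s' h' => (run_arr (hwa 2 (by decide)) s').trans h')
    (fun s' h' => (run_arr (by decide) s').trans h') (fun s' v h' => h')
    (fun s' h' => (run_arr (by decide) s').trans h') h rfl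
  refine ⟨g1, g2, ?_⟩
  rintro ⟨T, u, br, ptr, tm, m, Q, h1, h2, h3, h4, h5⟩
  refine g3 ptr (fun i _ => h1 ▸ (h4.ptr_lt_card i).le) fun s' h' hR hd =>
    (timeLoop_spec hA hK h').2.2 ⟨T, u, br, ptr, tm, m, Q, h1, h2, h3, h4, fun i hi => ?_⟩
  rw [hR]
  exact ⟨h5 i hi, hd i hi⟩

theorem branchLoop_spec (hA : IsGraph n A) (hK : K ≤ n) (h : Setup n A K s) :
    Setup n A K (branchLoop.run s) ∧
    ((∃ (T : Finset ℕ) (u br ptr tm : ℕ → ℕ) (m : ℕ) (Q : Finset ℕ), T.card = K ∧ (∀ x ∈ T, x < n) ∧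
      IsRun n A T u br m ∧ IsScheme n A T u m ptr tm Q) → (branchLoop.run s).reg 5 ≠ 0) := by
  have hwa : 2 ∉ ptrLoop.wa := by decide
  obtain ⟨g1, -, g3⟩ := strings_spec (c := ptrLoop) (a := 2) (x := 31)
    (R := fun _ => True) hK (by decide) (by decide)
    (fun s' h' => (ptrLoop_spec hA hK h').1) (fun s' h' => (ptrLoop_spec hA hK h').2.1)
    hwa (fun _ _ => trivial) (fun _ _ => trivial) (fun _ _ _ => trivial) (fun _ _ => trivial) h
        trivial
  refine ⟨g1, ?_⟩
  rintro ⟨T, u, br, ptr, tm, m, Q, h1, h2, h3, h4⟩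
  exact g3 br (fun i _ => h1 ▸ h3.br_le i) fun s' h' _ hd =>
    (ptrLoop_spec hA hK h').2.2 ⟨T, u, br, ptr, tm, m, Q, h1, h2, h3, h4, hd⟩

/-- The preparations for the search. -/
def prepare : Cmd :=
  (Cmd.set 14 (succ (reg 2))).seq ((pow 3 14).seq ((Cmd.set 15 (num 2)).seq (pow 4 15)))

theorem run_search (s : State) : search.run s = branchLoop.run (prepare.run s) := rfl

theorem prepare_spec (hK : K ≤ n) (h : Ctx n A s) (h2 : s.reg 2 = K)
    (h5 : s.reg 5 ≠ 0 → Good n A K s) : Setup n A K (prepare.run s) := by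
  set s1 := (Cmd.set 14 (succ (reg 2))).run s with hs1
  have e2 : s1.reg 2 = K := by rw [hs1, run_reg (by decide), h2]
  have e14 : s1.reg 14 = K + 1 := by
    rw [hs1, Cmd.run, State.setReg_reg, if_pos rfl, Exp.eval, Exp.eval, h2]
  have e0 : s1.reg 0 = n := (h.run (by decide) (by decide)).reg
  have p1 := pow_spec (s := s1) (dst := 3) (base := 14) (by decide) (by decide) (by omega)
  set s2 := (Cmd.set 15 (num 2)).run ((pow 3 14).run s1) with hs2
  have f2 : s2.reg 2 = K := by rw [hs2, run_reg (by decide), run_reg (by decide), e2]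
  have f0 : s2.reg 0 = n := by rw [hs2, run_reg (by decide), run_reg (by decide), e0]
  have f15 : s2.reg 15 = 2 := rfl
  have f3 : s2.reg 3 = (K + 1) ^ K := by rw [hs2, run_reg (by decide), p1, e14, e2]
  have p2 := pow_spec (s := s2) (dst := 4) (base := 15) (by decide) (by decide) (by omega)
  have hrun : prepare.run s = (pow 4 15).run s2 := rfl
  refine ⟨h.run (by decide) (by decide), (run_reg (by decide) s).trans h2, ?_, ?_, fun h => ?_⟩
  · rw [hrun, run_reg (by decide), f3]
  · rw [hrun, p2, f2, f15]
  · rw [run_reg (by decide)] at h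
    exact (h5 h).run (by decide)

/-! ### Minimum solutions and the main loop -/

/-- A non-empty safe set of vertices. -/
structure Solution (n : ℕ) (A : ℕ → ℕ → Prop) (T : Finset ℕ) : Prop where
  nonempty : T.Nonempty
  lt : ∀ x ∈ T, x < n
  safe : Safe n A T

/-- Success is guaranteed only when `K` is the minimum size of a solution, since minimality puts `T`
into one component of the graph. -/
theorem search_spec (hA : IsGraph n A) (hK : K ≤ n) (h : Ctx n A s) (h2 : s.reg 2 = K)
    (h5 : s.reg 5 ≠ 0 → Good n A K s) :
    Setup n A K (search.run s) ∧ ((∃ T, Solution n A T ∧ T.card = K ∧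
      ∀ T', Solution n A T' → K ≤ T'.card) → (search.run s).reg 5 ≠ 0) := by
  classical
  obtain ⟨g1, g2⟩ := branchLoop_spec hA hK (prepare_spec hK h h2 h5)
  rw [run_search]
  refine ⟨g1, ?_⟩
  rintro ⟨T, hT, hTK, hmin⟩
  obtain ⟨r, hr⟩ := hT.nonempty
  obtain ⟨u, br, m, hur, hu⟩ := exists_isRun hA hT.safe (r := r) hr
  have hconn : ∀ x ∈ T, Conn A ∅ (u 0) x := by
    have hsub := (Finset.filter_subset (fun x => Conn A ∅ r x) T)
    -- The part of `T` in the component of `r` is itself a solution, so by minimality it is all of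
    -- `T`.
    have hsol : Solution n A (T.filter fun x => Conn A ∅ r x) := by
      refine ⟨⟨r, Finset.mem_filter.2 ⟨hr, .refl r⟩⟩, fun x hx => hT.lt x (hsub hx), ?_⟩
      have := hT.safe.inter (U := {x | Conn A ∅ r x}) fun x y hxy hx =>
        Conn.trans hx (.single hxy (by simp))
      convert this using 1
      ext x
      simp
    have heq := Finset.eq_of_subset_of_card_le hsub (by rw [hTK]; exact hmin _ hsol)
    intro x hx
    rw [hur]
    rw [← heq] at hx
    exact (Finset.mem_filter.1 hx).2
  obtain ⟨ptr, tm, Q, hQ⟩ := exists_isScheme hA hT.safe hT.lt hu hconn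
  exact g2 ⟨T, u, br, ptr, tm, m, Q, hTK, hT.lt, hu, hQ⟩

/-- The body of the main loop. -/
def mainBody : Cmd := .ite (or (reg 5) (le (reg 1) (reg 30))) skip
  ((Cmd.set 2 (succ (reg 30))).seq search)

theorem Good.solution (h : Good n A K s) :
    ∃ T : Finset ℕ, Solution n A T ∧ T.card ≤ K ∧ ∀ x, x ∈ T ↔ x < n ∧ s.arr 1 x 0 ≠ 0 := by
  classical
  obtain ⟨⟨x, hx, hx'⟩, h2, h3⟩ := h
  refine ⟨(Finset.range n).filter fun x => s.arr 1 x 0 ≠ 0, ⟨⟨x, by simp [hx, hx']⟩,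
    fun x hx => by simp at hx; exact hx.1, ?_⟩, h2, fun x => by simp⟩
  convert h3 using 1
  ext x
  simp

/-- The invariant of the main loop. -/
structure MainInv (n : ℕ) (A : ℕ → ℕ → Prop) (k i : ℕ) (s : State) : Prop where
  ctx : Ctx n A s
  bound : s.reg 1 = k
  found : s.reg 5 ≠ 0 → ∃ K ≤ k, Good n A K s ∧ ∀ T, Solution n A T → K ≤ T.card
  missed : s.reg 5 = 0 → ∀ T, Solution n A T → min i k < T.card

theorem MainInv.setReg {k i : ℕ} (h : MainInv n A k i s) (v : ℕ) :
    MainInv n A k i (s.setReg 30 v) :=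
  ⟨h.ctx.setReg (by decide), h.bound, h.found, h.missed⟩

theorem MainInv.step (hA : IsGraph n A) {k i : ℕ} (h : MainInv n A k i s) (hi : i < n) :
    MainInv n A k (i + 1) (mainBody.run (s.setReg 30 i)) := by
  -- The candidate size is `i + 1`, so it exceeds the bound exactly when `k ≤ i`.
  have hc : (or (reg 5) (le (reg 1) (reg 30))).Holds (s.setReg 30 i) ↔ s.reg 5 ≠ 0 ∨ k ≤ i := by
    rw [holds_or, holds_reg, holds_le, ← h.bound]
    rfl
  rw [mainBody, run_ite, hc]
  by_cases h5 : s.reg 5 = 0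
  · by_cases hk : k ≤ i
    · rw [if_pos (.inr hk)]
      refine ⟨h.ctx.setReg (by decide), h.bound, h.found, fun h5' T hT => ?_⟩
      have := h.missed h5' T hT
      omega
    · rw [if_neg (by simp [h5, hk])]
      set s1 := (Cmd.set 2 (succ (reg 30))).run (s.setReg 30 i) with hs1
      have g1 : Ctx n A s1 := (h.ctx.setReg (by decide)).run (by decide) (by decide)
      have g2 : s1.reg 2 = i + 1 := rfl
      have g5 : s1.reg 5 = 0 := h5
      have hb : s1.reg 1 = k := h.bound
      obtain ⟨k1, k2⟩ := search_spec hA (K := i + 1) (by omega) g1 g2 fun h' => absurd g5 h'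
      -- All smaller sizes have failed, which makes `i + 1` minimal if it is attained.
      have hmin : ∀ T, Solution n A T → i + 1 ≤ T.card := fun T hT => by
        have := h.missed h5 T hT
        omega
      have hrun : ((Cmd.set 2 (succ (reg 30))).seq search).run (s.setReg 30 i) = search.run s1 :=
          rfl
      rw [hrun]
      refine ⟨k1.ctx, ?_, fun h' => ⟨i + 1, by omega, k1.good h', hmin⟩, fun h' T hT => ?_⟩
      · rw [run_search, run_reg (by decide), run_reg (by decide)]; exact hb
      · have h3 := hmin T hT
        have h4 : T.card ≠ i + 1 := fun hcard => k2 ⟨T, hT, hcard, hmin⟩ h'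
        omega
  · rw [if_pos (.inl h5)]
    exact ⟨h.ctx.setReg (by decide), h.bound, h.found, fun h5' => absurd h5' h5⟩

theorem main_spec (hA : IsGraph n A) {k : ℕ} (h : Ctx n A s) (h1 : s.reg 1 = k) (h5 : s.reg 5 = 0) :
    MainInv n A k n (main.run s) := by
  have := loop_induction (x := 30) (y := 0) (P := MainInv n A k) (s := s) (c := mainBody)
    ⟨h, h1, fun h' => absurd h5 h', fun _ T hT => by
      have := Finset.card_pos.2 hT.nonempty
      omega⟩ (fun i hi s' h' => h'.step hA (by rwa [← h.reg])) (fun i s' v h' => h'.setReg v)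
  rwa [h.reg] at this

end

end SafeSet

/-! ### Running time -/

namespace SafeSet

open Cmd Exp

namespace Cmd

/-- Loops are over the registers `0`, `3` and `4` only, and these are not overwritten. -/
def plain : Cmd → Bool
  | skip => true
  | set x _ => !([0, 3, 4].contains x)
  | put _ _ _ _ => true
  | seq c c' => c.plain && c'.plain
  | ite _ c c' => c.plain && c'.plain
  | loop x y c => !([0, 3, 4].contains x) && [0, 3, 4].contains y && c.plain

/-- The nesting depth of the loops over register `z`. -/
def depth (z : ℕ) : Cmd → ℕ
  | seq c c' => max (c.depth z) (c'.depth z)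
  | ite _ c c' => max (c.depth z) (c'.depth z)
  | loop _ y c => c.depth z + if y = z then 1 else 0
  | _ => 0

theorem notMem_wr_of_plain {c : Cmd} (h : c.plain) : ∀ x ∈ c.wr, x ∉ [0, 3, 4] := by
  induction c with
  | skip => simp [wr]
  | set x e => simpa [wr, plain] using h
  | put => simp [wr]
  | seq c c' ih ih' =>
    simp only [plain, Bool.and_eq_true] at h
    intro x hx
    rcases List.mem_append.1 hx with hx | hx
    exacts [ih h.1 x hx, ih' h.2 x hx]
  | ite e c c' ih ih' =>
    simp only [plain, Bool.and_eq_true] at h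
    intro x hx
    rcases List.mem_append.1 hx with hx | hx
    exacts [ih h.1 x hx, ih' h.2 x hx]
  | loop x y c ih =>
    simp only [plain, Bool.and_eq_true] at h
    exact ih h.2

/-- An invariant bounds the running time of a loop. -/
theorem time_loop_le {P : ℕ → State → Prop} {x y : ℕ} {c : Cmd} {s : State} {B : ℕ} (h0 : P 0 s)
    (hs : ∀ i < s.reg y, ∀ s', P i s' → P (i + 1) (c.run (s'.setReg x i)))
    (hB : ∀ i < s.reg y, ∀ s', P i s' → c.time (s'.setReg x i) ≤ B) :
    (loop x y c).time s ≤ s.reg y * (B + 3) + 5 := by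
  rw [time]
  refine Nat.add_le_add_right (le_trans (Finset.sum_le_card_nsmul _ _ (B + 3) fun i hi => ?_) ?_) 5
  · rw [Finset.mem_range] at hi
    exact Nat.add_le_add_right (hB i hi _ (iter_induction h0 fun j hj => hs j (by omega))) 3
  · simp

/-- Loop bounds never change, so each nested loop over register `3` or `4` costs one factor of its
content, and loops over register `0` only enlarge the polynomial. The contents are at least `1`, so
both exponents may be raised to their maximum. -/
theorem time_le {c : Cmd} (h : c.plain) : ∃ p : Polynomial ℕ, ∀ s : State, 1 ≤ s.reg 3 →
    1 ≤ s.reg 4 → c.time s ≤ s.reg 4 ^ c.depth 4 * s.reg 3 ^ c.depth 3 * p.eval (s.reg 0) := by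
  have hmono : ∀ {a b a' b' r3 r4 x y : ℕ}, 1 ≤ r3 → 1 ≤ r4 → a ≤ a' → b ≤ b' → x ≤ y →
      r4 ^ a * r3 ^ b * x ≤ r4 ^ a' * r3 ^ b' * y := fun h3 h4 ha hb hx =>
    Nat.mul_le_mul (Nat.mul_le_mul (Nat.pow_le_pow_right h4 ha) (Nat.pow_le_pow_right h3 hb)) hx
  induction c with
  | skip => exact ⟨1, fun s _ _ => by simp [time, depth]⟩
  | set x e => exact ⟨e.cost + 1, fun s _ _ => by simp [time, depth]⟩
  | put a e f g => exact ⟨e.cost + f.cost + g.cost + 1, fun s _ _ => by simp [time, depth]⟩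
  | seq c c' ih ih' =>
    simp only [plain, Bool.and_eq_true] at h
    obtain ⟨p, hp⟩ := ih h.1
    obtain ⟨q, hq⟩ := ih' h.2
    refine ⟨p + q, fun s h3 h4 => ?_⟩
    have hw := notMem_wr_of_plain h.1
    have e0 : (c.run s).reg 0 = s.reg 0 := run_reg (fun h => hw 0 h (by simp)) s
    have e3 : (c.run s).reg 3 = s.reg 3 := run_reg (fun h => hw 3 h (by simp)) s
    have e4 : (c.run s).reg 4 = s.reg 4 := run_reg (fun h => hw 4 h (by simp)) s
    have h1 := hp s h3 h4
    have h2 := hq (c.run s) (by rwa [e3]) (by rwa [e4])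
    rw [e0, e3, e4] at h2
    rw [time, Polynomial.eval_add, mul_add]
    exact add_le_add (h1.trans (hmono h3 h4 (le_max_left _ _) (le_max_left _ _) le_rfl))
      (h2.trans (hmono h3 h4 (le_max_right _ _) (le_max_right _ _) le_rfl))
  | ite e c c' ih ih' =>
    simp only [plain, Bool.and_eq_true] at h
    obtain ⟨p, hp⟩ := ih h.1
    obtain ⟨q, hq⟩ := ih' h.2
    refine ⟨e.cost + 2 + (p + q), fun s h3 h4 => ?_⟩
    rw [time, Polynomial.eval_add, mul_add]
    refine add_le_add ?_ ?_
    · have := hmono h3 h4 (Nat.zero_le ((Cmd.ite e c c').depth 4))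
        (Nat.zero_le ((Cmd.ite e c c').depth 3)) (le_refl ((e.cost + 2).eval (s.reg 0)))
      simpa using this
    · split_ifs
      · exact (hp s h3 h4).trans (hmono h3 h4 (le_max_left _ _) (le_max_left _ _) (by simp))
      · exact (hq s h3 h4).trans (hmono h3 h4 (le_max_right _ _) (le_max_right _ _) (by simp))
  | loop x y c ih =>
    simp only [plain, Bool.and_eq_true] at h
    obtain ⟨⟨hx, hy⟩, hc⟩ := h
    obtain ⟨p, hp⟩ := ih hc
    simp only [List.contains_cons, List.contains_nil, Bool.or_false, Bool.not_or, Bool.and_eq_true,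
      Bool.not_eq_true', beq_eq_false_iff_ne, Bool.or_eq_true, beq_iff_eq] at hx hy
    obtain ⟨x0, x3, x4⟩ := hx
    -- One choice serves all three loop registers: the factor `X + 1` pays for the iterations if the
    -- bound is register `0` and is at least `1` otherwise. The constants `3` and `5` are the
    -- overhead per iteration and per loop.
    refine ⟨(p + 3) * (Polynomial.X + 1) + 5, fun s h3 h4 => ?_⟩
    have hw := notMem_wr_of_plain hc
    have key := time_loop_le (x := x) (y := y) (c := c) (s := s)
      (B := s.reg 4 ^ c.depth 4 * s.reg 3 ^ c.depth 3 * p.eval (s.reg 0))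
      (P := fun _ s' => s'.reg 0 = s.reg 0 ∧ s'.reg 3 = s.reg 3 ∧ s'.reg 4 = s.reg 4) ⟨rfl, rfl,
          rfl⟩
      (fun i _ s' ⟨g0, g3, g4⟩ => by
        refine ⟨(run_reg (fun h => hw 0 h (by simp)) _).trans ?_,
          (run_reg (fun h => hw 3 h (by simp)) _).trans ?_,
          (run_reg (fun h => hw 4 h (by simp)) _).trans ?_⟩
        · rw [State.setReg_reg, if_neg (Ne.symm x0), g0]
        · rw [State.setReg_reg, if_neg (Ne.symm x3), g3]
        · rw [State.setReg_reg, if_neg (Ne.symm x4), g4])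
      (fun i _ s' ⟨g0, g3, g4⟩ => by
        have e0 : (s'.setReg x i).reg 0 = s.reg 0 := by
            rw [State.setReg_reg, if_neg (Ne.symm x0), g0]
        have e3 : (s'.setReg x i).reg 3 = s.reg 3 := by
            rw [State.setReg_reg, if_neg (Ne.symm x3), g3]
        have e4 : (s'.setReg x i).reg 4 = s.reg 4 := by
            rw [State.setReg_reg, if_neg (Ne.symm x4), g4]
        have := hp (s'.setReg x i) (by rwa [e3]) (by rwa [e4])
        rwa [e0, e3, e4] at this)
    set M := s.reg 4 ^ c.depth 4 * s.reg 3 ^ c.depth 3 with hM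
    have hM1 : 1 ≤ M := Nat.mul_pos (pow_pos h4 _) (pow_pos h3 _)
    set r := p.eval (s.reg 0) with hr
    have hev : ((p + 3) * (Polynomial.X + 1) + 5).eval (s.reg 0) = (r + 3) * (s.reg 0 + 1) + 5 := by
      simp [hr]
    have hF : s.reg 4 ^ (loop x y c).depth 4 * s.reg 3 ^ (loop x y c).depth 3 * (s.reg 0 + 1) ≥
        M * s.reg y ∧ M ≤ s.reg 4 ^ (loop x y c).depth 4 * s.reg 3 ^ (loop x y c).depth 3 := by
      simp only [depth]
      rcases hy with rfl | rfl | rfl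
      · simp only [show (0 : ℕ) ≠ 4 by decide, show (0 : ℕ) ≠ 3 by decide, if_false, add_zero, ← hM]
        exact ⟨Nat.mul_le_mul_left _ (Nat.le_succ _), le_rfl⟩
      · simp only [show (3 : ℕ) ≠ 4 by decide, if_true, if_false, add_zero, pow_succ, ← mul_assoc,
          ← hM]
        exact ⟨Nat.le_mul_of_pos_right _ (by omega), Nat.le_mul_of_pos_right _ h3⟩
      · simp only [show (4 : ℕ) ≠ 3 by decide, if_true, if_false, add_zero, pow_succ]
        rw [mul_right_comm (s.reg 4 ^ c.depth 4), ← hM]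
        exact ⟨Nat.le_mul_of_pos_right _ (by omega), Nat.le_mul_of_pos_right _ h4⟩
    obtain ⟨hF1, hF2⟩ := hF
    set F := s.reg 4 ^ (loop x y c).depth 4 * s.reg 3 ^ (loop x y c).depth 3 with hFdef
    rw [hev]
    calc (loop x y c).time s ≤ s.reg y * (M * r + 3) + 5 := key
      _ ≤ s.reg y * (M * r + M * 3) + M * 5 := by gcongr <;> omega
      _ = (M * s.reg y) * (r + 3) + M * 5 := by ring
      _ ≤ (F * (s.reg 0 + 1)) * (r + 3) + F * 5 := by gcongr
      _ = F * ((r + 3) * (s.reg 0 + 1) + 5) := by ring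

/-- The command writes its own loop bounds, so `time_le` does not apply. Each multiplication costs
about the final power times the base. The assumption that the base is at most `reg 0 + 2` makes the
latter a polynomial factor; it covers both `K + 1` and `2`. -/
theorem time_pow_le {s : State} {dst base : ℕ} (h1 : dst ∉ [0, 2, 13, 40, 41, 42])
    (h2 : base ∉ [dst, 13, 40, 41, 42]) (hb : 1 ≤ s.reg base) (hb' : s.reg base ≤ s.reg 0 + 2) :
    (pow dst base).time s ≤ s.reg base ^ s.reg 2 *
      ((Polynomial.X * (6 * Polynomial.X + 50) + 10 : Polynomial ℕ).eval (s.reg 0)) := by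
  have h1' := h1
  have h2' := h2
  simp only [List.mem_cons, List.not_mem_nil, or_false, not_or] at h1' h2'
  obtain ⟨d0, d2, d13, d40, d41, d42⟩ := h1'
  obtain ⟨bd, b13, b40, b41, b42⟩ := h2'
  have hinner : ∀ s : State, (loop 42 base (set 13 (succ (reg 13)))).time s ≤ s.reg base * 6 + 5 :=
    fun s => time_loop_le (P := fun _ _ => True) (B := 3) trivial (fun _ _ _ _ => trivial)
      (fun _ _ _ _ => by simp [time, cost])
  have hmid : ∀ s : State, (loop 41 dst (loop 42 base (set 13 (succ (reg 13))))).time s ≤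
      s.reg dst * (s.reg base * 6 + 8) + 5 := fun s => by
    refine time_loop_le (P := fun _ s' => s'.reg base = s.reg base) rfl
      (fun i _ s' h => ?_) (fun i _ s' h => ?_)
    · rw [run_reg (by simpa [wr] using b13), State.setReg_reg, if_neg b41, h]
    · refine (hinner _).trans ?_
      rw [State.setReg_reg, if_neg b41, h]
  have hbody : ∀ s : State, (powBody dst base).time s ≤ 20 + s.reg dst * (s.reg base * 6 + 8) := by
    intro s
    rw [powBody, time]
    have e1 : ((lt (reg 40) (reg 2)).cost).eval (s.reg 0) = 4 := by simp [cost]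
    rw [e1]
    split_ifs
    · have h3 := hmid (s.setReg 13 0)
      rw [State.setReg_reg, State.setReg_reg, if_neg d13, if_neg b13] at h3
      have h4 : (set 13 (num 0)).time s = 2 := by simp [time, cost]
      have h5 : ∀ s, (set dst (reg 13)).time s = 2 := fun s => by simp [time, cost]
      rw [time.eq_4, time.eq_4, h4, h5]
      have h6 : (set 13 (num 0)).run s = s.setReg 13 0 := rfl
      rw [h6]
      omega
    · rw [time]
      omega
  have key := time_loop_le (x := 40) (y := 0) (c := powBody dst base) (s := s.setReg dst 1)
    (B := 20 + s.reg base ^ s.reg 2 * (s.reg base * 6 + 8))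
    (P := PowInv dst base (s.reg base) (s.reg 2)) (powInv_zero d2 bd)
    (fun i _ s' h => h.step h1 h2)
    (fun i _ s' h => by
      refine (hbody _).trans ?_
      rw [State.setReg_reg, if_neg d40, State.setReg_reg, if_neg b40, h.2.2, h.2.1]
      gcongr
      exact min_le_right _ _)
  rw [State.setReg_reg, if_neg (Ne.symm d0)] at key
  have hM : 1 ≤ s.reg base ^ s.reg 2 := Nat.one_le_pow _ _ hb
  have e1 : (pow dst base).time s = 2 + (loop 40 0 (powBody dst base)).time (s.setReg dst 1) := by
    rw [pow, time]
    simp [time, cost, run, Exp.eval]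
  rw [e1]
  set M := s.reg base ^ s.reg 2
  set b := s.reg base
  set n := s.reg 0
  have e2 : (Polynomial.X * (6 * Polynomial.X + 50) + 10 : Polynomial ℕ).eval n =
      n * (6 * n + 50) + 10 := by simp
  rw [e2]
  calc 2 + (loop 40 0 (powBody dst base)).time (s.setReg dst 1)
      ≤ 2 + (n * (20 + M * (b * 6 + 8) + 3) + 5) := by omega
    _ = n * (23 + M * (b * 6 + 8)) + 7 := by ring
    _ ≤ n * (M * 23 + M * ((n + 2) * 6 + 8)) + M * 10 := by gcongr <;> omega
    _ ≤ n * (M * 30 + M * ((n + 2) * 6 + 8)) + M * 10 := by gcongr; omega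
    _ = M * (n * (6 * n + 50) + 10) := by ring

theorem time_prepare_le : ∃ p : Polynomial ℕ, ∀ s : State, s.reg 2 ≤ s.reg 0 →
    prepare.time s ≤ 2 ^ s.reg 2 * (s.reg 2 + 1) ^ (3 * s.reg 2) * p.eval (s.reg 0) := by
  refine ⟨2 * (Polynomial.X * (6 * Polynomial.X + 50) + 10) + 5, fun s h => ?_⟩
  set s1 := (Cmd.set 14 (succ (reg 2))).run s with hs1
  set s2 := (pow 3 14).run s1 with hs2
  set s3 := (Cmd.set 15 (num 2)).run s2 with hs3
  have e14 : s1.reg 14 = s.reg 2 + 1 := rfl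
  have e10 : s1.reg 0 = s.reg 0 := rfl
  have e12 : s1.reg 2 = s.reg 2 := rfl
  have e30 : s3.reg 0 = s.reg 0 := by rw [hs3, run_reg (by decide), hs2, run_reg (by decide), e10]
  have e32 : s3.reg 2 = s.reg 2 := by rw [hs3, run_reg (by decide), hs2, run_reg (by decide), e12]
  have e315 : s3.reg 15 = 2 := rfl
  have t1 := time_pow_le (s := s1) (dst := 3) (base := 14) (by decide) (by decide) (by omega)
    (by omega)
  have t2 := time_pow_le (s := s3) (dst := 4) (base := 15) (by decide) (by decide) (by omega)
    (by omega)
  rw [e14, e10, e12] at t1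
  rw [e315, e30, e32] at t2
  have t3 : (Cmd.set 14 (succ (reg 2))).time s = 3 := by simp [time, cost]
  have t4 : (Cmd.set 15 (num 2)).time s2 = 2 := by simp [time, cost]
  have hrun : prepare.time s = (Cmd.set 14 (succ (reg 2))).time s + ((pow 3 14).time s1 +
    ((Cmd.set 15 (num 2)).time s2 + (pow 4 15).time s3)) := rfl
  rw [hrun, t3, t4, Polynomial.eval_add, Polynomial.eval_mul]
  set P := (Polynomial.X * (6 * Polynomial.X + 50) + 10 : Polynomial ℕ).eval (s.reg 0)
  set K := s.reg 2
  have h5 : (5 : Polynomial ℕ).eval (s.reg 0) = 5 := by simp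
  have h2 : (2 : Polynomial ℕ).eval (s.reg 0) = 2 := by simp
  rw [h5, h2]
  have hX : 1 ≤ 2 ^ K := Nat.one_le_two_pow
  have hY : 1 ≤ (K + 1) ^ K := Nat.one_le_pow _ _ (by omega)
  have hZ : (K + 1) ^ K ≤ (K + 1) ^ (3 * K) := Nat.pow_le_pow_right (by omega) (by omega)
  set M := 2 ^ K * (K + 1) ^ (3 * K) with hM
  have hM1 : 2 ^ K ≤ M := Nat.le_mul_of_pos_right _ (by omega)
  have hM2 : (K + 1) ^ K ≤ M := hZ.trans (Nat.le_mul_of_pos_left _ hX)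
  calc 3 + ((pow 3 14).time s1 + (2 + (pow 4 15).time s3))
      ≤ 3 + ((K + 1) ^ K * P + (2 + 2 ^ K * P)) := by omega
    _ ≤ M * 3 + (M * P + (M * 2 + M * P)) := by gcongr <;> omega
    _ = M * (2 * P + 5) := by ring

/-- The nested enumerations have depth `3` over `(K + 1) ^ K` and depth `1` over `2 ^ K`, which
gives the exponents. -/
theorem time_search_le : ∃ p : Polynomial ℕ, ∀ (n : ℕ) (A : ℕ → ℕ → Prop) (s : State),
    Ctx n A s → s.reg 2 ≤ n → s.reg 5 = 0 →
    search.time s ≤ 2 ^ s.reg 2 * (s.reg 2 + 1) ^ (3 * s.reg 2) * p.eval n := by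
  obtain ⟨p, hp⟩ := time_prepare_le
  obtain ⟨q, hq⟩ := time_le (c := branchLoop) (by decide)
  have d4 : branchLoop.depth 4 = 1 := by decide
  have d3 : branchLoop.depth 3 = 3 := by decide
  refine ⟨p + q, fun n A s h h2 h5 => ?_⟩
  have hset := prepare_spec h2 h rfl fun h' => absurd h5 h'
  have t1 := hp s (by rwa [h.reg])
  have t2 := hq (prepare.run s) (by rw [hset.strings]; exact Nat.one_le_pow _ _ (by omega))
    (by rw [hset.pow]; exact Nat.one_le_two_pow)
  rw [hset.strings, hset.pow, hset.ctx.reg, d3, d4, pow_one, ← pow_mul, mul_comm _ 3] at t2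
  rw [h.reg] at t1
  have hrun : search.time s = prepare.time s + branchLoop.time (prepare.run s) := by
    simp only [search, prepare, branchLoop, ptrLoop, timeLoop, time, run, add_assoc]
  rw [hrun, Polynomial.eval_add, mul_add]
  exact add_le_add t1 t2

end Cmd

/-- From `(1 + 1 / K) ^ K ≤ e < 3`, cubed. -/
theorem add_one_pow_le {K : ℕ} (hK : 1 ≤ K) : (K + 1) ^ (3 * K) ≤ 27 * K ^ (3 * K) := by
  have h : (K + 1) ^ K ≤ 3 * K ^ K := by
    have hK' : (0 : ℝ) < K := by exact_mod_cast hK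
    have h1 : ((1 : ℝ) / K + 1) ^ K ≤ Real.exp 1 := by
      calc ((1 : ℝ) / K + 1) ^ K ≤ Real.exp (1 / K) ^ K :=
            pow_le_pow_left₀ (by positivity) (Real.add_one_le_exp _) K
        _ = Real.exp 1 := by
          rw [← Real.exp_nat_mul, mul_one_div_cancel hK'.ne']
    have h2 : ((K : ℝ) + 1) ^ K ≤ 3 * (K : ℝ) ^ K := by
      calc ((K : ℝ) + 1) ^ K = (((1 : ℝ) / K + 1) * K) ^ K := by
            congr 1; field_simp; ring
        _ = ((1 : ℝ) / K + 1) ^ K * K ^ K := mul_pow _ _ _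
        _ ≤ 3 * (K : ℝ) ^ K := by
          gcongr
          exact h1.trans Real.exp_one_lt_three.le
    exact_mod_cast h2
  calc (K + 1) ^ (3 * K) = ((K + 1) ^ K) ^ 3 := by rw [← pow_mul, mul_comm]
    _ ≤ (3 * K ^ K) ^ 3 := Nat.pow_le_pow_left h 3
    _ = 27 * K ^ (3 * K) := by rw [mul_pow, ← pow_mul, mul_comm K 3]; norm_num

theorem bound_mono {K M : ℕ} (hK : 1 ≤ K) (h : K ≤ M) :
    2 ^ K * K ^ (3 * K) ≤ 2 ^ M * M ^ (3 * M) :=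
  Nat.mul_le_mul (Nat.pow_le_pow_right (by omega) h)
    ((Nat.pow_le_pow_left h _).trans (Nat.pow_le_pow_right (by omega) (by omega)))

/-- For `M = 0` this relies on `0 ^ 0 = 1`; it lets the bound absorb additive constants. -/
theorem bound_pos (M : ℕ) : 1 ≤ 2 ^ M * M ^ (3 * M) := by
  rcases Nat.eq_zero_or_pos M with rfl | h
  · simp
  · exact Nat.mul_pos Nat.one_le_two_pow (Nat.one_le_pow _ _ h)

/-- The running time of the main program, if the numbers `K` for which a search is carried out are
    at
most `M`. -/
theorem time_main_le : ∃ p : Polynomial ℕ, ∀ (n : ℕ) (A : ℕ → ℕ → Prop) (s : State) (k M : ℕ),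
    IsGraph n A → Ctx n A s → s.reg 1 = k → s.reg 5 = 0 →
    (∀ K ≤ k, (∀ T, Solution n A T → K ≤ T.card) → K ≤ M) →
    Cmd.main.time s ≤ 2 ^ M * M ^ (3 * M) * p.eval n := by
  obtain ⟨p, hp⟩ := time_search_le
  refine ⟨Polynomial.X * ((or (reg 5) (le (reg 1) (reg 30))).cost + 27 * p + 9) + 5,
    fun n A s k M hA h h1 h5 hM => ?_⟩
  have h6 := bound_pos M
  set B := 2 ^ M * M ^ (3 * M) with hB
  set q := (or (reg 5) (le (reg 1) (reg 30))).cost.eval n with hq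
  have key := time_loop_le (x := 30) (y := 0) (c := mainBody) (s := s) (P := MainInv n A k)
    (B := q + B * (27 * p.eval n) + 6) ⟨h, h1, fun h' => absurd h5 h', fun _ T hT => by
      have := Finset.card_pos.2 hT.nonempty
      omega⟩ (fun i hi s' h' => h'.step hA (by rwa [← h.reg])) (fun i hi s' h' => by
    have hc : (or (reg 5) (le (reg 1) (reg 30))).Holds (s'.setReg 30 i) ↔ s'.reg 5 ≠ 0 ∨ k ≤ i := by
      rw [holds_or, holds_reg, holds_le, ← h'.bound]
      rfl
    have hctx : Ctx n A (s'.setReg 30 i) := h'.ctx.setReg (by decide)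
    have htime : mainBody.time (s'.setReg 30 i) = q + 2 +
        if (or (reg 5) (le (reg 1) (reg 30))).eval (s'.setReg 30 i) ≠ 0 then 1 else
        ((Cmd.set 2 (succ (reg 30))).seq search).time (s'.setReg 30 i) := by
      rw [mainBody, Cmd.time.eq_5, hctx.reg, Cmd.time.eq_1]
    rw [htime]
    split_ifs with hif
    · omega
    · have hif' := mt hc.2 hif
      push Not at hif'
      set s1 := (Cmd.set 2 (succ (reg 30))).run (s'.setReg 30 i) with hs1
      have g1 : Ctx n A s1 := hctx.run (by decide) (by decide)
      have g2 : s1.reg 2 = i + 1 := rfl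
      have g5 : s1.reg 5 = 0 := hif'.1
      have t1 : (Cmd.set 2 (succ (reg 30))).time (s'.setReg 30 i) = 3 := by
        simp [Cmd.time, cost]
      have t2 := hp n A s1 g1 (by rw [g2]; rw [h.reg] at hi; omega) g5
      rw [g2] at t2
      have t4 : ((Cmd.set 2 (succ (reg 30))).seq search).time (s'.setReg 30 i) =
          3 + search.time s1 := by rw [Cmd.time.eq_4, t1]
      rw [t4]
      -- A search for `i + 1` takes place only if all smaller sizes have failed, so no solution has
      -- fewer vertices and the hypothesis on `M` applies.
      have hiM : i + 1 ≤ M := hM (i + 1) (by omega) fun T hT => by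
        have := h'.missed hif'.1 T hT
        omega
      have t3 : 2 ^ (i + 1) * (i + 1 + 1) ^ (3 * (i + 1)) * p.eval n ≤ B * (27 * p.eval n) := by
        calc 2 ^ (i + 1) * (i + 1 + 1) ^ (3 * (i + 1)) * p.eval n
            ≤ 2 ^ (i + 1) * (27 * (i + 1) ^ (3 * (i + 1))) * p.eval n := by
              gcongr; exact add_one_pow_le (by omega)
          _ = 2 ^ (i + 1) * (i + 1) ^ (3 * (i + 1)) * (27 * p.eval n) := by ring
          _ ≤ B * (27 * p.eval n) := Nat.mul_le_mul_right _ (bound_mono (by omega) hiM)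
      omega)
  rw [h.reg] at key
  have hev : (Polynomial.X * ((or (reg 5) (le (reg 1) (reg 30))).cost + 27 * p + 9) + 5 :
      Polynomial ℕ).eval n = n * (q + 27 * p.eval n + 9) + 5 := by simp [hq]
  rw [hev]
  calc Cmd.main.time s ≤ n * (q + B * (27 * p.eval n) + 6 + 3) + 5 := key
    _ = n * (q + B * (27 * p.eval n) + 9) + 5 := by ring
    _ ≤ n * (B * q + B * (27 * p.eval n) + B * 9) + B * 5 := by
      gcongr
      · exact Nat.le_mul_of_pos_left _ h6
      · omega
      · omega
    _ = B * (n * (q + 27 * p.eval n + 9) + 5) := by ring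

end SafeSet

/-! ### Safe sets of graphs and of relations on numbers -/

namespace SafeSet

section

variable {n : ℕ} {G : SimpleGraph (Fin n)}

/-- The adjacency relation as a relation on numbers. -/
def natAdj (G : SimpleGraph (Fin n)) (i j : ℕ) : Prop :=
  ∃ u v : Fin n, (u : ℕ) = i ∧ (v : ℕ) = j ∧ G.Adj u v

theorem natAdj_val {u v : Fin n} : natAdj G u v ↔ G.Adj u v :=
  ⟨fun ⟨_, _, hu, hv, h⟩ => Fin.ext hu ▸ Fin.ext hv ▸ h, fun h => ⟨u, v, rfl, rfl, h⟩⟩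

theorem isGraph_natAdj : IsGraph n (natAdj G) :=
  ⟨fun ⟨u, _, hu, _, _⟩ => hu ▸ u.2, fun ⟨u, v, hu, hv, h⟩ => ⟨v, u, hv, hu, h.symm⟩⟩

/-- The hypothesis says that `U` is one of the two sides of `Y`. A walk that does not change sides
is then a walk in the induced graph. It is applied both to a set and to its complement. -/
theorem ncard_supp_eq_csize {U : Set (Fin n)} {Y : Set ℕ}
    (hU : ∀ x y : Fin n, x ∈ U → (((x : ℕ) ∈ Y ↔ (y : ℕ) ∈ Y) ↔ y ∈ U)) (a : U) :
    ((G.induce U).connectedComponentMk a).supp.ncard = csize n (natAdj G) Y (a : Fin n) := by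
  classical
  have hreach : ∀ b : U, (G.induce U).Reachable a b → Conn (natAdj G) Y (a : Fin n) (b : Fin n) :=
      by
    intro b h
    rw [SimpleGraph.reachable_iff_reflTransGen] at h
    induction h with
    | refl => exact .refl _
    | tail _ h ih => exact ih.trans (.single (natAdj_val.2 h) ((hU _ _ (Subtype.prop _)).2
        (Subtype.prop _)))
  have hconn : ∀ j : ℕ, Conn (natAdj G) Y (a : Fin n) j →
      ∃ b : U, ((b : Fin n) : ℕ) = j ∧ (G.induce U).Reachable a b := by
    intro j h
    induction h with
    | refl => exact ⟨a, rfl, .refl _⟩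
    | tail _ h ih =>
      obtain ⟨b, rfl, hb⟩ := ih
      obtain ⟨⟨u, v, hu, rfl, huv⟩, hside⟩ := h
      obtain rfl := Fin.ext hu
      have hv := (hU b v b.2).1 hside
      exact ⟨⟨v, hv⟩, rfl, hb.trans (SimpleGraph.Adj.reachable (G := G.induce U) (by
          simpa using huv))⟩
  have himg : (fun b : U => ((b : Fin n) : ℕ)) '' ((G.induce U).connectedComponentMk a).supp =
      ((Finset.range n).filter fun b => Conn (natAdj G) Y (a : Fin n) b : Finset ℕ) := by
    ext j
    simp only [Set.mem_image, SimpleGraph.ConnectedComponent.mem_supp_iff,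
      SimpleGraph.ConnectedComponent.eq, Finset.coe_filter, Finset.mem_range, Set.mem_ofPred_eq]
    constructor
    · rintro ⟨b, hb, rfl⟩
      exact ⟨(b : Fin n).2, hreach b hb.symm⟩
    · rintro ⟨-, h⟩
      obtain ⟨b, hb, h⟩ := hconn j h
      exact ⟨b, h.symm, hb⟩
  rw [← Set.ncard_image_of_injective _ (f := fun b : U => ((b : Fin n) : ℕ))
    (Fin.val_injective.comp Subtype.val_injective), himg, Set.ncard_coe_finset, csize]

theorem isSafeSet_iff {S : Set (Fin n)} {Y : Set ℕ} (hY : ∀ x : Fin n, (x : ℕ) ∈ Y ↔ x ∈ S) :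
    IsSafeSet G S ↔ S.Nonempty ∧ Safe n (natAdj G) Y := by
  have h1 : ∀ x y : Fin n, x ∈ S → (((x : ℕ) ∈ Y ↔ (y : ℕ) ∈ Y) ↔ y ∈ S) := fun x y hx => by
    rw [hY, hY]; tauto
  have h2 : ∀ x y : Fin n, x ∈ Sᶜ → (((x : ℕ) ∈ Y ↔ (y : ℕ) ∈ Y) ↔ y ∈ Sᶜ) := fun x y hx => by
    rw [hY, hY, Set.mem_compl_iff]; rw [Set.mem_compl_iff] at hx; tauto
  refine and_congr_right fun _ => ⟨fun h a ha b hb hab => ?_, fun h C D hCD => ?_⟩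
  · obtain ⟨u, v, rfl, rfl, huv⟩ := hab
    have hu := (hY u).1 ha
    have hv : v ∈ Sᶜ := fun h => hb ((hY v).2 h)
    have := h ((G.induce S).connectedComponentMk ⟨u, hu⟩) ((G.induce Sᶜ).connectedComponentMk ⟨v,
        hv⟩)
      ⟨⟨u, hu⟩, rfl, ⟨v, hv⟩, rfl, huv⟩
    rw [ncard_supp_eq_csize h1, ncard_supp_eq_csize h2] at this
    exact not_lt.1 this
  · obtain ⟨a, ha, b, hb, hab⟩ := hCD
    rw [SimpleGraph.ConnectedComponent.mem_supp_iff] at ha hb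
    subst ha hb
    rw [ncard_supp_eq_csize h1, ncard_supp_eq_csize h2, not_lt]
    exact h _ ((hY _).2 a.2) _ (fun h => b.2 ((hY _).1 h)) (natAdj_val.2 hab)

theorem IsSafeSet.exists_solution {S : Set (Fin n)} (h : IsSafeSet G S) :
    ∃ T, Solution n (natAdj G) T ∧ T.card = S.ncard := by
  classical
  have hS := S.toFinite
  refine ⟨hS.toFinset.map Fin.valEmbedding, ?_, ?_⟩
  · have hn : ∀ x ∈ (hS.toFinset.map Fin.valEmbedding : Finset ℕ), x < n := by
      intro x hx
      obtain ⟨y, -, rfl⟩ := Finset.mem_map.1 hx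
      exact y.2
    obtain ⟨⟨x, hx⟩, h2⟩ := (isSafeSet_iff (Y := (hS.toFinset.map Fin.valEmbedding : Finset ℕ))
      (fun x => by simp [Fin.val_inj])).1 h
    exact ⟨⟨x, by simpa using ⟨x, hx, rfl⟩⟩, hn, h2⟩
  · rw [Finset.card_map, Set.ncard_eq_toFinset_card S hS]

theorem Solution.isSafeSet {T : Finset ℕ} (h : Solution n (natAdj G) T) :
    IsSafeSet G {v : Fin n | (v : ℕ) ∈ T} ∧ {v : Fin n | (v : ℕ) ∈ T}.ncard = T.card := by
  refine ⟨(isSafeSet_iff (Y := T) (fun x => by simp)).2 ⟨?_, h.safe⟩, ?_⟩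
  · obtain ⟨x, hx⟩ := h.nonempty
    exact ⟨⟨x, h.lt x hx⟩, hx⟩
  · rw [← Set.ncard_image_of_injective _ Fin.val_injective, ← Set.ncard_coe_finset]
    congr 1
    ext x
    simp only [Set.mem_image, Set.mem_ofPred_eq, Finset.mem_coe]
    exact ⟨fun ⟨v, hv, hvx⟩ => hvx ▸ hv, fun hx => ⟨⟨x, h.lt x hx⟩, hx, rfl⟩⟩

theorem Solution.card_le {A : ℕ → ℕ → Prop} {T : Finset ℕ} (h : Solution n A T) : T.card ≤ n :=
    card_le_of_forall_lt h.lt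

theorem ctx_inputState (k : ℕ) : Ctx n (natAdj G) (inputState G k) := by
  refine ⟨rfl, fun i _ j _ => ?_⟩
  simp [inputState, natAdj]

theorem Good.outputSet {K : ℕ} {s s' : State} (h : Good n (natAdj G) K s) (hs : s'.arr = s.arr) :
    IsSafeSet G (outputSet n s') ∧ (outputSet n s').ncard ≤ K := by
  obtain ⟨T, h1, h2, h3⟩ := h.solution
  have : SafeSet.outputSet n s' = {v : Fin n | (v : ℕ) ∈ T} := by
    ext v
    rw [Set.mem_ofPred_eq, h3, SafeSet.outputSet, Set.mem_ofPred_eq, hs]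
    exact (and_iff_right v.2).symm
  rw [this]
  exact ⟨h1.isSafeSet.1, h1.isSafeSet.2.trans_le h2⟩

end

/-! ### The decision program and the optimization program -/

theorem exists_decision_program :
    ∃ (P : Prog) (p : Polynomial ℕ), ∀ (n : ℕ) (G : SimpleGraph (Fin n)) (k : ℕ),
      ∃ (s : State) (t : ℕ), Exec P (inputState G k) s t ∧
        t ≤ 2 ^ k * k ^ (3 * k) * p.eval n ∧
        (s.reg 0 ≠ 0 ↔ ∃ S : Set (Fin n), IsSafeSet G S ∧ S.ncard ≤ k) ∧
        (s.reg 0 ≠ 0 → IsSafeSet G (outputSet n s) ∧ (outputSet n s).ncard ≤ k) := by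
  obtain ⟨p, hp⟩ := time_main_le
  -- The answer is moved to register `0` only at the very end, because register `0` must hold `n`
  -- until then. The summand `1` in the polynomial pays for this move.
  refine ⟨.seq (Cmd.main.comp 50) (.copy 0 5), p + 1, fun n G k => ?_⟩
  obtain ⟨s, t, hex, ht, hag, harr⟩ := Cmd.exec Cmd.main_ok (by decide) (inputState G k)
  have hctx := ctx_inputState (G := G) k
  have hinv := main_spec isGraph_natAdj hctx (k := k) rfl rfl
  have htime := hp n _ _ k k isGraph_natAdj hctx rfl rfl fun K hK _ => hK
  have h5 := hag 5 (by decide)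
  have hreg : (s.setReg 0 (s.reg 5)).reg 0 = (Cmd.main.run (inputState G k)).reg 5 := by
    rw [State.setReg_reg, if_pos rfl, h5]
  have hout : (s.setReg 0 (s.reg 5)).reg 0 ≠ 0 →
      IsSafeSet G (outputSet n (s.setReg 0 (s.reg 5))) ∧
      (outputSet n (s.setReg 0 (s.reg 5))).ncard ≤ k := by
    rw [hreg]
    intro h
    obtain ⟨K, hK, hg, -⟩ := hinv.found h
    obtain ⟨h1, h2⟩ := hg.outputSet (s' := s.setReg 0 (s.reg 5)) harr
    exact ⟨h1, h2.trans hK⟩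
  refine ⟨_, _, .seq hex (.copy s 0 5), ?_, ⟨fun h => ⟨_, hout h⟩, ?_⟩, hout⟩
  · rw [Polynomial.eval_add, mul_add]
    refine add_le_add (ht.trans htime) ?_
    simpa using bound_pos k
  · rintro ⟨S, hS, hcard⟩
    rw [hreg]
    intro h
    obtain ⟨T, hT, hTS⟩ := hS.exists_solution
    have := hinv.missed h T hT
    have := hT.card_le
    omega

theorem exists_optimization_program :
    ∃ (P : Prog) (p : Polynomial ℕ), ∀ (n : ℕ) (G : SimpleGraph (Fin n)), 0 < n →
      ∃ (s : State) (t : ℕ), Exec P (inputState G 0) s t ∧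
        t ≤ 2 ^ safeNumber G * safeNumber G ^ (3 * safeNumber G) * p.eval n ∧
        IsSafeSet G (outputSet n s) ∧ (outputSet n s).ncard = safeNumber G := by
  obtain ⟨p, hp⟩ := time_main_le
  -- The bound is set to `n`, which excludes nothing, as the set of all vertices is safe.
  refine ⟨.seq (.copy 1 0) (Cmd.main.comp 50), p + 1, fun n G hn => ?_⟩
  set s0 := (inputState G 0).setReg 1 ((inputState G 0).reg 0) with hs0
  obtain ⟨s, t, hex, ht, hag, harr⟩ := Cmd.exec Cmd.main_ok (by decide) s0
  have hctx : Ctx n (natAdj G) s0 := (ctx_inputState (G := G) 0).setReg (by decide)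
  have hinv := main_spec isGraph_natAdj hctx (k := n) rfl rfl
  have hall : Solution n (natAdj G) (Finset.range n) :=
    ⟨⟨0, Finset.mem_range.2 hn⟩, fun x hx => Finset.mem_range.1 hx, fun a _ b hb hab =>
      absurd (Finset.mem_range.2 (isGraph_natAdj.lt' hab)) hb⟩
  have h5 : (Cmd.main.run s0).reg 5 ≠ 0 := by
    intro h
    have := hinv.missed h _ hall
    have := hall.card_le
    omega
  obtain ⟨K, -, hg, hmin⟩ := hinv.found h5
  obtain ⟨h1, h2⟩ := hg.outputSet (s' := s) harr
  have hle : ∀ S : Set (Fin n), IsSafeSet G S → K ≤ S.ncard := fun S hS => by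
    obtain ⟨T, hT, hTS⟩ := hS.exists_solution
    exact hTS ▸ hmin T hT
  have hcard : (outputSet n s).ncard = safeNumber G := by
    have hleast : IsLeast {m | ∃ S : Set (Fin n), IsSafeSet G S ∧ S.ncard = m}
        (outputSet n s).ncard := by
      refine ⟨⟨_, h1, rfl⟩, ?_⟩
      rintro m ⟨S, hS, rfl⟩
      exact h2.trans (hle S hS)
    exact hleast.csInf_eq.symm
  -- Sizes are tried only up to the minimum, so the time is bounded in terms of `safeNumber G`
  -- although the bound in register `1` is `n`.
  have htime := hp n _ s0 n (safeNumber G) isGraph_natAdj hctx rfl rfl fun K' _ hK' => by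
    obtain ⟨T, hT, hTS⟩ := h1.exists_solution
    rw [← hcard, ← hTS]
    exact hK' T hT
  refine ⟨s, _, .seq (.copy _ 1 0) hex, ?_, h1, hcard⟩
  rw [Polynomial.eval_add, mul_add, add_comm]
  refine add_le_add (ht.trans htime) ?_
  simpa using bound_pos (safeNumber G)

end SafeSet

theorem theorem5 :
    -- decision and search version: given `G` and `k`, find a safe set of size at most `k`
    (∃ (P : SafeSet.Prog) (p : Polynomial ℕ), ∀ (n : ℕ) (G : SimpleGraph (Fin n)) (k : ℕ),
      ∃ (s : SafeSet.State) (t : ℕ),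
        SafeSet.Exec P (SafeSet.inputState G k) s t ∧
        t ≤ 2 ^ k * k ^ (3 * k) * p.eval n ∧
        (s.reg 0 ≠ 0 ↔ ∃ S : Set (Fin n), SafeSet.IsSafeSet G S ∧ S.ncard ≤ k) ∧
        (s.reg 0 ≠ 0 → SafeSet.IsSafeSet G (SafeSet.outputSet n s) ∧
          (SafeSet.outputSet n s).ncard ≤ k)) ∧
    -- optimization version: given `G`, find a minimum safe set; here `k` is its size
    (∃ (P : SafeSet.Prog) (p : Polynomial ℕ), ∀ (n : ℕ) (G : SimpleGraph (Fin n)), 0 < n →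
      ∃ (s : SafeSet.State) (t : ℕ),
        SafeSet.Exec P (SafeSet.inputState G 0) s t ∧
        t ≤ 2 ^ SafeSet.safeNumber G * SafeSet.safeNumber G ^ (3 * SafeSet.safeNumber G) *
          p.eval n ∧
        SafeSet.IsSafeSet G (SafeSet.outputSet n s) ∧
        (SafeSet.outputSet n s).ncard = SafeSet.safeNumber G) :=
  ⟨SafeSet.exists_decision_program, SafeSet.exists_optimization_program⟩
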